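/- Let $R$ be a commutative ring with unit. For $r\ge 0$, an \emph{$r$-bigraded complex} is a family of $R$-modules $A=\{A^{p,n}\}_{p,n\in\mathbb Z}$ with $R$-linear maps $d\colon A^{p,n}\to A^{p-r,n+1-r}$ such that $d^2=0$; morphisms are the bidegree-preserving $R$-linear maps commuting with $d$, and $H(A)$ is the bigraded homology. An \emph{extended spectral sequence} $X$ is a family of $r$-bigraded complexes $(X_r,d_r)$, $r\ge 0$, with maps of bigraded modules $\varphi_{r+1}\colon X_{r+1}\to H(X_r)$, $r\ge 0$ (not required to be isomorphisms); a morphism is a family $f_r\colon X_r\to Y_r$ of morphisms of $r$-bigraded complexes with $\varphi_{r+1}f_{r+1}=H(f_r)\varphi_{r+1}$. Let $\mathrm{eSpSe}$ be the resulting category. Let $T$ be the translation isomorphism from $r$-bigraded to $(r+1)$-bigraded complexes, $(TA)^{p,n}=A^{n,2n-p}$ with the differential of $A$. For $X$ in $\mathrm{eSpSe}$, let $(NX)_1$ be the $1$-bigraded complex with $(NX)_1^{p,n}$ the module of all $(x_0,x_1;y_0,y_1)$ with $x_i\in X_i^{p,n}$, $y_i\in X_i^{p-1,n}$, $d_0x_0=0$,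 $d_0y_0=0$, $\varphi_1(x_1)=[x_0]$, $\varphi_1(y_1)=[y_0]$, $d_1x_1=y_1$, and with differential $(x_0,x_1;y_0,y_1)\mapsto(y_0,y_1;0,0)$; the projection $\rho\colon (NX)_1\to X_1$, $(x_0,x_1;y_0,y_1)\mapsto x_1$, is a quasi-isomorphism. Let $\operatorname{Cone}_1(X_0)^{p,n}=X_0^{p,n}\oplus X_0^{p+1,n}$ with $d(a,b)=(0,a)$, and let $q\colon (NX)_1^{p+1,n}\to\operatorname{Cone}_1(X_0)^{p,n}$, $q(x_0,x_1;y_0,y_1)=(-y_0,x_0)$; its image is a subcomplex. Define functors $\operatorname{Shift},\operatorname{Dec},\operatorname{LDec}\colon\mathrm{eSpSe}\to\mathrm{eSpSe}$ as follows. (a) $\operatorname{Shift}(X)_0$ is the bigraded module $TX_0$ with zero differential and $\operatorname{Shift}(X)_{i+1}=TX_i$ for $i\ge 0$; the first characteristic map is the identity of $TX_0$ and the others are the translates of those of $X$. (b) $\operatorname{Dec}(X)_0=T^{-1}(NX)_1$ and $\operatorname{Dec}(X)_i=T^{-1}X_{i+1}$ for $i\ge 1$; the first characteristic map is the translate of $X_2\xrightarrow{\varphi_2}H(X_1)\xrightarrow{H(\rho)^{-1}}H((NX)_1)$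 and the others are the translates of those of $X$. (c) $\operatorname{LDec}(X)_0=T^{-1}(\operatorname{Cone}_1(X_0)/\operatorname{Im}q)$ and $\operatorname{LDec}(X)_i=T^{-1}X_{i+1}$ for $i\ge 1$; the first characteristic map is the translate of the composite of $H(\rho)^{-1}\varphi_2$ with the map $H((NX)_1)\to H(\operatorname{Cone}_1(X_0)/\operatorname{Im}q)$ induced by $(x_0,x_1;y_0,y_1)\mapsto\overline{(x_0,0)}$, and the others are the translates of those of $X$. There are adjunctions $\operatorname{LDec}\dashv\operatorname{Shift}\dashv\operatorname{Dec}$. The category $\mathrm{eSpSe}$ has all small limits and colimits, and for every $r\ge0$ it has a model structure $\mathrm{eSpSe}'_r$ in which a morphism $f$ is a fibration if and only if $f_i$ is bidegreewise surjective for $0\le i\le r$, a weak equivalence if and only if $f_r$ is a quasi-isomorphism and $f_i$ is an isomorphism for all $i>r$, and a cofibration if and only if it has the left lifting property with respect to the fibrations that are weak equivalences. \textbf{Proposition.} For every $r\ge 0$: (1) the adjunction $\operatorname{Shift}\dashv\operatorname{Dec}$ is a Quillen equivalence between $\mathrm{eSpSe}'_r$ and $\mathrm{eSpSe}'_{r+1}$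 (with $\operatorname{Shift}\colon \mathrm{eSpSe}'_r\to\mathrm{eSpSe}'_{r+1}$ the left adjoint); (2) the adjunction $\operatorname{LDec}\dashv\operatorname{Shift}$ is a Quillen equivalence between $\mathrm{eSpSe}'_{r+1}$ and $\mathrm{eSpSe}'_r$ (with $\operatorname{LDec}\colon \mathrm{eSpSe}'_{r+1}\to\mathrm{eSpSe}'_r$ the left adjoint). -/

import Mathlib

open CategoryTheory HomotopicalAlgebra

universe u

noncomputable section

/-- The shape of an `r`-bigraded complex: bidegrees are pairs `(p, n)` of integers, and the
differential goes from `(p, n)` to `(p - r, n + 1 - r)`. -/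
abbrev pageShape (r : ℕ) : ComplexShape (ℤ × ℤ) := ComplexShape.up' (-(r : ℤ), 1 - (r : ℤ))

/-- The category of `r`-bigraded complexes of `R`-modules. -/
abbrev BiComplex (R : Type u) [CommRing R] (r : ℕ) := HomologicalComplex (ModuleCat.{u} R) (pageShape r)

lemma pageShape_rel {r : ℕ} {i j : ℤ × ℤ} :
    (pageShape r).Rel i j ↔ j = (i.1 - r, i.2 + 1 - r) := by
  obtain ⟨p, n⟩ := i
  obtain ⟨p', n'⟩ := j
  simp only [ComplexShape.up'_Rel, Prod.mk_add_mk, Prod.mk.injEq]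
  omega

/-- An extended spectral sequence: for every `r ≥ 0` an `r`-bigraded complex `page r`, and
characteristic maps of bigraded modules from `page (r + 1)` to the homology of `page r`. -/
structure ESpSe (R : Type u) [CommRing R] where
  page (r : ℕ) : BiComplex R r
  φ (r : ℕ) (i : ℤ × ℤ) : (page (r + 1)).X i ⟶ (page r).homology i

namespace ESpSe

variable {R : Type u} [CommRing R]

/-- Morphisms of extended spectral sequences: morphisms of `r`-bigraded complexes for all `r`,
compatible with the characteristic maps. -/
@[ext]
structure Hom (X Y : ESpSe R) where
  page (r : ℕ) : X.page r ⟶ Y.page r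
  comm (r : ℕ) (i : ℤ × ℤ) :
    (page (r + 1)).f i ≫ Y.φ r i = X.φ r i ≫ HomologicalComplex.homologyMap (page r) i

instance : Category (ESpSe R) where
  Hom := Hom
  id X := { page := fun r => 𝟙 (X.page r), comm := by intros; simp }
  comp f g :=
    { page := fun r => f.page r ≫ g.page r
      comm := by
        intro r i
        rw [HomologicalComplex.comp_f, Category.assoc, g.comm, ← Category.assoc, f.comm,
          HomologicalComplex.homologyMap_comp, Category.assoc] }

@[ext]
lemma hom_ext {X Y : ESpSe R} {f g : X ⟶ Y} (h : ∀ r, f.page r = g.page r) : f = g :=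
  Hom.ext (funext h)

@[simp]
lemma id_page (X : ESpSe R) (r : ℕ) : Hom.page (𝟙 X) r = 𝟙 (X.page r) := rfl

@[simp]
lemma comp_page {X Y Z : ESpSe R} (f : X ⟶ Y) (g : Y ⟶ Z) (r : ℕ) :
    Hom.page (f ≫ g) r = f.page r ≫ g.page r := rfl

/-! ### Elements of homology modules -/

section Elements

variable {c : ComplexShape (ℤ × ℤ)} (K : HomologicalComplex (ModuleCat.{u} R) c)

lemma homologyπ_surjective (i : ℤ × ℤ) : Function.Surjective (K.homologyπ i) :=
  (ModuleCat.epi_iff_surjective _).1 inferInstance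

lemma iCycles_injective (i : ℤ × ℤ) : Function.Injective (K.iCycles i) :=
  (ModuleCat.mono_iff_injective _).1 inferInstance

lemma d_iCycles {i : ℤ × ℤ} (j : ℤ × ℤ) (z : K.cycles i) : K.d i j (K.iCycles i z) = 0 := by
  rw [← ConcreteCategory.comp_apply, K.iCycles_d]
  rfl

lemma exists_cycle {i j : ℤ × ℤ} (hij : c.Rel i j) (x : K.X i) (hx : K.d i j x = 0) :
    ∃ z : K.cycles i, K.iCycles i z = x := by
  have h := ShortComplex.exact_of_f_is_kernel (ShortComplex.mk _ _ (K.iCycles_d i j))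
    (K.cyclesIsKernel i j (c.next_eq' hij))
  rw [ShortComplex.moduleCat_exact_iff] at h
  exact h x hx

lemma homologyπ_eq_zero_iff {i j : ℤ × ℤ} (hij : c.Rel i j) (z : K.cycles j) :
    K.homologyπ j z = 0 ↔ ∃ w : K.X i, K.d i j w = K.iCycles j z := by
  have h := ShortComplex.exact_of_g_is_cokernel (ShortComplex.mk _ _ (K.toCycles_comp_homologyπ i j))
    (K.homologyIsCokernel i j (c.prev_eq' hij))
  rw [ShortComplex.moduleCat_exact_iff] at h
  constructor
  · intro hz
    obtain ⟨w, hw⟩ := h z hz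
    refine ⟨w, ?_⟩
    have : K.toCycles i j w = z := hw
    rw [← this, ← ConcreteCategory.comp_apply, K.toCycles_i]
  · rintro ⟨w, hw⟩
    have : K.toCycles i j w = z := by
      apply iCycles_injective
      rw [← hw, ← ConcreteCategory.comp_apply, K.toCycles_i]
    rw [← this, ← ConcreteCategory.comp_apply, K.toCycles_comp_homologyπ]
    rfl

variable {K} {L : HomologicalComplex (ModuleCat.{u} R) c}

lemma homologyMap_homologyπ (f : K ⟶ L) (i : ℤ × ℤ) (z : K.cycles i) :
    HomologicalComplex.homologyMap f i (K.homologyπ i z) =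
      L.homologyπ i (HomologicalComplex.cyclesMap f i z) := by
  rw [← ConcreteCategory.comp_apply, HomologicalComplex.homologyπ_naturality,
    ConcreteCategory.comp_apply]

lemma iCycles_cyclesMap (f : K ⟶ L) (i : ℤ × ℤ) (z : K.cycles i) :
    L.iCycles i (HomologicalComplex.cyclesMap f i z) = f.f i (K.iCycles i z) := by
  rw [← ConcreteCategory.comp_apply, HomologicalComplex.cyclesMap_i, ConcreteCategory.comp_apply]

lemma comm_apply (f : K ⟶ L) (i j : ℤ × ℤ) (x : K.X i) :
    L.d i j (f.f i x) = f.f j (K.d i j x) := by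
  rw [← ConcreteCategory.comp_apply, f.comm, ConcreteCategory.comp_apply]

end Elements

/-! ### Transport along equalities of bidegrees -/

/-- The canonical identification of `K.X i` with `K.X j` if `i = j`, and zero otherwise. -/
def tr {c : ComplexShape (ℤ × ℤ)} (K : HomologicalComplex (ModuleCat.{u} R) c) (i j : ℤ × ℤ) :
    K.X i ⟶ K.X j :=
  if h : i = j then (K.XIsoOfEq h).hom else 0

section Tr

variable {c : ComplexShape (ℤ × ℤ)} {K L : HomologicalComplex (ModuleCat.{u} R) c}

@[simp]
lemma tr_self (i : ℤ × ℤ) : tr K i i = 𝟙 (K.X i) := by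
  simp [tr]

lemma tr_of_ne {i j : ℤ × ℤ} (h : i ≠ j) : tr K i j = 0 := by
  simp [tr, h]

lemma tr_naturality (f : K ⟶ L) (i j : ℤ × ℤ) (x : K.X i) :
    tr L i j (f.f i x) = f.f j (tr K i j x) := by
  by_cases h : i = j
  · subst h
    simp
  · simp [tr_of_ne h]

end Tr

/-! ### The first page of the nerve of an extended spectral sequence -/

/-- `x ∈ X_r` and `x' ∈ X_{r+1}` are compatible: `x` is a cycle and `φ x' = [x]`. -/
def Compat (X : ESpSe R) (r : ℕ) (i : ℤ × ℤ) (x : (X.page r).X i) (x' : (X.page (r + 1)).X i) :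
    Prop :=
  ∃ z : (X.page r).cycles i, (X.page r).iCycles i z = x ∧ (X.page r).homologyπ i z = X.φ r i x'

section Compat

variable {X Y : ESpSe R} {r : ℕ} {i : ℤ × ℤ}

lemma Compat.zero : Compat X r i 0 0 := ⟨0, by simp, by simp⟩

lemma Compat.add {x y : (X.page r).X i} {x' y' : (X.page (r + 1)).X i}
    (h : Compat X r i x x') (h' : Compat X r i y y') : Compat X r i (x + y) (x' + y') := by
  obtain ⟨z, rfl, hz⟩ := h
  obtain ⟨w, rfl, hw⟩ := h'
  exact ⟨z + w, by simp, by simp [hz, hw]⟩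

lemma Compat.smul {x : (X.page r).X i} {x' : (X.page (r + 1)).X i} (a : R)
    (h : Compat X r i x x') : Compat X r i (a • x) (a • x') := by
  obtain ⟨z, rfl, hz⟩ := h
  exact ⟨a • z, by simp, by simp [hz]⟩

lemma Compat.map (f : X ⟶ Y) {x : (X.page r).X i} {x' : (X.page (r + 1)).X i}
    (h : Compat X r i x x') : Compat Y r i ((f.page r).f i x) ((f.page (r + 1)).f i x') := by
  obtain ⟨z, rfl, hz⟩ := h
  refine ⟨HomologicalComplex.cyclesMap (f.page r) i z, iCycles_cyclesMap _ _ _, ?_⟩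
  rw [← homologyMap_homologyπ, hz, ← ConcreteCategory.comp_apply, ← ConcreteCategory.comp_apply,
    f.comm]

lemma Compat.tr {x : (X.page r).X i} {x' : (X.page (r + 1)).X i} (h : Compat X r i x x')
    (j : ℤ × ℤ) : Compat X r j (ESpSe.tr _ i j x) (ESpSe.tr _ i j x') := by
  by_cases hij : i = j
  · subst hij
    simpa using h
  · simpa [tr_of_ne hij] using Compat.zero

lemma Compat.exists_left (x' : (X.page (r + 1)).X i) : ∃ x, Compat X r i x x' := by
  obtain ⟨z, hz⟩ := homologyπ_surjective (X.page r) i (X.φ r i x')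
  exact ⟨_, z, rfl, hz⟩

end Compat

/-- The target bidegree of the differential of a `1`-bigraded complex starting at `i`. -/
def tgt (i : ℤ × ℤ) : ℤ × ℤ := (i.1 - 1, i.2)

/-- The source bidegree of the differential of a `1`-bigraded complex arriving at `i`. -/
def src (i : ℤ × ℤ) : ℤ × ℤ := (i.1 + 1, i.2)

@[simp]
lemma tgt_src (i : ℤ × ℤ) : tgt (src i) = i := by simp [tgt, src]

@[simp]
lemma src_tgt (i : ℤ × ℤ) : src (tgt i) = i := by simp [tgt, src]

lemma rel_one_iff {i j : ℤ × ℤ} : (pageShape 1).Rel i j ↔ tgt i = j := by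
  rw [pageShape_rel, tgt, eq_comm]
  simp

/-- The module `(N X)_1` in bidegree `i`: pairs `(x₀, x₁; y₀, y₁)` of compatible sequences, the
first in bidegree `i` and the second in the bidegree `tgt i`, with `d₁ x₁ = y₁`. -/
def nerveModule (X : ESpSe R) (i : ℤ × ℤ) : Submodule R
    ((X.page 0).X i × (X.page 1).X i × (X.page 0).X (tgt i) × (X.page 1).X (tgt i)) where
  carrier := {v | Compat X 0 i v.1 v.2.1 ∧ Compat X 0 (tgt i) v.2.2.1 v.2.2.2 ∧
    (X.page 1).d i (tgt i) v.2.1 = v.2.2.2}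
  add_mem' := by
    rintro v w ⟨h₁, h₂, h₃⟩ ⟨k₁, k₂, k₃⟩
    exact ⟨h₁.add k₁, h₂.add k₂, by simp [h₃, k₃]⟩
  zero_mem' := ⟨Compat.zero, Compat.zero, by simp⟩
  smul_mem' := by
    rintro a v ⟨h₁, h₂, h₃⟩
    exact ⟨h₁.smul a, h₂.smul a, by simp [h₃]⟩

/-- The differential `(x₀, x₁; y₀, y₁) ↦ (y₀, y₁; 0, 0)` of `(N X)_1`. -/
def nerveD (X : ESpSe R) (i j : ℤ × ℤ) : X.nerveModule i →ₗ[R] X.nerveModule j where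
  toFun v := ⟨(tr _ (tgt i) j v.1.2.2.1, tr _ (tgt i) j v.1.2.2.2, 0, 0),
    v.2.2.1.tr j, Compat.zero, by
      have h : (X.page 1).d i (tgt i) v.1.2.1 = v.1.2.2.2 := v.2.2.2
      by_cases hij : tgt i = j
      · subst hij
        simp only [tr_self, ModuleCat.id_apply]
        rw [← h, ← ConcreteCategory.comp_apply, (X.page 1).d_comp_d]
        rfl
      · simp [tr_of_ne hij]⟩
  map_add' v w := by ext <;> simp
  map_smul' a v := by ext <;> simp

/-- The `1`-bigraded complex `(N X)_1`. -/
def nerve (X : ESpSe R) : BiComplex R 1 where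
  X i := ModuleCat.of R (X.nerveModule i)
  d i j := ModuleCat.ofHom (X.nerveD i j)
  shape i j hij := by
    have h : tgt i ≠ j := fun h => hij (rel_one_iff.2 h)
    refine ModuleCat.hom_ext (LinearMap.ext fun v => Subtype.ext ?_)
    change (tr _ (tgt i) j v.1.2.2.1, tr _ (tgt i) j v.1.2.2.2, 0, 0) = 0
    simp [tr_of_ne h]
  d_comp_d' i j k _ _ := by
    refine ModuleCat.hom_ext (LinearMap.ext fun v => Subtype.ext ?_)
    change (tr (X.page 0) (tgt j) k 0, tr (X.page 1) (tgt j) k 0, 0, 0) = 0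
    simp

/-- The functoriality of `(N X)_1`, componentwise. -/
def nerveMapLin {X Y : ESpSe R} (f : X ⟶ Y) (i : ℤ × ℤ) :
    X.nerveModule i →ₗ[R] Y.nerveModule i where
  toFun v := ⟨((f.page 0).f i v.1.1, (f.page 1).f i v.1.2.1,
      (f.page 0).f (tgt i) v.1.2.2.1, (f.page 1).f (tgt i) v.1.2.2.2),
    v.2.1.map f, v.2.2.1.map f, by
      have h : (X.page 1).d i (tgt i) v.1.2.1 = v.1.2.2.2 := v.2.2.2
      change (Y.page 1).d i (tgt i) ((f.page 1).f i v.1.2.1) = (f.page 1).f (tgt i) v.1.2.2.2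
      rw [comm_apply, h]⟩
  map_add' v w := by ext <;> simp
  map_smul' a v := by ext <;> simp

/-- The functoriality of `(N X)_1`. -/
def nerveMap {X Y : ESpSe R} (f : X ⟶ Y) : X.nerve ⟶ Y.nerve where
  f i := ModuleCat.ofHom (nerveMapLin f i)
  comm' i j _ := by
    refine ModuleCat.hom_ext (LinearMap.ext fun v => Subtype.ext ?_)
    change (tr _ (tgt i) j ((f.page 0).f _ v.1.2.2.1), tr _ (tgt i) j ((f.page 1).f _ v.1.2.2.2),
        0, 0) = ((f.page 0).f j (tr _ (tgt i) j v.1.2.2.1),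
      (f.page 1).f j (tr _ (tgt i) j v.1.2.2.2), (f.page 0).f _ 0, (f.page 1).f _ 0)
    rw [tr_naturality, tr_naturality, map_zero, map_zero]

lemma nerveMap_id (X : ESpSe R) : nerveMap (𝟙 X) = 𝟙 X.nerve := by
  ext i : 1
  rfl

lemma nerveMap_comp {X Y Z : ESpSe R} (f : X ⟶ Y) (g : Y ⟶ Z) :
    nerveMap (f ≫ g) = nerveMap f ≫ nerveMap g := by
  ext i : 1
  rfl

/-- The projection `ρ : (N X)_1 ⟶ X_1`, `(x₀, x₁; y₀, y₁) ↦ x₁`. -/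
def ρ (X : ESpSe R) : X.nerve ⟶ X.page 1 where
  f i := ModuleCat.ofHom
    { toFun := fun v : X.nerveModule i => v.1.2.1
      map_add' := fun _ _ => rfl
      map_smul' := fun _ _ => rfl }
  comm' i j hij := by
    obtain rfl := rel_one_iff.1 hij
    refine ModuleCat.hom_ext (LinearMap.ext fun v => ?_)
    have h : (X.page 1).d i (tgt i) v.1.2.1 = v.1.2.2.2 := v.2.2.2
    change (X.page 1).d i (tgt i) v.1.2.1 = tr (X.page 1) (tgt i) (tgt i) v.1.2.2.2
    rw [h, tr_self]
    rfl

lemma ρ_naturality {X Y : ESpSe R} (f : X ⟶ Y) : nerveMap f ≫ ρ Y = ρ X ≫ f.page 1 := by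
  ext i : 1
  rfl

/-- `ρ` induces an isomorphism in homology. -/
instance ρ_homology_isIso (X : ESpSe R) (j : ℤ × ℤ) :
    IsIso (HomologicalComplex.homologyMap (ρ X) j) := by
  rw [ConcreteCategory.isIso_iff_bijective]
  constructor
  · rw [injective_iff_map_eq_zero]
    intro a ha
    obtain ⟨z, rfl⟩ := homologyπ_surjective _ _ a
    have hij : (pageShape 1).Rel (src j) j := rel_one_iff.2 (tgt_src j)
    obtain ⟨i, hi⟩ : ∃ i, tgt i = j := ⟨src j, tgt_src j⟩
    subst hi
    have hij : (pageShape 1).Rel i (tgt i) := rel_one_iff.2 rfl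
    rw [homologyMap_homologyπ, homologyπ_eq_zero_iff _ hij, iCycles_cyclesMap] at ha
    obtain ⟨w, hw⟩ := ha
    rw [homologyπ_eq_zero_iff _ hij]
    obtain ⟨w₀, hw₀⟩ := Compat.exists_left (X := X) (r := 0) w
    have hz := d_iCycles X.nerve (tgt (tgt i)) z
    generalize X.nerve.iCycles (tgt i) z = n at hw hz
    have hz' := congrArg Subtype.val hz
    change (tr _ (tgt (tgt i)) _ n.1.2.2.1, tr _ (tgt (tgt i)) _ n.1.2.2.2, 0, 0) = 0 at hz'
    have h₁ : n.1.2.2.1 = 0 := by simpa using congrArg Prod.fst hz'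
    have h₂ : n.1.2.2.2 = 0 := by simpa using congrArg (fun t => t.2.1) hz'
    change (X.page 1).d i (tgt i) w = n.1.2.1 at hw
    refine ⟨⟨(w₀, w, n.1.1, n.1.2.1), hw₀, n.2.1, hw⟩, Subtype.ext ?_⟩
    change (tr (X.page 0) (tgt i) (tgt i) n.1.1, tr (X.page 1) (tgt i) (tgt i) n.1.2.1, 0, 0) = n.1
    rw [tr_self, tr_self]
    exact Prod.ext rfl (Prod.ext rfl (Prod.ext h₁.symm h₂.symm))
  · intro b
    obtain ⟨z, rfl⟩ := homologyπ_surjective _ _ b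
    have hij : (pageShape 1).Rel j (tgt j) := rel_one_iff.2 rfl
    obtain ⟨x₀, hx₀⟩ := Compat.exists_left (X := X) (r := 0) ((X.page 1).iCycles j z)
    obtain ⟨t, ht⟩ := exists_cycle X.nerve hij
      ⟨(x₀, (X.page 1).iCycles j z, 0, 0), hx₀, Compat.zero, d_iCycles _ _ z⟩ (by
        refine Subtype.ext ?_
        change (tr (X.page 0) (tgt j) (tgt j) 0, tr (X.page 1) (tgt j) (tgt j) 0, 0, 0) = 0
        simp)
    refine ⟨X.nerve.homologyπ j t, ?_⟩
    rw [homologyMap_homologyπ]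
    congr 1
    apply iCycles_injective
    rw [iCycles_cyclesMap, ht]
    rfl

/-! ### The cokernel of `q` -/

/-- The differential `(a, b) ↦ (0, a)` of the `1`-cone of `X_0`, which in bidegree `i` is
`X_0 i × X_0 (src i)`. -/
def coneD (X : ESpSe R) (i j : ℤ × ℤ) :
    ((X.page 0).X i × (X.page 0).X (src i)) →ₗ[R] ((X.page 0).X j × (X.page 0).X (src j)) where
  toFun v := (0, tr _ i (src j) v.1)
  map_add' v w := by simp
  map_smul' a v := by simp

/-- The map `q : (N X)_1 → Cone_1(X_0)`, `(x₀, x₁; y₀, y₁) ↦ (-y₀, x₀)`. -/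
def q (X : ESpSe R) (i : ℤ × ℤ) :
    X.nerveModule (src i) →ₗ[R] ((X.page 0).X i × (X.page 0).X (src i)) where
  toFun v := (-tr _ (tgt (src i)) i v.1.2.2.1, v.1.1)
  map_add' v w := by simp [add_comm]
  map_smul' a v := by simp

lemma coneD_q (X : ESpSe R) (i j : ℤ × ℤ) (v : X.nerveModule (src i)) :
    X.coneD i j (X.q i v) = - X.q j (X.nerveD (src i) (src j) v) := by
  change ((0 : (X.page 0).X j), tr (X.page 0) i (src j) (-tr _ (tgt (src i)) i v.1.2.2.1)) =
    (- -tr (X.page 0) (tgt (src j)) j 0, - tr _ (tgt (src i)) (src j) v.1.2.2.1)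
  have h : ∀ (k : ℤ × ℤ) (hk : k = i) (y : (X.page 0).X k),
      tr (X.page 0) i (src j) (tr (X.page 0) k i y) = tr (X.page 0) k (src j) y := by
    rintro k rfl y
    simp
  simp [h _ (tgt_src i)]

/-- The differential induced by that of the cone on the quotient by the image of `q`. -/
def cokerD (X : ESpSe R) (i j : ℤ × ℤ) :
    (((X.page 0).X i × (X.page 0).X (src i)) ⧸ LinearMap.range (X.q i)) →ₗ[R]
      (((X.page 0).X j × (X.page 0).X (src j)) ⧸ LinearMap.range (X.q j)) :=
  Submodule.mapQ _ _ (X.coneD i j) (by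
    rintro _ ⟨v, rfl⟩
    rw [Submodule.mem_comap, coneD_q]
    exact neg_mem (LinearMap.mem_range_self _ _))

/-- The `1`-bigraded complex `Cone_1(X_0) / Im q`. -/
def coker (X : ESpSe R) : BiComplex R 1 where
  X i := ModuleCat.of R (((X.page 0).X i × (X.page 0).X (src i)) ⧸ LinearMap.range (X.q i))
  d i j := ModuleCat.ofHom (X.cokerD i j)
  shape i j hij := by
    have h : i ≠ src j := fun h => hij (rel_one_iff.2 (by rw [h, tgt_src]))
    refine ModuleCat.hom_ext (Submodule.linearMap_qext _ (LinearMap.ext fun v => ?_))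
    change Submodule.Quotient.mk (0, tr (X.page 0) i (src j) v.1) = 0
    rw [tr_of_ne h]
    exact Submodule.Quotient.mk_zero _
  d_comp_d' i j k _ _ := by
    refine ModuleCat.hom_ext (Submodule.linearMap_qext _ (LinearMap.ext fun v => ?_))
    change Submodule.Quotient.mk (0, tr (X.page 0) j (src k) 0) = 0
    rw [map_zero]
    exact Submodule.Quotient.mk_zero _

lemma prodMap_q {X Y : ESpSe R} (f : X ⟶ Y) (i : ℤ × ℤ) (v : X.nerveModule (src i)) :
    LinearMap.prodMap ((f.page 0).f i).hom ((f.page 0).f (src i)).hom (X.q i v) =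
      Y.q i (nerveMapLin f (src i) v) := by
  change ((f.page 0).f i (-tr _ (tgt (src i)) i v.1.2.2.1), _) =
    (-tr _ (tgt (src i)) i ((f.page 0).f (tgt (src i)) v.1.2.2.1), _)
  rw [map_neg, tr_naturality]
  rfl

/-- The functoriality of `Cone_1(X_0) / Im q`. -/
def cokerMap {X Y : ESpSe R} (f : X ⟶ Y) : X.coker ⟶ Y.coker where
  f i := ModuleCat.ofHom (Submodule.mapQ _ _
    (LinearMap.prodMap ((f.page 0).f i).hom ((f.page 0).f (src i)).hom) (by
      rintro _ ⟨v, rfl⟩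
      rw [Submodule.mem_comap, prodMap_q]
      exact LinearMap.mem_range_self _ _))
  comm' i j _ := by
    refine ModuleCat.hom_ext (Submodule.linearMap_qext _ (LinearMap.ext fun v => ?_))
    change Submodule.Quotient.mk (0, tr (Y.page 0) i (src j) ((f.page 0).f i v.1)) =
      Submodule.Quotient.mk ((f.page 0).f j 0, (f.page 0).f (src j) (tr _ i (src j) v.1))
    rw [tr_naturality, map_zero]

lemma cokerMap_id (X : ESpSe R) : cokerMap (𝟙 X) = 𝟙 X.coker := by
  ext i : 1
  exact ModuleCat.hom_ext (Submodule.linearMap_qext _ (LinearMap.ext fun v => rfl))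

lemma cokerMap_comp {X Y Z : ESpSe R} (f : X ⟶ Y) (g : Y ⟶ Z) :
    cokerMap (f ≫ g) = cokerMap f ≫ cokerMap g := by
  ext i : 1
  exact ModuleCat.hom_ext (Submodule.linearMap_qext _ (LinearMap.ext fun v => rfl))

/-- The morphism of complexes `(N X)_1 ⟶ Cone_1(X_0) / Im q` which sends `(x₀, x₁; y₀, y₁)` to the
class of `(x₀, 0)`. In homology, it is the projection `H((N X)_1) ⟶ H((N X)_1 / Ker q)` followed by
the inverse of the connecting isomorphism of the extension
`0 ⟶ Σ (N X)_1 / Ker q ⟶ Cone_1(X_0) ⟶ Cone_1(X_0) / Im q ⟶ 0`. -/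
def κ (X : ESpSe R) : X.nerve ⟶ X.coker where
  f i := ModuleCat.ofHom
    { toFun := fun v : X.nerveModule i => Submodule.Quotient.mk (v.1.1, 0)
      map_add' := fun v w => by
        rw [← Submodule.Quotient.mk_add]
        simp
      map_smul' := fun a v => by
        rw [RingHom.id_apply, ← Submodule.Quotient.mk_smul]
        simp }
  comm' i j hij := by
    obtain rfl : i = src j := by rw [← rel_one_iff.1 hij, src_tgt]
    refine ModuleCat.hom_ext (LinearMap.ext fun v => ?_)
    change Submodule.Quotient.mk (0, tr (X.page 0) (src j) (src j) v.1.1) =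
      Submodule.Quotient.mk (tr (X.page 0) (tgt (src j)) j v.1.2.2.1, 0)
    rw [tr_self]
    refine (Submodule.Quotient.eq _).2 ⟨v, ?_⟩
    change (-tr _ (tgt (src j)) j v.1.2.2.1, v.1.1) = _
    simp

lemma κ_naturality {X Y : ESpSe R} (f : X ⟶ Y) : nerveMap f ≫ κ Y = κ X ≫ cokerMap f := by
  ext i : 1
  refine ModuleCat.hom_ext (LinearMap.ext fun v => ?_)
  change Submodule.Quotient.mk ((f.page 0).f i v.1.1, 0) =
    Submodule.Quotient.mk ((f.page 0).f i v.1.1, (f.page 0).f (src i) 0)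
  rw [map_zero]

/-! ### Translation -/

/-- The reindexing `(p, n) ↦ (n, 2n - p)` defining the translation functor `T` from `r`-bigraded
complexes to `(r + 1)`-bigraded complexes, `(T A)^{p, n} = A^{n, 2n - p}`. -/
def transEmb (r : ℕ) : (pageShape (r + 1)).Embedding (pageShape r) :=
  ComplexShape.Embedding.mk' _ _ (fun i => (i.2, 2 * i.2 - i.1))
    (by
      rintro ⟨p, n⟩ ⟨p', n'⟩ h
      simp only [Prod.mk.injEq] at h ⊢
      omega)
    (by
      rintro ⟨p, n⟩ ⟨p', n'⟩
      simp only [pageShape_rel, Prod.mk.injEq]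
      push_cast
      omega)

instance (r : ℕ) : (transEmb r).IsRelIff where
  rel' := by
    rintro ⟨p, n⟩ ⟨p', n'⟩ h
    change (pageShape r).Rel (n, 2 * n - p) (n', 2 * n' - p') at h
    simp only [pageShape_rel, Prod.mk.injEq] at h ⊢
    push_cast
    omega

/-- The inverse reindexing `(p, n) ↦ (2p - n, p)`, defining the inverse `T⁻¹` of the translation
functor, `(T⁻¹ B)^{p, n} = B^{2p - n, p}`. -/
def invTransEmb (r : ℕ) : (pageShape r).Embedding (pageShape (r + 1)) :=
  ComplexShape.Embedding.mk' _ _ (fun i => (2 * i.1 - i.2, i.1))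
    (by
      rintro ⟨p, n⟩ ⟨p', n'⟩ h
      simp only [Prod.mk.injEq] at h ⊢
      omega)
    (by
      rintro ⟨p, n⟩ ⟨p', n'⟩
      simp only [pageShape_rel, Prod.mk.injEq]
      push_cast
      omega)

instance (r : ℕ) : (invTransEmb r).IsRelIff where
  rel' := by
    rintro ⟨p, n⟩ ⟨p', n'⟩ h
    change (pageShape (r + 1)).Rel (2 * p - n, p) (2 * p' - n', p') at h
    simp only [pageShape_rel, Prod.mk.injEq] at h ⊢
    push_cast at h
    omega

/-- The reindexing `(p, n) ↦ (2p - n, p)` from `0`-bigraded to `1`-bigraded complexes. -/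
abbrev invTransEmbZero : (pageShape 0).Embedding (pageShape 1) := invTransEmb 0

instance : invTransEmbZero.IsRelIff := inferInstanceAs (invTransEmb 0).IsRelIff

@[simp]
lemma transEmb_f (r : ℕ) (i : ℤ × ℤ) : (transEmb r).f i = (i.2, 2 * i.2 - i.1) := rfl

@[simp]
lemma invTransEmb_f (r : ℕ) (i : ℤ × ℤ) : (invTransEmb r).f i = (2 * i.1 - i.2, i.1) := rfl

section Restriction

variable {r s : ℕ} (e : (pageShape r).Embedding (pageShape s)) [e.IsRelIff]

/-- The homology of a reindexed complex is the reindexed homology. -/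
def resIso (K : BiComplex R s) (j : ℤ × ℤ) : (K.restriction e).homology j ≅ K.homology (e.f j) :=
  have hi : (pageShape r).Rel (j.1 + r, j.2 + r - 1) j := pageShape_rel.2 (by ext <;> simp)
  have hk : (pageShape r).Rel j (j.1 - r, j.2 + 1 - r) := pageShape_rel.2 rfl
  K.restrictionHomologyIso e _ j _ ((pageShape r).prev_eq' hi) ((pageShape r).next_eq' hk)
    rfl rfl rfl ((pageShape s).prev_eq' (e.rel hi)) ((pageShape s).next_eq' (e.rel hk))

lemma resIso_hom_naturality {K L : BiComplex R s} (f : K ⟶ L) (j : ℤ × ℤ) :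
    HomologicalComplex.homologyMap (HomologicalComplex.restrictionMap f e) j ≫ (resIso e L j).hom =
      (resIso e K j).hom ≫ HomologicalComplex.homologyMap f (e.f j) := by
  rw [← cancel_epi ((K.restriction e).homologyπ j), HomologicalComplex.homologyπ_naturality_assoc,
    resIso, resIso, HomologicalComplex.homologyπ_restrictionHomologyIso_hom,
    HomologicalComplex.homologyπ_restrictionHomologyIso_hom_assoc,
    HomologicalComplex.homologyπ_naturality, ← Category.assoc, ← Category.assoc]
  congr 1
  rw [← cancel_mono (L.iCycles _)]
  simp only [Category.assoc, HomologicalComplex.restrictionCyclesIso_hom_iCycles,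
    HomologicalComplex.cyclesMap_i_assoc, HomologicalComplex.cyclesMap_i,
    HomologicalComplex.restrictionCyclesIso_hom_iCycles_assoc]
  exact congrArg ((K.restriction e).iCycles j ≫ ·)
    ((Category.comp_id (f.f (e.f j))).trans (Category.id_comp (f.f (e.f j))).symm)

lemma resIso_inv_naturality {K L : BiComplex R s} (f : K ⟶ L) (j : ℤ × ℤ) :
    HomologicalComplex.homologyMap f (e.f j) ≫ (resIso e L j).inv =
      (resIso e K j).inv ≫
        HomologicalComplex.homologyMap (HomologicalComplex.restrictionMap f e) j := by
  rw [Iso.comp_inv_eq, Category.assoc, resIso_hom_naturality, Iso.inv_hom_id_assoc]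

end Restriction

/-! ### The functor `Shift` -/

/-- Page `0` of `Shift X`: the bigraded module `(p, n) ↦ X_0^{n, 2n - p}` with zero differential. -/
def shiftZero (X : ESpSe R) : BiComplex R 0 where
  X i := (X.page 0).X (i.2, 2 * i.2 - i.1)
  d _ _ := 0

/-- The functoriality of page `0` of `Shift X`. -/
def shiftZeroMap {X Y : ESpSe R} (f : X ⟶ Y) : X.shiftZero ⟶ Y.shiftZero where
  f i := (f.page 0).f (i.2, 2 * i.2 - i.1)
  comm' i j _ := by simp [shiftZero]

/-- All elements of page `0` of `Shift X` are cycles. -/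
def shiftZeroLift (X : ESpSe R) (i : ℤ × ℤ) : X.shiftZero.X i ⟶ X.shiftZero.cycles i :=
  X.shiftZero.liftCycles (𝟙 (X.shiftZero.X i)) _ rfl Limits.comp_zero

@[simp]
lemma shiftZeroLift_i (X : ESpSe R) (i : ℤ × ℤ) :
    X.shiftZeroLift i ≫ X.shiftZero.iCycles i = 𝟙 (X.shiftZero.X i) :=
  X.shiftZero.liftCycles_i _ _ _ _

/-- The map to the homology of page `0` of `Shift X` which sends `x` to its class. -/
def shiftZeroφ (X : ESpSe R) (i : ℤ × ℤ) : X.shiftZero.X i ⟶ X.shiftZero.homology i :=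
  X.shiftZeroLift i ≫ X.shiftZero.homologyπ i

lemma shiftZeroφ_naturality {X Y : ESpSe R} (f : X ⟶ Y) (i : ℤ × ℤ) :
    (shiftZeroMap f).f i ≫ Y.shiftZeroφ i =
      X.shiftZeroφ i ≫ HomologicalComplex.homologyMap (shiftZeroMap f) i := by
  rw [shiftZeroφ, shiftZeroφ, Category.assoc, HomologicalComplex.homologyπ_naturality,
    ← Category.assoc, ← Category.assoc]
  congr 1
  rw [← cancel_mono (Y.shiftZero.iCycles i), Category.assoc, Category.assoc, shiftZeroLift_i,
    HomologicalComplex.cyclesMap_i, ← Category.assoc, shiftZeroLift_i, Category.comp_id,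
    Category.id_comp]

/-- The characteristic maps of a reindexed extended spectral sequence. -/
def resφ {r s : ℕ} (e : (pageShape s).Embedding (pageShape r)) [e.IsRelIff] (X : ESpSe R)
    (i : ℤ × ℤ) : (X.page (r + 1)).X (e.f i) ⟶ ((X.page r).restriction e).homology i :=
  X.φ r (e.f i) ≫ (resIso e (X.page r) i).inv

lemma resφ_naturality {r s : ℕ} (e : (pageShape s).Embedding (pageShape r)) [e.IsRelIff]
    {X Y : ESpSe R} (f : X ⟶ Y) (i : ℤ × ℤ) :
    (f.page (r + 1)).f (e.f i) ≫ resφ e Y i = resφ e X i ≫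
      HomologicalComplex.homologyMap (HomologicalComplex.restrictionMap (f.page r) e) i := by
  rw [resφ, resφ, ← Category.assoc, f.comm, Category.assoc, Category.assoc, resIso_inv_naturality]

/-- The pages of `Shift X`: the translates of those of `X`, preceded by `T X_0` with zero
differential. -/
def shiftPage (X : ESpSe R) : ∀ r : ℕ, BiComplex R r
  | 0 => X.shiftZero
  | r + 1 => (X.page r).restriction (transEmb r)

/-- The characteristic maps of `Shift X`: the identity of `T X_0` for the first one, and the
translates of those of `X` for the others. -/
def shiftφ (X : ESpSe R) : ∀ (r : ℕ) (i : ℤ × ℤ),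
    (X.shiftPage (r + 1)).X i ⟶ (X.shiftPage r).homology i
  | 0, i => X.shiftZeroφ i
  | r + 1, i => resφ (transEmb r) X i

/-- `Shift` on morphisms. -/
def shiftMap {X Y : ESpSe R} (f : X ⟶ Y) : ∀ r : ℕ, X.shiftPage r ⟶ Y.shiftPage r
  | 0 => shiftZeroMap f
  | r + 1 => HomologicalComplex.restrictionMap (f.page r) (transEmb r)

/-- The shift functor. -/
def Shift (R : Type u) [CommRing R] : ESpSe R ⥤ ESpSe R where
  obj X := { page := X.shiftPage, φ := X.shiftφ }
  map {X Y} f :=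
    { page := shiftMap f
      comm := by
        rintro (_ | r) i
        · exact shiftZeroφ_naturality f i
        · exact resφ_naturality (transEmb r) f i }
  map_id X := by
    ext (_ | r) : 1 <;> rfl
  map_comp f g := by
    ext (_ | r) : 1 <;> rfl

/-! ### The functors `Dec` and `LDec` -/

lemma inv_ρ_naturality {X Y : ESpSe R} (f : X ⟶ Y) (i : ℤ × ℤ) :
    HomologicalComplex.homologyMap (f.page 1) i ≫ inv (HomologicalComplex.homologyMap (ρ Y) i) =
      inv (HomologicalComplex.homologyMap (ρ X) i) ≫
        HomologicalComplex.homologyMap (nerveMap f) i := by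
  rw [IsIso.comp_inv_eq, Category.assoc, ← HomologicalComplex.homologyMap_comp, ρ_naturality,
    HomologicalComplex.homologyMap_comp, IsIso.inv_hom_id_assoc]

/-- The map `X_2 ⟶ H((N X)_1)`: the characteristic map `X_2 ⟶ H(X_1)` followed by the inverse of
the isomorphism `H(ρ)`. -/
def nerveφ (X : ESpSe R) (i : ℤ × ℤ) : (X.page 2).X i ⟶ X.nerve.homology i :=
  X.φ 1 i ≫ inv (HomologicalComplex.homologyMap (ρ X) i)

lemma nerveφ_naturality {X Y : ESpSe R} (f : X ⟶ Y) (i : ℤ × ℤ) :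
    (f.page 2).f i ≫ Y.nerveφ i =
      X.nerveφ i ≫ HomologicalComplex.homologyMap (nerveMap f) i := by
  rw [nerveφ, nerveφ, ← Category.assoc, f.comm, Category.assoc, Category.assoc, inv_ρ_naturality]

/-- The map `X_2 ⟶ H(Cone_1(X_0) / Im q)`: the map `X_2 ⟶ H((N X)_1)` followed by `H(κ)`. -/
def cokerφ (X : ESpSe R) (i : ℤ × ℤ) : (X.page 2).X i ⟶ X.coker.homology i :=
  X.nerveφ i ≫ HomologicalComplex.homologyMap (κ X) i

lemma cokerφ_naturality {X Y : ESpSe R} (f : X ⟶ Y) (i : ℤ × ℤ) :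
    (f.page 2).f i ≫ Y.cokerφ i =
      X.cokerφ i ≫ HomologicalComplex.homologyMap (cokerMap f) i := by
  rw [cokerφ, cokerφ, ← Category.assoc, nerveφ_naturality, Category.assoc, Category.assoc,
    ← HomologicalComplex.homologyMap_comp, κ_naturality, HomologicalComplex.homologyMap_comp]

/-- The pages of `Dec X`: the inverse translates of `(N X)_1`, `X_2`, `X_3`, ... -/
def decPage (X : ESpSe R) : ∀ r : ℕ, BiComplex R r
  | 0 => X.nerve.restriction invTransEmbZero
  | r + 1 => (X.page (r + 2)).restriction (invTransEmb (r + 1))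

/-- The characteristic maps of `Dec X`: up to translation, the first one is the map
`X_2 ⟶ H((N X)_1)` defined above, and the other ones are those of `X`. -/
def decφ (X : ESpSe R) : ∀ (r : ℕ) (i : ℤ × ℤ),
    (X.decPage (r + 1)).X i ⟶ (X.decPage r).homology i
  | 0, i => X.nerveφ (invTransEmbZero.f i) ≫ (resIso invTransEmbZero X.nerve i).inv
  | r + 1, i => resφ (invTransEmb (r + 1)) X i

/-- `Dec` on morphisms. -/
def decMap {X Y : ESpSe R} (f : X ⟶ Y) : ∀ r : ℕ, X.decPage r ⟶ Y.decPage r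
  | 0 => HomologicalComplex.restrictionMap (nerveMap f) invTransEmbZero
  | r + 1 => HomologicalComplex.restrictionMap (f.page (r + 2)) (invTransEmb (r + 1))

lemma decφ_zero_naturality {X Y : ESpSe R} (f : X ⟶ Y) (i : ℤ × ℤ) :
    (f.page 2).f (invTransEmbZero.f i) ≫
        Y.nerveφ (invTransEmbZero.f i) ≫ (resIso invTransEmbZero Y.nerve i).inv =
      (X.nerveφ (invTransEmbZero.f i) ≫ (resIso invTransEmbZero X.nerve i).inv) ≫
        HomologicalComplex.homologyMap
          (HomologicalComplex.restrictionMap (nerveMap f) invTransEmbZero) i := by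
  rw [← Category.assoc, nerveφ_naturality, Category.assoc, Category.assoc, resIso_inv_naturality]

/-- The décalage functor. -/
def Dec (R : Type u) [CommRing R] : ESpSe R ⥤ ESpSe R where
  obj X := { page := X.decPage, φ := X.decφ }
  map {X Y} f :=
    { page := decMap f
      comm := by
        rintro (_ | r) i
        · exact decφ_zero_naturality f i
        · exact resφ_naturality (invTransEmb (r + 1)) f i }
  map_id X := by
    ext (_ | r) : 1
    · exact congrArg (HomologicalComplex.restrictionMap · invTransEmbZero) (nerveMap_id X)
    · rfl
  map_comp f g := by
    ext (_ | r) : 1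
    · exact congrArg (HomologicalComplex.restrictionMap · invTransEmbZero) (nerveMap_comp f g)
    · rfl

/-- The pages of `LDec X`: the inverse translates of `Cone_1(X_0) / Im q`, `X_2`, `X_3`, ... -/
def ldecPage (X : ESpSe R) : ∀ r : ℕ, BiComplex R r
  | 0 => X.coker.restriction invTransEmbZero
  | r + 1 => (X.page (r + 2)).restriction (invTransEmb (r + 1))

/-- The characteristic maps of `LDec X`: up to translation, the first one is the map
`X_2 ⟶ H(Cone_1(X_0) / Im q)` defined above, and the other ones are those of `X`. -/
def ldecφ (X : ESpSe R) : ∀ (r : ℕ) (i : ℤ × ℤ),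
    (X.ldecPage (r + 1)).X i ⟶ (X.ldecPage r).homology i
  | 0, i => X.cokerφ (invTransEmbZero.f i) ≫ (resIso invTransEmbZero X.coker i).inv
  | r + 1, i => resφ (invTransEmb (r + 1)) X i

/-- `LDec` on morphisms. -/
def ldecMap {X Y : ESpSe R} (f : X ⟶ Y) : ∀ r : ℕ, X.ldecPage r ⟶ Y.ldecPage r
  | 0 => HomologicalComplex.restrictionMap (cokerMap f) invTransEmbZero
  | r + 1 => HomologicalComplex.restrictionMap (f.page (r + 2)) (invTransEmb (r + 1))

lemma ldecφ_zero_naturality {X Y : ESpSe R} (f : X ⟶ Y) (i : ℤ × ℤ) :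
    (f.page 2).f (invTransEmbZero.f i) ≫
        Y.cokerφ (invTransEmbZero.f i) ≫ (resIso invTransEmbZero Y.coker i).inv =
      (X.cokerφ (invTransEmbZero.f i) ≫ (resIso invTransEmbZero X.coker i).inv) ≫
        HomologicalComplex.homologyMap
          (HomologicalComplex.restrictionMap (cokerMap f) invTransEmbZero) i := by
  rw [← Category.assoc, cokerφ_naturality, Category.assoc, Category.assoc, resIso_inv_naturality]

/-- The left décalage functor. -/
def LDec (R : Type u) [CommRing R] : ESpSe R ⥤ ESpSe R where
  obj X := { page := X.ldecPage, φ := X.ldecφ }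
  map {X Y} f :=
    { page := ldecMap f
      comm := by
        rintro (_ | r) i
        · exact ldecφ_zero_naturality f i
        · exact resφ_naturality (invTransEmb (r + 1)) f i }
  map_id X := by
    ext (_ | r) : 1
    · exact congrArg (HomologicalComplex.restrictionMap · invTransEmbZero) (cokerMap_id X)
    · rfl
  map_comp f g := by
    ext (_ | r) : 1
    · exact congrArg (HomologicalComplex.restrictionMap · invTransEmbZero) (cokerMap_comp f g)
    · rfl

/-! ### The classes of morphisms defining the model structures -/

/-- The class `Fib_r`: morphisms that are bidegreewise surjective on pages `0` to `r`. -/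
def fib (R : Type u) [CommRing R] (r : ℕ) : MorphismProperty (ESpSe R) := fun _ _ f =>
  ∀ s ≤ r, ∀ i : ℤ × ℤ, Function.Surjective ((f.page s).f i)

/-- The class `E'_r`: morphisms that are a quasi-isomorphism on page `r` and an isomorphism on all
pages `s > r`. -/
def weq (R : Type u) [CommRing R] (r : ℕ) : MorphismProperty (ESpSe R) := fun _ _ f =>
  QuasiIso (f.page r) ∧ ∀ s, r < s → IsIso (f.page s)

/-- The class `Cof'_r`: morphisms with the left lifting property with respect to `Fib_r ∩ E'_r`. -/
def cof (R : Type u) [CommRing R] (r : ℕ) : MorphismProperty (ESpSe R) := (fib R r ⊓ weq R r).llp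

/-- A model structure on extended spectral sequences is the model structure `eSpSe'_r` if its
fibrations, weak equivalences and cofibrations are the classes `Fib_r`, `E'_r` and `Cof'_r`. -/
structure IsModelPrime {R : Type u} [CommRing R] (M : ModelCategory (ESpSe R)) (r : ℕ) : Prop where
  fibrations_eq : fibrations (ESpSe R) = fib R r
  weakEquivalences_eq : weakEquivalences (ESpSe R) = weq R r
  cofibrations_eq : cofibrations (ESpSe R) = cof R r

end ESpSe

/-! ### Quillen equivalences -/

section Quillen

universe v₁ v₂ u₁ u₂

variable {C : Type u₁} [Category.{v₁} C] {D : Type u₂} [Category.{v₂} D]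

/-- An adjunction between model categories is a Quillen adjunction if the left adjoint preserves
cofibrations and trivial cofibrations. -/
structure IsQuillenAdjunction (MC : ModelCategory C) (MD : ModelCategory D) {F : C ⥤ D} {G : D ⥤ C}
    (adj : F ⊣ G) : Prop where
  map_cofibration {X Y : C} (f : X ⟶ Y) : cofibrations C f → cofibrations D (F.map f)
  map_trivialCofibration {X Y : C} (f : X ⟶ Y) :
    trivialCofibrations C f → trivialCofibrations D (F.map f)

/-- A Quillen adjunction `F ⊣ G` is a Quillen equivalence if for all cofibrant `X` and fibrant `Y`,
a morphism `F X ⟶ Y` is a weak equivalence if and only if its adjunct `X ⟶ G Y` is. -/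
structure IsQuillenEquivalence (MC : ModelCategory C) (MD : ModelCategory D) {F : C ⥤ D} {G : D ⥤ C}
    (adj : F ⊣ G) : Prop extends IsQuillenAdjunction MC MD adj where
  weakEquivalence_iff (X : C) (Y : D) (f : F.obj X ⟶ Y) : IsCofibrant X → IsFibrant Y →
    (weakEquivalences D f ↔ weakEquivalences C (adj.homEquiv X Y f))

end Quillen

end

/-! The Quillen equivalences reduce to two properties of the right adjoints and one of each unit.
`Shift` and `Dec` preserve and reflect weak equivalences between the levels r and r + 1: `Shift`
only reindexes pages, and the page 0 of `Dec X` is quasi-isomorphic to X_1 through ρ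
(`weq_shift_iff`, `weq_dec_iff`). Both preserve fibrations (`fib_shift`, `fib_dec`), since
compatible pairs lift along a morphism surjective on pages 0 and 1. So the left adjoints preserve
cofibrations and trivial cofibrations; and since the adjunct of f is the unit followed by the right
adjoint applied to f, it remains to see that the unit is a weak equivalence on cofibrant objects.

For `Shift ⊣ Dec` the unit is an isomorphism on every page: the nerve of `Shift X` consists of the
quadruples (x, x; dx, dx), a copy of X_0. For `LDec ⊣ Shift` it is an isomorphism from page 2 on,
and on page 1 it is, up to reindexing, x₁ ↦ [(x₀, 0)] from X_1 to Cone_1(X_0)/Im q, where x₀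
represents φ x₁. This is a quasi-isomorphism as soon as `φ 0` is injective
(`quasiIso_pageOneToCoker`). Cofibrant objects of level r + 1 have injective `φ 0`
(`φ_injective_of_cof`): enlarging page 0 by page 1 with zero differential gives a trivial fibration
onto X from an object with injective `φ 0`, and it has a section.

The model structures are built as well. Colimits are pagewise; limits are not, and come from the
special adjoint functor theorem. Factorizations go by induction on r. At r = 0 they are those of the
projective model structure on page 0. For the step, `Dec f` is factored at level r, `Shift` is
applied, the result is pushed out along the counit at the source of f, and page 0 is corrected by
free discs (`exists_factorization_of_dec`). The counit is an isomorphism from page 2 on and a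
surjective quasi-isomorphism on page 1, so the pushout is harmless except on page 1 when r = 0;
there, injectivity on page 0, carried through the induction, makes `surjQi_of_isPushout` apply. -/

noncomputable section

/-! ### Elementwise calculus of homology classes, reindexing and compatible pairs. -/

namespace ESpSe

variable {R : Type u} [CommRing R]

/-! ### Cycles and their homology classes -/

section IsClass

variable {c : ComplexShape (ℤ × ℤ)}

/-- The element `x` is a cycle whose homology class is `h`. -/
def IsClass (K : HomologicalComplex (ModuleCat.{u} R) c) (i : ℤ × ℤ) (x : K.X i)
    (h : K.homology i) : Prop :=
  ∃ z : K.cycles i, K.iCycles i z = x ∧ K.homologyπ i z = h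

variable {K L : HomologicalComplex (ModuleCat.{u} R) c} {i : ℤ × ℤ}

namespace IsClass

lemma exists_rep (h : K.homology i) : ∃ x, IsClass K i x h := by
  obtain ⟨z, hz⟩ := homologyπ_surjective K i h
  exact ⟨_, z, rfl, hz⟩

lemma exists_class {j : ℤ × ℤ} (hij : c.Rel i j) {x : K.X i} (hx : K.d i j x = 0) :
    ∃ h, IsClass K i x h := by
  obtain ⟨z, hz⟩ := exists_cycle K hij x hx
  exact ⟨_, z, hz, rfl⟩

lemma d_eq_zero {x : K.X i} {h : K.homology i} (hx : IsClass K i x h) (j : ℤ × ℤ) :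
    K.d i j x = 0 := by
  obtain ⟨z, rfl, -⟩ := hx
  exact d_iCycles K j z

lemma unique {x : K.X i} {h h' : K.homology i} (hx : IsClass K i x h) (hx' : IsClass K i x h') :
    h = h' := by
  obtain ⟨z, rfl, rfl⟩ := hx
  obtain ⟨w, hw, rfl⟩ := hx'
  rw [iCycles_injective K i hw]

lemma zero : IsClass K i 0 0 := ⟨0, by simp, by simp⟩

lemma add {x y : K.X i} {h k : K.homology i} (hx : IsClass K i x h) (hy : IsClass K i y k) :
    IsClass K i (x + y) (h + k) := by
  obtain ⟨z, rfl, rfl⟩ := hx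
  obtain ⟨w, rfl, rfl⟩ := hy
  exact ⟨z + w, by simp, by simp⟩

lemma neg {x : K.X i} {h : K.homology i} (hx : IsClass K i x h) : IsClass K i (-x) (-h) := by
  obtain ⟨z, rfl, rfl⟩ := hx
  exact ⟨-z, by simp, by simp⟩

lemma sub {x y : K.X i} {h k : K.homology i} (hx : IsClass K i x h) (hy : IsClass K i y k) :
    IsClass K i (x - y) (h - k) := by
  simpa only [sub_eq_add_neg] using hx.add hy.neg

lemma map (f : K ⟶ L) {x : K.X i} {h : K.homology i} (hx : IsClass K i x h) :
    IsClass L i (f.f i x) (HomologicalComplex.homologyMap f i h) := by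
  obtain ⟨z, rfl, rfl⟩ := hx
  exact ⟨HomologicalComplex.cyclesMap f i z, iCycles_cyclesMap _ _ _,
    (homologyMap_homologyπ _ _ _).symm⟩

lemma d {j : ℤ × ℤ} (w : K.X j) : IsClass K i (K.d j i w) 0 := by
  by_cases hij : c.Rel j i
  · refine ⟨K.toCycles j i w, ?_, ?_⟩
    · rw [← ConcreteCategory.comp_apply, K.toCycles_i]
    · rw [← ConcreteCategory.comp_apply, K.toCycles_comp_homologyπ]
      rfl
  · rw [K.shape _ _ hij]
    exact zero

lemma exists_d_eq {j : ℤ × ℤ} (hij : c.Rel j i) {x : K.X i} (hx : IsClass K i x 0) :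
    ∃ w, K.d j i w = x := by
  obtain ⟨z, rfl, hz⟩ := hx
  exact (homologyπ_eq_zero_iff K hij z).1 hz

lemma exists_sub_eq_d {j : ℤ × ℤ} (hij : c.Rel j i) {x y : K.X i} {h : K.homology i}
    (hx : IsClass K i x h) (hy : IsClass K i y h) : ∃ w, K.d j i w = x - y :=
  exists_d_eq hij (by simpa using hx.sub hy)

lemma add_d {j : ℤ × ℤ} {x : K.X i} {h : K.homology i} (hx : IsClass K i x h) (w : K.X j) :
    IsClass K i (x + K.d j i w) h := by
  simpa using hx.add (IsClass.d w)

end IsClass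

end IsClass

lemma compat_iff {X : ESpSe R} {r : ℕ} {i : ℤ × ℤ} {x : (X.page r).X i}
    {x' : (X.page (r + 1)).X i} : Compat X r i x x' ↔ IsClass (X.page r) i x (X.φ r i x') :=
  Iff.rfl

/-- A family of morphisms of complexes which preserves compatible pairs is a morphism of extended
spectral sequences. -/
def Hom.ofCompat {X Y : ESpSe R} (f : ∀ r, X.page r ⟶ Y.page r)
    (hf : ∀ (r : ℕ) (i : ℤ × ℤ) (x : (X.page r).X i) (x' : (X.page (r + 1)).X i),
      Compat X r i x x' → Compat Y r i ((f r).f i x) ((f (r + 1)).f i x')) : X ⟶ Y where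
  page := f
  comm r i := by
    refine ModuleCat.hom_ext (LinearMap.ext fun x' => ?_)
    obtain ⟨x, hx⟩ := Compat.exists_left (X := X) (r := r) x'
    -- Both sides are the homology class of the image of a representative x of φ x'.
    exact IsClass.unique (hf r i x x' hx) (IsClass.map (f r) hx)

/-! ### Successors and predecessors of bidegrees -/

/-- The target bidegree of the differential of an `r`-bigraded complex starting at `i`. -/
def nxt (r : ℕ) (i : ℤ × ℤ) : ℤ × ℤ := (i.1 - r, i.2 + 1 - r)

/-- The source bidegree of the differential of an `r`-bigraded complex arriving at `i`. -/
def prv (r : ℕ) (i : ℤ × ℤ) : ℤ × ℤ := (i.1 + r, i.2 + r - 1)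

lemma rel_nxt (r : ℕ) (i : ℤ × ℤ) : (pageShape r).Rel i (nxt r i) := pageShape_rel.2 rfl

lemma rel_prv (r : ℕ) (i : ℤ × ℤ) : (pageShape r).Rel (prv r i) i :=
  pageShape_rel.2 (by ext <;> simp [prv])

instance (r : ℕ) : (pageShape r).HasNoLoop where
  not_rel_self i h := by
    have := pageShape_rel.1 h
    rw [Prod.ext_iff] at this
    dsimp at this
    omega

/-! ### Quasi-isomorphisms in terms of elements -/

section QuasiIso

variable {r : ℕ} {K L : BiComplex R r}

/-- Homology at i only involves cycles at i and boundaries from the preceding bidegree. The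
neighbours `p` and `n` are parameters so that `src` and `tgt` can serve for 1-bigraded complexes,
where they agree with `prv 1` and `nxt 1` only propositionally. -/
lemma quasiIso_of_elements (f : K ⟶ L) (p n : ℤ × ℤ → ℤ × ℤ)
    (hp : ∀ i, (pageShape r).Rel (p i) i) (hn : ∀ i, (pageShape r).Rel i (n i))
    (hinj : ∀ i (x : K.X i), K.d i (n i) x = 0 →
      ∀ w : L.X (p i), L.d (p i) i w = f.f i x → ∃ w', K.d (p i) i w' = x)
    (hsurj : ∀ i (y : L.X i), L.d i (n i) y = 0 →
      ∃ x : K.X i, K.d i (n i) x = 0 ∧ ∃ w, y = f.f i x + L.d (p i) i w) :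
    QuasiIso f where
  quasiIsoAt i := by
    rw [quasiIsoAt_iff_isIso_homologyMap, ConcreteCategory.isIso_iff_bijective]
    constructor
    · rw [injective_iff_map_eq_zero]
      intro h hh
      obtain ⟨x, hx⟩ := IsClass.exists_rep h
      have := hx.map f
      rw [hh] at this
      obtain ⟨w, hw⟩ := this.exists_d_eq (hp i)
      obtain ⟨w', rfl⟩ := hinj i x (hx.d_eq_zero _) w hw
      exact hx.unique (IsClass.d w')
    · intro h
      obtain ⟨y, hy⟩ := IsClass.exists_rep h
      obtain ⟨x, hx, w, rfl⟩ := hsurj i y (hy.d_eq_zero _)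
      obtain ⟨k, hk⟩ := IsClass.exists_class (hn i) hx
      exact ⟨k, ((hk.map f).add_d w).unique hy⟩

lemma exists_of_quasiIso_inj (f : K ⟶ L) [QuasiIso f] (i) (x : K.X i)
    (hx : K.d i (nxt r i) x = 0) (w : L.X (prv r i)) (hw : L.d (prv r i) i w = f.f i x) :
    ∃ w', K.d (prv r i) i w' = x := by
  obtain ⟨k, hk⟩ := IsClass.exists_class (rel_nxt r i) hx
  have h₀ : HomologicalComplex.homologyMap f i k = 0 := by
    have := hk.map f
    rw [← hw] at this
    exact this.unique (IsClass.d w)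
  have hi : Function.Injective (HomologicalComplex.homologyMap f i) :=
    (ModuleCat.mono_iff_injective _).1 inferInstance
  have : k = 0 := hi (by rw [h₀, map_zero])
  subst this
  exact hk.exists_d_eq (rel_prv r i)

lemma exists_of_quasiIso_surj (f : K ⟶ L) [QuasiIso f] (i) (y : L.X i)
    (hy : L.d i (nxt r i) y = 0) :
    ∃ x : K.X i, K.d i (nxt r i) x = 0 ∧ ∃ w, y = f.f i x + L.d (prv r i) i w := by
  obtain ⟨k, hk⟩ := IsClass.exists_class (rel_nxt r i) hy
  have hs : Function.Surjective (HomologicalComplex.homologyMap f i) :=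
    (ModuleCat.epi_iff_surjective _).1 inferInstance
  obtain ⟨h, rfl⟩ := hs k
  obtain ⟨x, hx⟩ := IsClass.exists_rep h
  obtain ⟨w, hw⟩ := hk.exists_sub_eq_d (rel_prv r i) (hx.map f)
  exact ⟨x, hx.d_eq_zero _, w, by rw [hw]; abel⟩

end QuasiIso

/-! ### Reindexed complexes -/

section Restriction

variable {r s : ℕ} (e : (pageShape r).Embedding (pageShape s)) [e.IsRelIff]

/-- Cycles transport forwards through the isomorphism of cycle modules. Conversely, a cycle has some
class in the reindexed complex, and it is the expected one because `resIso` is injective. -/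
lemma isClass_restriction_iff {K : BiComplex R s} {j : ℤ × ℤ} {x : K.X (e.f j)}
    {h : (K.restriction e).homology j} :
    IsClass (K.restriction e) j x h ↔ IsClass K (e.f j) x ((resIso e K j).hom h) := by
  have key : ∀ (x : K.X (e.f j)) (h : (K.restriction e).homology j),
      IsClass (K.restriction e) j x h → IsClass K (e.f j) x ((resIso e K j).hom h) := by
    rintro x h ⟨z, hz, rfl⟩
    have hk : (pageShape r).Rel j (j.1 - r, j.2 + 1 - r) := pageShape_rel.2 rfl
    refine ⟨(K.restrictionCyclesIso e j _ ((pageShape r).next_eq' hk) rfl rfl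
      ((pageShape s).next_eq' (e.rel hk))).hom z, ?_, ?_⟩
    · rw [← ConcreteCategory.comp_apply, HomologicalComplex.restrictionCyclesIso_hom_iCycles]
      exact hz
    · rw [← ConcreteCategory.comp_apply, ← ConcreteCategory.comp_apply, resIso,
        HomologicalComplex.homologyπ_restrictionHomologyIso_hom]
  refine ⟨key x h, fun hx => ?_⟩
  obtain ⟨k, hk⟩ := IsClass.exists_class (K := K.restriction e) (rel_nxt r j)
    (x := x) (hx.d_eq_zero _)
  have := (key _ _ hk).unique hx
  have hkh : k = h := by
    have := congrArg (resIso e K j).inv this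
    simpa using this
  exact hkh ▸ hk

lemma quasiIso_restrictionMap_iff {K L : BiComplex R s} (f : K ⟶ L)
    (he : Function.Surjective e.f) :
    QuasiIso (HomologicalComplex.restrictionMap f e) ↔ QuasiIso f := by
  have key (j : ℤ × ℤ) : QuasiIsoAt (HomologicalComplex.restrictionMap f e) j ↔
      QuasiIsoAt f (e.f j) := by
    rw [quasiIsoAt_iff_isIso_homologyMap, quasiIsoAt_iff_isIso_homologyMap]
    have h := resIso_hom_naturality e f j
    constructor
    · intro
      have : IsIso ((resIso e K j).hom ≫ HomologicalComplex.homologyMap f (e.f j)) := by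
        rw [← h]; infer_instance
      exact IsIso.of_isIso_comp_left (resIso e K j).hom _
    · intro
      have : IsIso (HomologicalComplex.homologyMap (HomologicalComplex.restrictionMap f e) j ≫
          (resIso e L j).hom) := by
        rw [h]; infer_instance
      exact IsIso.of_isIso_comp_right _ (resIso e L j).hom
  rw [quasiIso_iff, quasiIso_iff, he.forall (p := fun i => QuasiIsoAt f i)]
  exact forall_congr' key

lemma isIso_restrictionMap_iff {K L : BiComplex R s} (f : K ⟶ L)
    (he : Function.Surjective e.f) :
    IsIso (HomologicalComplex.restrictionMap f e) ↔ IsIso f := by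
  constructor
  · intro h
    have : ∀ i, IsIso (f.f i) := he.forall.2 fun j =>
      inferInstanceAs (IsIso ((HomologicalComplex.restrictionMap f e).f j))
    exact HomologicalComplex.Hom.isIso_of_components f
  · intro h
    have : ∀ j, IsIso ((HomologicalComplex.restrictionMap f e).f j) := fun j =>
      inferInstanceAs (IsIso (f.f (e.f j)))
    exact HomologicalComplex.Hom.isIso_of_components _

end Restriction

lemma transEmb_surjective (r : ℕ) : Function.Surjective (transEmb r).f := fun i =>
  ⟨(2 * i.1 - i.2, i.1), by ext <;> simp⟩

lemma invTransEmb_surjective (r : ℕ) : Function.Surjective (invTransEmb r).f := fun i =>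
  ⟨(i.2, 2 * i.2 - i.1), by ext <;> simp⟩

/-! ### Transport -/

section Tr

variable {c : ComplexShape (ℤ × ℤ)} {K : HomologicalComplex (ModuleCat.{u} R) c}

@[simp]
lemma tr_self_apply (i : ℤ × ℤ) (x : K.X i) : tr K i i x = x := by simp

/-- The reindexings T and T⁻¹ are mutually inverse only up to propositional equality of bidegrees,
so differentials are compared across two independent transports. -/
lemma d_tr {i i' j j' : ℤ × ℤ} (hi : i = i') (hj : j = j') (x : K.X i) :
    K.d i' j' (tr K i i' x) = tr K j j' (K.d i j x) := by
  subst hi hj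
  simp

lemma tr_bijective {i j : ℤ × ℤ} (h : i = j) : Function.Bijective (tr K i j) := by
  subst h
  simpa using Function.bijective_id

/-- A reindexed complex is isomorphic to the original one if the reindexing is the identity. -/
def resTr {c' : ComplexShape (ℤ × ℤ)} (K : HomologicalComplex (ModuleCat.{u} R) c)
    (e : c'.Embedding c) [e.IsRelIff] (e' : c.Embedding c') [e'.IsRelIff]
    (h : ∀ i, e.f (e'.f i) = i) : (K.restriction e).restriction e' ⟶ K where
  f i := tr K (e.f (e'.f i)) i
  comm' i j _ := by
    refine ModuleCat.hom_ext (LinearMap.ext fun x => ?_)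
    exact d_tr (K := K) (h i) (h j) x

/-- The inverse of `resTr`. -/
def resTrInv {c' : ComplexShape (ℤ × ℤ)} (K : HomologicalComplex (ModuleCat.{u} R) c)
    (e : c'.Embedding c) [e.IsRelIff] (e' : c.Embedding c') [e'.IsRelIff]
    (h : ∀ i, e.f (e'.f i) = i) : K ⟶ (K.restriction e).restriction e' where
  f i := tr K i (e.f (e'.f i))
  comm' i j _ := by
    refine ModuleCat.hom_ext (LinearMap.ext fun x => ?_)
    exact d_tr (K := K) (h i).symm (h j).symm x

end Tr

lemma transEmb_invTransEmb (r : ℕ) (i : ℤ × ℤ) : (transEmb r).f ((invTransEmb r).f i) = i := by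
  ext <;> simp

lemma invTransEmb_transEmb (r : ℕ) (i : ℤ × ℤ) : (invTransEmb r).f ((transEmb r).f i) = i := by
  ext <;> simp

/-! ### Compatible pairs in `Shift X`, `Dec X` and `LDec X` -/

section Compat

variable {X : ESpSe R}

lemma compat_shift_succ_iff {r : ℕ} {i : ℤ × ℤ} {x : (X.page r).X ((transEmb r).f i)}
    {x' : (X.page (r + 1)).X ((transEmb r).f i)} :
    Compat ((Shift R).obj X) (r + 1) i x x' ↔ Compat X r ((transEmb r).f i) x x' := by
  refine Iff.trans (isClass_restriction_iff (transEmb r) (K := X.page r)) ?_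
  change IsClass (X.page r) _ x ((resIso (transEmb r) (X.page r) i).hom
    ((resφ (transEmb r) X i) x')) ↔ _
  rw [resφ, ← ConcreteCategory.comp_apply, Category.assoc, Iso.inv_hom_id, Category.comp_id]
  rfl

/-- With zero differential, every homology class has exactly one representative, and the first
characteristic map of `Shift X` sends an element to its own class. -/
lemma compat_shift_zero_iff {i : ℤ × ℤ} {x x' : (X.page 0).X ((transEmb 0).f i)} :
    Compat ((Shift R).obj X) 0 i x x' ↔ x = x' := by
  have key : ∀ y : (X.page 0).X ((transEmb 0).f i), Compat ((Shift R).obj X) 0 i y y := by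
    intro y
    refine ⟨X.shiftZeroLift i y, ?_, rfl⟩
    change (X.shiftZeroLift i ≫ X.shiftZero.iCycles i) y = y
    rw [shiftZeroLift_i]
    rfl
  constructor
  · intro h
    obtain ⟨w, hw⟩ := (compat_iff.1 h).exists_sub_eq_d (rel_prv 0 i) (compat_iff.1 (key x'))
    have h0 : x - x' = 0 := hw.symm
    exact sub_eq_zero.1 h0
  · rintro rfl
    exact key x

lemma compat_dec_succ_iff {r : ℕ} {i : ℤ × ℤ} {x : (X.page (r + 2)).X ((invTransEmb (r + 1)).f i)}
    {x' : (X.page (r + 3)).X ((invTransEmb (r + 1)).f i)} :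
    Compat ((Dec R).obj X) (r + 1) i x x' ↔ Compat X (r + 2) ((invTransEmb (r + 1)).f i) x x' := by
  refine Iff.trans (isClass_restriction_iff (invTransEmb (r + 1)) (K := X.page (r + 2))) ?_
  change IsClass (X.page (r + 2)) _ x ((resIso (invTransEmb (r + 1)) (X.page (r + 2)) i).hom
    ((resφ (invTransEmb (r + 1)) X i) x')) ↔ _
  rw [resφ, ← ConcreteCategory.comp_apply, Category.assoc, Iso.inv_hom_id, Category.comp_id]
  rfl

/-- `LDec` and `Dec` differ only in page 0 and in the first characteristic map. -/
lemma compat_ldec_succ_iff {r : ℕ} {i : ℤ × ℤ}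
    {x : (X.page (r + 2)).X ((invTransEmb (r + 1)).f i)}
    {x' : (X.page (r + 3)).X ((invTransEmb (r + 1)).f i)} :
    Compat ((LDec R).obj X) (r + 1) i x x' ↔ Compat X (r + 2) ((invTransEmb (r + 1)).f i) x x' :=
  compat_dec_succ_iff

/-- A quadruple is a cycle exactly when y₀ = y₁ = 0, and its class is detected by x₁ since H(ρ) is
injective. -/
lemma isClass_nerve_iff {i : ℤ × ℤ} {v : X.nerve.X i} {h : X.nerve.homology i} :
    IsClass X.nerve i v h ↔ v.1.2.2.1 = 0 ∧ v.1.2.2.2 = 0 ∧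
      IsClass (X.page 1) i v.1.2.1 (HomologicalComplex.homologyMap (ρ X) i h) := by
  constructor
  · intro hv
    have h0 := congrArg Subtype.val (hv.d_eq_zero (tgt i))
    change (tr _ (tgt i) (tgt i) v.1.2.2.1, tr _ (tgt i) (tgt i) v.1.2.2.2, 0, 0) = 0 at h0
    exact ⟨by simpa using congrArg Prod.fst h0, by simpa using congrArg (fun t => t.2.1) h0,
      hv.map (ρ X)⟩
  · rintro ⟨h₁, h₂, h₃⟩
    have h0 : X.nerve.d i (tgt i) v = 0 := by
      refine Subtype.ext ?_
      change (tr _ (tgt i) (tgt i) v.1.2.2.1, tr _ (tgt i) (tgt i) v.1.2.2.2, 0, 0) = 0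
      rw [h₁, h₂]
      simp
    obtain ⟨k, hk⟩ := IsClass.exists_class (rel_one_iff.2 rfl) h0
    have hi : Function.Injective (HomologicalComplex.homologyMap (ρ X) i) :=
      (ModuleCat.mono_iff_injective _).1 inferInstance
    have := hi ((hk.map (ρ X)).unique h₃)
    exact this ▸ hk

lemma compat_dec_zero_iff {i : ℤ × ℤ} {v : X.nerve.X (invTransEmbZero.f i)}
    {x' : (X.page 2).X (invTransEmbZero.f i)} :
    Compat ((Dec R).obj X) 0 i v x' ↔ v.1.2.2.1 = 0 ∧ v.1.2.2.2 = 0 ∧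
      Compat X 1 (invTransEmbZero.f i) v.1.2.1 x' := by
  refine Iff.trans (isClass_restriction_iff invTransEmbZero (K := X.nerve)) ?_
  change IsClass X.nerve _ v ((resIso invTransEmbZero X.nerve i).hom
    ((X.nerveφ _ ≫ (resIso invTransEmbZero X.nerve i).inv) x')) ↔ _
  rw [← ConcreteCategory.comp_apply, Category.assoc, Iso.inv_hom_id, Category.comp_id,
    isClass_nerve_iff, nerveφ, ← ConcreteCategory.comp_apply, Category.assoc, IsIso.inv_hom_id,
    Category.comp_id]
  rfl

/-- The first characteristic map of `LDec X` factors through H(κ), so its representatives are the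
images under κ of nerve cycles lying over x', up to boundaries. -/
lemma compat_ldec_zero_iff {i : ℤ × ℤ} {a : X.coker.X (invTransEmbZero.f i)}
    {x' : (X.page 2).X (invTransEmbZero.f i)} :
    Compat ((LDec R).obj X) 0 i a x' ↔ ∃ v : X.nerve.X (invTransEmbZero.f i),
      v.1.2.2.1 = 0 ∧ v.1.2.2.2 = 0 ∧ Compat X 1 (invTransEmbZero.f i) v.1.2.1 x' ∧
      ∃ w : X.coker.X (src (invTransEmbZero.f i)),
        a = (κ X).f _ v + X.coker.d (src (invTransEmbZero.f i)) (invTransEmbZero.f i) w := by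
  have key : Compat ((LDec R).obj X) 0 i a x' ↔ IsClass X.coker (invTransEmbZero.f i) a
      (HomologicalComplex.homologyMap (κ X) _ (X.nerveφ (invTransEmbZero.f i) x')) := by
    refine Iff.trans (isClass_restriction_iff invTransEmbZero (K := X.coker)) ?_
    change IsClass X.coker _ a ((resIso invTransEmbZero X.coker i).hom
      ((X.cokerφ _ ≫ (resIso invTransEmbZero X.coker i).inv) x')) ↔ _
    rw [← ConcreteCategory.comp_apply, Category.assoc, Iso.inv_hom_id, Category.comp_id,
      cokerφ, ConcreteCategory.comp_apply]
  have key' (v : X.nerve.X (invTransEmbZero.f i)) : v.1.2.2.1 = 0 ∧ v.1.2.2.2 = 0 ∧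
      Compat X 1 (invTransEmbZero.f i) v.1.2.1 x' ↔ IsClass X.nerve _ v (X.nerveφ _ x') := by
    rw [isClass_nerve_iff, nerveφ, ← ConcreteCategory.comp_apply, Category.assoc, IsIso.inv_hom_id,
      Category.comp_id, compat_iff]
  rw [key]
  constructor
  · intro h
    obtain ⟨v, hv⟩ := IsClass.exists_rep (X.nerveφ (invTransEmbZero.f i) x')
    obtain ⟨w, hw⟩ := h.exists_sub_eq_d (rel_one_iff.2 (tgt_src _)) (hv.map (κ X))
    obtain ⟨h₁, h₂, h₃⟩ := (key' v).2 hv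
    exact ⟨v, h₁, h₂, h₃, w, by rw [hw]; abel⟩
  · rintro ⟨v, h₁, h₂, h₃, w, rfl⟩
    exact (((key' v).1 ⟨h₁, h₂, h₃⟩).map (κ X)).add_d w

end Compat

end ESpSe

/-! ### The adjunction `Shift ⊣ Dec`. -/

namespace ESpSe

variable {R : Type u} [CommRing R]

/-! ### Auxiliary lemmas on transport -/

lemma tr_tr_self {c : ComplexShape (ℤ × ℤ)} {K : HomologicalComplex (ModuleCat.{u} R) c}
    {i j : ℤ × ℤ} (h : i = j) (x : K.X j) : tr K i j (tr K j i x) = x := by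
  subst h
  simp

/-- One transport is taken in K and the other in its reindexing, which is the form in which the
triangle identities produce them. -/
lemma tr_restriction_tr {c c' : ComplexShape (ℤ × ℤ)}
    {K : HomologicalComplex (ModuleCat.{u} R) c} {e : c'.Embedding c} [e.IsRelIff] {i j : ℤ × ℤ}
    (h : i = j) (x : K.X (e.f j)) :
    tr (K.restriction e) i j (tr K (e.f j) (e.f i) x : K.X (e.f i)) = x := by
  subst h
  exact (tr_self_apply (K := K.restriction e) i _).trans (tr_self_apply (K := K) _ x)

lemma tr_tr_restriction {c c' : ComplexShape (ℤ × ℤ)}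
    {K : HomologicalComplex (ModuleCat.{u} R) c} {e : c'.Embedding c} [e.IsRelIff] {i j : ℤ × ℤ}
    (h : i = j) (x : (K.restriction e).X j) :
    tr K (e.f i) (e.f j) (tr (K.restriction e) j i x : K.X (e.f i)) = x := by
  subst h
  rw [tr_self_apply]
  exact tr_self_apply (K := K) _ x

lemma tr_shiftZero_tr (X : ESpSe R) {i j : ℤ × ℤ} (h : i = j)
    (x : (X.page 0).X ((transEmb 0).f j)) :
    tr X.shiftZero i j (tr (X.page 0) ((transEmb 0).f j) ((transEmb 0).f i) x :
      (X.page 0).X ((transEmb 0).f i)) = x := by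
  subst h
  exact (tr_self_apply (K := X.shiftZero) i _).trans (tr_self_apply (K := X.page 0) _ x)

lemma tr_shiftZero_apply (X : ESpSe R) {i j : ℤ × ℤ} (h : i = j)
    (x : (X.page 0).X ((transEmb 0).f i)) :
    tr X.shiftZero i j x = tr (X.page 0) ((transEmb 0).f i) ((transEmb 0).f j) x := by
  subst h
  exact (tr_self_apply (K := X.shiftZero) i x).trans (tr_self_apply (K := X.page 0) _ x).symm

lemma d_d_apply {c : ComplexShape (ℤ × ℤ)} (K : HomologicalComplex (ModuleCat.{u} R) c)
    (i j k : ℤ × ℤ) (x : K.X i) : K.d j k (K.d i j x) = 0 := by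
  rw [← ConcreteCategory.comp_apply, K.d_comp_d]
  rfl

lemma d_add_d {c : ComplexShape (ℤ × ℤ)} (K : HomologicalComplex (ModuleCat.{u} R) c)
    (i j k : ℤ × ℤ) (a : K.X j) (b : K.X i) : K.d j k (a + K.d i j b) = K.d j k a := by
  rw [map_add, d_d_apply, add_zero]

lemma tr_nerve (X : ESpSe R) {i j : ℤ × ℤ} (h : i = j) (v : X.nerve.X i) :
    (tr X.nerve i j v : X.nerve.X j).1 = (tr (X.page 0) i j v.1.1, tr (X.page 1) i j v.1.2.1,
      tr (X.page 0) (tgt i) (tgt j) v.1.2.2.1, tr (X.page 1) (tgt i) (tgt j) v.1.2.2.2) := by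
  subst h
  simp

/-- The entry y₁ is redundant, being d₁ x₁. -/
lemma nerve_ext {X : ESpSe R} {i : ℤ × ℤ} {v w : X.nerve.X i} (h₁ : v.1.1 = w.1.1)
    (h₂ : v.1.2.1 = w.1.2.1) (h₃ : v.1.2.2.1 = w.1.2.2.1) : v = w := by
  refine Subtype.ext (Prod.ext h₁ (Prod.ext h₂ (Prod.ext h₃ ?_)))
  have hv : (X.page 1).d i (tgt i) v.1.2.1 = v.1.2.2.2 := v.2.2.2
  have hw : (X.page 1).d i (tgt i) w.1.2.1 = w.1.2.2.2 := w.2.2.2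
  rw [← hv, ← hw, h₂]

lemma tr_nerve_restriction {X : ESpSe R} {a b : ℤ × ℤ} (h : a = b)
    (v : X.nerve.X (invTransEmbZero.f b)) :
    tr (X.page 0) (invTransEmbZero.f a) (invTransEmbZero.f b)
      (tr (X.nerve.restriction invTransEmbZero) b a v : X.nerve.X (invTransEmbZero.f a)).1.1 =
      v.1.1 := by
  subst h
  exact (tr_self_apply _ _).trans
    (congrArg (fun w : X.nerve.X (invTransEmbZero.f a) => w.1.1)
      (tr_self_apply (K := X.nerve.restriction invTransEmbZero) a v))

lemma hom_ext_apply {c : ComplexShape (ℤ × ℤ)} {K L : HomologicalComplex (ModuleCat.{u} R) c}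
    {f g : K ⟶ L} (h : ∀ i (x : K.X i), f.f i x = g.f i x) : f = g := by
  ext i : 1
  exact ModuleCat.hom_ext (LinearMap.ext (h i))

/-! ### The adjunction between `Shift` and `Dec` -/

/-- The map `x ↦ (x, x; d x, d x)` from `T X_0` to the nerve of `Shift X`. -/
def shiftNerve (X : ESpSe R) :
    (X.page 0).restriction (transEmb 0) ⟶ ((Shift R).obj X).nerve where
  f i := ModuleCat.ofHom
    { toFun := fun x : (X.page 0).X ((transEmb 0).f i) =>
        ⟨(x, x, (X.page 0).d ((transEmb 0).f i) ((transEmb 0).f (tgt i)) x,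
          (X.page 0).d ((transEmb 0).f i) ((transEmb 0).f (tgt i)) x),
          compat_shift_zero_iff.2 rfl, compat_shift_zero_iff.2 rfl, rfl⟩
      map_add' := fun x y => Subtype.ext (by
        refine Prod.ext rfl (Prod.ext rfl (Prod.ext ?_ ?_)) <;> exact map_add _ _ _)
      map_smul' := fun a x => Subtype.ext (by
        refine Prod.ext rfl (Prod.ext rfl (Prod.ext ?_ ?_)) <;> exact map_smul _ _ _) }
  comm' i j hij := by
    obtain rfl := rel_one_iff.1 hij
    refine ModuleCat.hom_ext (LinearMap.ext fun x => Subtype.ext ?_)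
    change (tr (X.shiftPage 0) (tgt i) (tgt i) ((X.page 0).d _ _ x),
      tr (X.shiftPage 1) (tgt i) (tgt i) ((X.page 0).d _ _ x), 0, 0) =
      ((X.page 0).d _ _ x, (X.page 0).d _ _ x, (X.page 0).d _ _ ((X.page 0).d _ _ x),
        (X.page 0).d _ _ ((X.page 0).d _ _ x))
    exact Prod.ext (tr_self_apply (K := X.shiftPage 0) _ _)
      (Prod.ext (tr_self_apply (K := X.shiftPage 1) _ _)
        (Prod.ext (d_d_apply (X.page 0) _ _ _ x).symm (d_d_apply (X.page 0) _ _ _ x).symm))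

/-- In `Shift X` compatible elements of pages 0 and 1 coincide, so a quadruple of the nerve is
determined by x: it is (x, x; dx, dx). -/
lemma shiftNerve_bijective (X : ESpSe R) (i : ℤ × ℤ) : Function.Bijective (X.shiftNerve.f i) := by
  constructor
  · intro x y h
    exact congrArg (fun v : ((Shift R).obj X).nerve.X i => v.1.1) h
  · rintro ⟨⟨x, x', y, y'⟩, h₁, h₂, h₃⟩
    have h₁' : x = x' := compat_shift_zero_iff.1 h₁
    have h₂' : y = y' := compat_shift_zero_iff.1 h₂
    change (X.page 0).d _ _ x' = y' at h₃
    subst h₁' h₂' h₃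
    exact ⟨x, rfl⟩

/-- The components of the unit of the adjunction between `Shift` and `Dec`. -/
def unitPage (X : ESpSe R) : ∀ r, X.page r ⟶ ((Dec R).obj ((Shift R).obj X)).page r
  | 0 => resTrInv (X.page 0) (transEmb 0) (invTransEmb 0) (transEmb_invTransEmb 0) ≫
      HomologicalComplex.restrictionMap X.shiftNerve invTransEmbZero
  | r + 1 => resTrInv (X.page (r + 1)) (transEmb (r + 1)) (invTransEmb (r + 1))
      (transEmb_invTransEmb (r + 1))

/-- The unit of the adjunction between `Shift` and `Dec`. -/
def shiftDecUnit (X : ESpSe R) : X ⟶ (Dec R).obj ((Shift R).obj X) :=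
  Hom.ofCompat X.unitPage (by
    rintro (_ | r) i x x' h
    · refine compat_dec_zero_iff.2 ⟨?_, ?_, compat_shift_succ_iff.2 (h.tr _)⟩ <;>
      exact IsClass.d_eq_zero (h.tr _) _
    · exact compat_dec_succ_iff.2 (compat_shift_succ_iff.2 (h.tr _)))

/-- The map from the inverse translate of the nerve which remembers the entry `x₀`. -/
def counitZero (Y : ESpSe R) : ((Dec R).obj Y).shiftZero ⟶ Y.page 0 where
  f i := ModuleCat.ofHom
    { toFun := fun v : Y.nerve.X (invTransEmbZero.f ((transEmb 0).f i)) =>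
        tr (Y.page 0) (invTransEmbZero.f ((transEmb 0).f i)) i v.1.1
      map_add' := fun v w => map_add _ v.1.1 w.1.1
      map_smul' := fun a v => map_smul _ a v.1.1 }
  comm' i j _ := by
    refine ModuleCat.hom_ext (LinearMap.ext fun v => ?_)
    -- The source has zero differential, and x₀ is a cycle because it represents φ x₁.
    exact (IsClass.d_eq_zero (Compat.tr
      (v : Y.nerve.X (invTransEmbZero.f ((transEmb 0).f i))).2.1 i) j).trans
      (map_zero (tr (Y.page 0) _ _).hom).symm

/-- The components of the counit of the adjunction between `Shift` and `Dec`. -/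
def counitPage (Y : ESpSe R) : ∀ r, ((Shift R).obj ((Dec R).obj Y)).page r ⟶ Y.page r
  | 0 => Y.counitZero
  | 1 => resTr Y.nerve (invTransEmb 0) (transEmb 0) (invTransEmb_transEmb 0) ≫ ρ Y
  | r + 2 => resTr (Y.page (r + 2)) (invTransEmb (r + 1)) (transEmb (r + 1))
      (invTransEmb_transEmb (r + 1))

/-- The counit of the adjunction between `Shift` and `Dec`. -/
def shiftDecCounit (Y : ESpSe R) : (Shift R).obj ((Dec R).obj Y) ⟶ Y :=
  Hom.ofCompat Y.counitPage (by
    rintro (_ | _ | r) i x x' h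
    · obtain rfl := compat_shift_zero_iff.1 h
      have h := Compat.tr (x : Y.nerve.X (invTransEmbZero.f ((transEmb 0).f i))).2.1 i
      exact (tr_naturality (ρ Y) _ i x : _) ▸ h
    · obtain ⟨-, -, h⟩ := compat_dec_zero_iff.1 (compat_shift_succ_iff.1 h)
      have h' := h.tr i
      exact (tr_naturality (ρ Y) _ i x : _) ▸ h'
    · exact (compat_dec_succ_iff.1 (compat_shift_succ_iff.1 h)).tr i)

/-- The adjunction between `Shift` and `Dec`. -/
def shiftDecAdj (R : Type u) [CommRing R] : Shift R ⊣ Dec R where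
  unit :=
    { app := shiftDecUnit
      naturality := fun X Y f => by
        ext (_ | r) : 1
        · refine hom_ext_apply fun i x => ?_
          refine (congrArg (fun y => Y.shiftNerve.f (invTransEmbZero.f i) y)
            (tr_naturality (f.page 0) _ _ x)).trans (Subtype.ext ?_)
          refine Prod.ext rfl (Prod.ext rfl (Prod.ext ?_ ?_)) <;> exact comm_apply _ _ _ _
        · exact hom_ext_apply fun i x => tr_naturality (f.page (r + 1)) _ _ x }
  counit :=
    { app := shiftDecCounit
      naturality := fun X Y f => by
        ext (_ | _ | r) : 1
        · exact hom_ext_apply fun i x => tr_naturality (f.page 0) _ _ _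
        · refine hom_ext_apply fun i x => ?_
          exact congrArg ((ρ Y).f i) (tr_naturality (nerveMap f) _ _ x)
        · exact hom_ext_apply fun i x => tr_naturality (f.page (r + 2)) _ _ x }
  left_triangle_components X := by
    ext (_ | _ | r) : 1
    · exact hom_ext_apply fun i x => tr_shiftZero_tr X (invTransEmb_transEmb 0 i) x
    · refine hom_ext_apply fun i x => ?_
      exact (tr_naturality (ρ ((Shift R).obj X)) _ _ _).symm.trans
        (tr_restriction_tr (e := transEmb 0) (invTransEmb_transEmb 0 i) x)
    · exact hom_ext_apply fun i x =>
        tr_restriction_tr (e := transEmb (r + 1)) (invTransEmb_transEmb (r + 1) i) x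
  right_triangle_components Y := by
    ext (_ | r) : 1
    · refine hom_ext_apply fun i v => nerve_ext (X := Y) (i := invTransEmbZero.f i) ?_ ?_ ?_
      · exact tr_nerve_restriction (transEmb_invTransEmb 0 i) v
      · have hv := congrArg (fun w : Y.nerve.X (invTransEmbZero.f i) => w.1.2.1)
          (tr_tr_restriction (K := Y.nerve) (e := invTransEmbZero) (transEmb_invTransEmb 0 i) v)
        exact hv
      -- The unit sends v to (z, z; dz, dz), where z is v transported along the reindexing, and the
      -- counit then keeps the entry x₀ of dz. That entry is y₀ of z, by the formula for the
      -- differential of the nerve.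
      · let j := invTransEmbZero.f i
        have hj (k : ℤ × ℤ) : invTransEmbZero.f ((transEmb 0).f k) = k := invTransEmb_transEmb 0 k
        let z : Y.nerve.X (invTransEmbZero.f ((transEmb 0).f j)) :=
          tr (Y.nerve.restriction invTransEmbZero) i ((transEmb 0).f j) v
        have hz : tr Y.nerve (invTransEmbZero.f ((transEmb 0).f j)) j z = v :=
          tr_tr_restriction (K := Y.nerve) (e := invTransEmbZero) (transEmb_invTransEmb 0 i) v
        let y : Y.nerve.X (invTransEmbZero.f ((transEmb 0).f (tgt j))) := Y.nerve.d _ _ z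
        have h₁ : tr Y.nerve (invTransEmbZero.f ((transEmb 0).f (tgt j))) (tgt j) y =
            Y.nerve.d j (tgt j) v :=
          (d_tr (K := Y.nerve) (hj j) (hj (tgt j)) z).symm.trans (congrArg _ hz)
        have h₂ := congrArg Prod.fst (tr_nerve Y (hj (tgt j)) y)
        have h₃ := congrArg (fun w : Y.nerve.X (tgt j) => w.1.1) h₁
        exact h₂.symm.trans (h₃.trans (tr_self_apply (tgt j) v.1.2.2.1))
    · exact hom_ext_apply fun i x => tr_tr_restriction (K := Y.page (r + 2))
        (e := invTransEmb (r + 1)) (transEmb_invTransEmb (r + 1) i) x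

end ESpSe

/-! ### The quotient Cone_1(X_0)/Im q and the adjunction `LDec ⊣ Shift`. -/

namespace ESpSe

variable {R : Type u} [CommRing R]

/-! ### The comparison between the first page and the cokernel of `q` -/

section Coker

variable (X : ESpSe R)

/-- The class of a pair in `Cone_1(X_0) / Im q`. -/
def cokerMk (i : ℤ × ℤ) :
    ((X.page 0).X i × (X.page 0).X (src i)) →ₗ[R] X.coker.X i :=
  Submodule.mkQ (LinearMap.range (X.q i))

variable {X}

lemma cokerMk_surjective (i : ℤ × ℤ) : Function.Surjective (X.cokerMk i) :=
  Submodule.mkQ_surjective _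

lemma cokerMk_eq_zero_iff {i : ℤ × ℤ} {a : (X.page 0).X i} {b : (X.page 0).X (src i)} :
    X.cokerMk i (a, b) = 0 ↔ ∃ v : X.nerve.X (src i),
      -tr (X.page 0) (tgt (src i)) i v.1.2.2.1 = a ∧ v.1.1 = b := by
  refine (Submodule.Quotient.mk_eq_zero _).trans (exists_congr fun v => ?_)
  exact Prod.ext_iff

/-- The quadruple (0, 0; -y, 0) belongs to the nerve when y is a boundary, and q sends it to (y, 0).
Hence the class of (x₀, 0) depends only on the homology class of x₀. -/
lemma cokerMk_boundary {i : ℤ × ℤ} {y : (X.page 0).X i} (hy : Compat X 0 i y 0) :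
    X.cokerMk i (y, 0) = 0 := by
  have h : Compat X 0 (tgt (src i)) (-tr (X.page 0) i (tgt (src i)) y) 0 := by
    have := (hy.tr (tgt (src i))).smul (-1 : R)
    simpa using this
  refine cokerMk_eq_zero_iff.2 ⟨⟨(0, 0, _, 0), Compat.zero, h, map_zero _⟩, ?_, rfl⟩
  change -tr (X.page 0) (tgt (src i)) i (-tr (X.page 0) i (tgt (src i)) y) = y
  rw [map_neg, neg_neg]
  exact tr_tr_self (tgt_src i) y

lemma cokerMk_eq_of_compat {i : ℤ × ℤ} {x₀ y₀ : (X.page 0).X i} {x₁ : (X.page 1).X i}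
    (hx : Compat X 0 i x₀ x₁) (hy : Compat X 0 i y₀ x₁) :
    X.cokerMk i (x₀, 0) = X.cokerMk i (y₀, 0) := by
  have h : Compat X 0 i (x₀ - y₀) 0 := by
    have := hx.add (hy.smul (-1 : R))
    simpa [sub_eq_add_neg] using this
  have := cokerMk_boundary h
  rw [← sub_eq_zero, ← map_sub]
  simpa using this

/-- The map from the first page to `Cone_1(X_0) / Im q` in a given bidegree. -/
def pageOneToCokerLin (X : ESpSe R) (i : ℤ × ℤ) : (X.page 1).X i →ₗ[R] X.coker.X i :=
  have key {x₀ : (X.page 0).X i} {x₁ : (X.page 1).X i} (h : Compat X 0 i x₀ x₁) :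
      X.cokerMk i ((Compat.exists_left (X := X) (r := 0) x₁).choose, 0) = X.cokerMk i (x₀, 0) :=
    cokerMk_eq_of_compat (Compat.exists_left (X := X) (r := 0) x₁).choose_spec h
  { toFun := fun x₁ => X.cokerMk i ((Compat.exists_left (X := X) (r := 0) x₁).choose, 0)
    map_add' := fun x y => by
      rw [key ((Compat.exists_left (X := X) (r := 0) x).choose_spec.add
        (Compat.exists_left (X := X) (r := 0) y).choose_spec), ← map_add]
      simp
    map_smul' := fun a x => by
      rw [key ((Compat.exists_left (X := X) (r := 0) x).choose_spec.smul a), RingHom.id_apply,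
        ← map_smul]
      simp }

lemma pageOneToCokerLin_eq {i : ℤ × ℤ} {x₀ : (X.page 0).X i} {x₁ : (X.page 1).X i}
    (h : Compat X 0 i x₀ x₁) : X.pageOneToCokerLin i x₁ = X.cokerMk i (x₀, 0) :=
  cokerMk_eq_of_compat (Compat.exists_left (X := X) (r := 0) x₁).choose_spec h

lemma ρ_surjective (X : ESpSe R) (i : ℤ × ℤ) : Function.Surjective ((ρ X).f i) := by
  intro x₁
  obtain ⟨x₀, hx⟩ := Compat.exists_left (X := X) (r := 0) x₁
  obtain ⟨y₀, hy⟩ := Compat.exists_left (X := X) (r := 0) ((X.page 1).d i (tgt i) x₁)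
  exact ⟨⟨(x₀, x₁, y₀, _), hx, hy, rfl⟩, rfl⟩

/-- This factorization of κ through the surjection ρ makes compatibility with differentials on page
1 a consequence of that of κ and ρ. -/
lemma pageOneToCokerLin_ρ (i : ℤ × ℤ) (v : X.nerve.X i) :
    X.pageOneToCokerLin i ((ρ X).f i v) = (κ X).f i v :=
  pageOneToCokerLin_eq v.2.1

/-- The morphism from the first page to `Cone_1(X_0) / Im q` which sends `x₁` to the class of
`(x₀, 0)` for any representative `x₀` of `φ x₁`. -/
def pageOneToCoker (X : ESpSe R) : X.page 1 ⟶ X.coker where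
  f i := ModuleCat.ofHom (X.pageOneToCokerLin i)
  comm' i j _ := by
    refine ModuleCat.hom_ext (LinearMap.ext fun x => ?_)
    obtain ⟨v, rfl⟩ := ρ_surjective X i x
    change X.coker.d i j (X.pageOneToCokerLin i ((ρ X).f i v)) =
      X.pageOneToCokerLin j ((X.page 1).d i j ((ρ X).f i v))
    rw [comm_apply, pageOneToCokerLin_ρ, pageOneToCokerLin_ρ, comm_apply]

lemma pageOneToCoker_apply {i : ℤ × ℤ} {x₀ : (X.page 0).X i} {x₁ : (X.page 1).X i}
    (h : Compat X 0 i x₀ x₁) : X.pageOneToCoker.f i x₁ = X.cokerMk i (x₀, 0) :=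
  pageOneToCokerLin_eq h

lemma pageOneToCoker_naturality {X Y : ESpSe R} (f : X ⟶ Y) :
    f.page 1 ≫ Y.pageOneToCoker = X.pageOneToCoker ≫ cokerMap f := by
  refine hom_ext_apply fun i x => ?_
  obtain ⟨x₀, hx⟩ := Compat.exists_left (X := X) (r := 0) x
  refine (pageOneToCoker_apply (hx.map f)).trans ?_
  refine Eq.trans ?_ (congrArg ((cokerMap f).f i) (pageOneToCoker_apply hx)).symm
  exact congrArg (fun y => Y.cokerMk i ((f.page 0).f i x₀, y)) (map_zero ((f.page 0).f _).hom).symm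

lemma coker_d_cokerMk (i j : ℤ × ℤ) (a : (X.page 0).X i) (b : (X.page 0).X (src i)) :
    X.coker.d i j (X.cokerMk i (a, b)) = X.cokerMk j (0, tr (X.page 0) i (src j) a) := rfl

/-- If the first characteristic map is injective, the first page is quasi-isomorphic to
`Cone_1(X_0) / Im q`. -/
lemma quasiIso_pageOneToCoker (h : ∀ i, Function.Injective (X.φ 0 i)) :
    QuasiIso X.pageOneToCoker := by
  have hφ {i : ℤ × ℤ} {x₀ : (X.page 0).X i} {x₁ y₁ : (X.page 1).X i} (hx : Compat X 0 i x₀ x₁)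
      (hy : Compat X 0 i x₀ y₁) : x₁ = y₁ := h i (IsClass.unique hx hy)
  refine quasiIso_of_elements _ src tgt (fun i => rel_one_iff.2 (tgt_src i))
    (fun i => rel_one_iff.2 rfl) ?_ ?_
  · intro i x hx w hw
    obtain ⟨⟨a, b⟩, rfl⟩ := cokerMk_surjective _ w
    obtain ⟨x₀, hx₀⟩ := Compat.exists_left (X := X) (r := 0) x
    rw [coker_d_cokerMk, pageOneToCoker_apply hx₀, eq_comm, ← sub_eq_zero, ← map_sub] at hw
    -- The classes of (x₀, 0) and (0, a) agree, so (x₀, -a) = q v. Thus y₀ = -x₀ in v, injectivity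
    -- of `φ 0` forces y₁ = -x, and y₁ is the boundary of the entry x₁ of v.
    obtain ⟨v, hv₁, hv₂⟩ := cokerMk_eq_zero_iff.1
      ((congrArg (X.cokerMk i) (Prod.ext rfl rfl)).trans hw)
    have hv : (X.page 1).d (src i) (tgt (src i)) v.1.2.1 = v.1.2.2.2 := v.2.2.2
    have h₁ := (v.2.2.1.tr i).smul (-1 : R)
    rw [neg_one_smul, hv₁] at h₁
    have h₂ := hφ (by simpa using hx₀) h₁
    refine ⟨-v.1.2.1, ?_⟩
    have h₃ := d_tr (K := X.page 1) (rfl : src i = src i) (tgt_src i) v.1.2.1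
    rw [tr_self_apply, hv] at h₃
    rw [map_neg, h₃, h₂, neg_one_smul]
  · intro i y hy
    obtain ⟨⟨a, b⟩, rfl⟩ := cokerMk_surjective _ y
    rw [coker_d_cokerMk] at hy
    obtain ⟨v, hv₁, hv₂⟩ := cokerMk_eq_zero_iff.1 hy
    have hs : src (tgt i) = i := src_tgt i
    -- The class of (a, b) being a cycle means (0, a) = q v, so v has the form (a, x₁; 0, y₁); it is
    -- moved from bidegree `src (tgt i)` to i.
    obtain ⟨w, hw⟩ : ∃ w : X.nerve.X i, w.1.2.2.1 = 0 ∧ w.1.1 = a := by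
      refine ⟨tr X.nerve (src (tgt i)) i v, ?_, ?_⟩
      · rw [tr_nerve X hs]
        have := congrArg (tr (X.page 0) (tgt i) (tgt (src (tgt i)))) hv₁
        rw [map_neg, map_zero, neg_eq_zero, tr_tr_self (tgt_src _).symm] at this
        change tr (X.page 0) _ _ v.1.2.2.1 = 0
        rw [this, map_zero]
      · rw [tr_nerve X hs]
        change tr (X.page 0) _ _ v.1.1 = a
        rw [hv₂]
        exact tr_tr_self hs a
    obtain ⟨hw₁, hw₂⟩ := hw
    -- Since y₀ = 0, injectivity of `φ 0` gives y₁ = 0, so x₁ is a cycle of page 1. It maps to the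
    -- class of (a, 0), and (a, b) differs from this by the boundary of (b, 0).
    have hw₃ : w.1.2.2.2 = 0 := by
      have := w.2.2.1
      rw [hw₁] at this
      exact hφ this Compat.zero
    have hd : (X.page 1).d i (tgt i) w.1.2.1 = w.1.2.2.2 := w.2.2.2
    refine ⟨w.1.2.1, hd.trans hw₃, X.cokerMk (src i) (b, 0), ?_⟩
    rw [pageOneToCoker_apply w.2.1, coker_d_cokerMk, tr_self_apply, ← map_add, hw₂]
    simp

/-! ### The adjunction between `LDec` and `Shift` -/

/-- The map `X_0 ⟶ Cone_1(X_0) / Im q` which sends `x` to the class of `(x, 0)`. -/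
def ldecUnitZero (X : ESpSe R) : X.page 0 ⟶ ((LDec R).obj X).shiftZero where
  f i := ModuleCat.ofHom
    ((tr X.coker i (invTransEmbZero.f ((transEmb 0).f i))).hom ∘ₗ X.cokerMk i ∘ₗ
      LinearMap.inl R _ _)
  comm' i j _ := by
    refine ModuleCat.hom_ext (LinearMap.ext fun x => ?_)
    -- The target has zero differential, so boundaries of X_0 must vanish in the quotient.
    have h : X.cokerMk j ((X.page 0).d i j x, 0) = 0 := by
      refine cokerMk_boundary ?_
      rw [compat_iff, map_zero]
      exact IsClass.d x
    exact ((congrArg (tr X.coker j (invTransEmbZero.f ((transEmb 0).f j))) h).trans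
      (map_zero (tr X.coker _ _).hom)).symm

/-- The components of the unit of the adjunction between `LDec` and `Shift`. -/
def ldecUnitPage (X : ESpSe R) : ∀ r, X.page r ⟶ ((Shift R).obj ((LDec R).obj X)).page r
  | 0 => X.ldecUnitZero
  | 1 => X.pageOneToCoker ≫
      resTrInv X.coker (invTransEmb 0) (transEmb 0) (invTransEmb_transEmb 0)
  | r + 2 => resTrInv (X.page (r + 2)) (invTransEmb (r + 1)) (transEmb (r + 1))
      (invTransEmb_transEmb (r + 1))

/-- The unit of the adjunction between `LDec` and `Shift`. -/
def ldecShiftUnit (X : ESpSe R) : X ⟶ (Shift R).obj ((LDec R).obj X) :=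
  Hom.ofCompat X.ldecUnitPage (by
    rintro (_ | _ | r) i x x' h
    · refine compat_shift_zero_iff.2 ?_
      exact (congrArg (tr X.coker i _) (pageOneToCoker_apply h)).symm
    · refine compat_shift_succ_iff.2 (compat_ldec_zero_iff.2 ?_)
      obtain ⟨x₀, hx⟩ := Compat.exists_left (X := X) (r := 0) x
      let v : X.nerve.X i := ⟨(x₀, x, 0, 0), hx, Compat.zero, IsClass.d_eq_zero h _⟩
      have hi : i = invTransEmbZero.f ((transEmb 0).f i) := (invTransEmb_transEmb 0 i).symm
      refine ⟨tr X.nerve _ _ v, ?_, ?_, ?_, 0, ?_⟩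
      · rw [tr_nerve X hi]
        exact map_zero _
      · rw [tr_nerve X hi]
        exact map_zero _
      · rw [tr_nerve X hi]
        exact h.tr _
      · rw [map_zero, add_zero, ← tr_naturality]
        exact congrArg (tr X.coker _ _) (pageOneToCoker_apply hx)
    · exact compat_shift_succ_iff.2 (compat_ldec_succ_iff.2 (h.tr _)))

/-- The map `(a, b) ↦ a + d b` in a given bidegree. -/
def cokerShiftLin (Y : ESpSe R) (i : ℤ × ℤ) :
    ((Shift R).obj Y).coker.X i →ₗ[R] (Y.page 0).X ((transEmb 0).f i) :=
  Submodule.liftQ _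
    (LinearMap.coprod LinearMap.id
      ((Y.page 0).d ((transEmb 0).f (src i)) ((transEmb 0).f i)).hom) (by
    -- A quadruple of the nerve of `Shift Y` is (x, x; dx, dx). Its image (-dx, x) under q is killed
    -- by (a, b) ↦ a + d b.
    rintro _ ⟨⟨⟨x, x', y, y'⟩, h₁, h₂, h₃⟩, rfl⟩
    have h₁' : x = x' := compat_shift_zero_iff.1 h₁
    have h₂' : y = y' := compat_shift_zero_iff.1 h₂
    change (Y.page 0).d _ _ x' = y' at h₃
    subst h₁' h₂' h₃
    have h := d_tr (K := Y.page 0) (rfl : (transEmb 0).f (src i) = _)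
      (congrArg (transEmb 0).f (tgt_src i)) x
    have h' := (congrArg ((Y.page 0).d _ _) (tr_self_apply (K := Y.page 0) _ x)).symm.trans h
    have h'' := tr_shiftZero_apply Y (tgt_src i)
      ((Y.page 0).d ((transEmb 0).f (src i)) ((transEmb 0).f (tgt (src i))) x)
    exact (congrArg₂ (fun u v : (Y.page 0).X ((transEmb 0).f i) => -u + v) h'' h').trans
      (neg_add_cancel _))

lemma cokerShiftLin_cokerMk (Y : ESpSe R) (i : ℤ × ℤ) (a : (Y.page 0).X ((transEmb 0).f i))
    (b : (Y.page 0).X ((transEmb 0).f (src i))) :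
    Y.cokerShiftLin i (((Shift R).obj Y).cokerMk i (a, b)) =
      a + (Y.page 0).d ((transEmb 0).f (src i)) ((transEmb 0).f i) b := rfl

/-- The morphism `Cone_1 (Shift Y) / Im q ⟶ T Y_0`, `(a, b) ↦ a + d b`. -/
def cokerShift (Y : ESpSe R) :
    ((Shift R).obj Y).coker ⟶ (Y.page 0).restriction (transEmb 0) where
  f i := ModuleCat.ofHom (Y.cokerShiftLin i)
  comm' i j hij := by
    have hij' : i = src j := by rw [← rel_one_iff.1 hij, src_tgt]
    refine ModuleCat.hom_ext (LinearMap.ext fun x => ?_)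
    obtain ⟨⟨a, b⟩, rfl⟩ := cokerMk_surjective _ x
    subst hij'
    have h₁ : Y.cokerShiftLin (src j) (((Shift R).obj Y).cokerMk (src j) (a, b)) = _ :=
      cokerShiftLin_cokerMk Y (src j) a b
    have h₂ : Y.cokerShiftLin j (((Shift R).obj Y).coker.d (src j) j
        (((Shift R).obj Y).cokerMk (src j) (a, b))) = _ :=
      cokerShiftLin_cokerMk Y j 0 (tr Y.shiftZero (src j) (src j) a)
    refine (congrArg ((Y.page 0).d _ _) h₁).trans (Eq.trans ?_ h₂.symm)
    exact (d_add_d (Y.page 0) _ _ _ a b).trans ((zero_add _).trans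
      (congrArg ((Y.page 0).d ((transEmb 0).f (src j)) ((transEmb 0).f j))
        (tr_self_apply (K := Y.shiftZero) _ a))).symm

lemma cokerShift_cokerMk (Y : ESpSe R) (i : ℤ × ℤ) (a : (Y.page 0).X ((transEmb 0).f i)) :
    Y.cokerShift.f i (((Shift R).obj Y).cokerMk i (a, 0)) = a :=
  (cokerShiftLin_cokerMk Y i a 0).trans ((congrArg (a + ·) (map_zero _)).trans (add_zero a))

lemma cokerMap_cokerMk {X Y : ESpSe R} (f : X ⟶ Y) (i : ℤ × ℤ) (a : (X.page 0).X i)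
    (b : (X.page 0).X (src i)) : (cokerMap f).f i (X.cokerMk i (a, b)) =
      Y.cokerMk i ((f.page 0).f i a, (f.page 0).f (src i) b) := rfl

lemma cokerMap_cokerMk_zero {X Y : ESpSe R} (f : X ⟶ Y) (i : ℤ × ℤ) (a : (X.page 0).X i) :
    (cokerMap f).f i (X.cokerMk i (a, 0)) = Y.cokerMk i ((f.page 0).f i a, 0) := by
  rw [cokerMap_cokerMk, map_zero]

lemma cokerShift_naturality {X Y : ESpSe R} (f : X ⟶ Y) :
    cokerMap ((Shift R).map f) ≫ Y.cokerShift =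
      X.cokerShift ≫ HomologicalComplex.restrictionMap (f.page 0) (transEmb 0) := by
  refine hom_ext_apply fun i x => ?_
  obtain ⟨⟨a, b⟩, rfl⟩ := cokerMk_surjective _ x
  refine (cokerShiftLin_cokerMk Y i ((f.page 0).f _ a) ((f.page 0).f _ b)).trans ?_
  refine (congrArg _ (comm_apply (f.page 0) _ _ b)).trans ?_
  exact ((congrArg ((f.page 0).f _) (cokerShiftLin_cokerMk X i a b)).trans (map_add _ _ _)).symm

/-- The differential of the cone moves b to the second entry, so classes of the form (a, 0) generate
the quotient as a complex. -/
lemma cokerMk_add_d (i : ℤ × ℤ) (a : (X.page 0).X i) (b : (X.page 0).X (src i)) :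
    X.cokerMk i (a, 0) + X.coker.d (src i) i (X.cokerMk (src i) (b, 0)) = X.cokerMk i (a, b) := by
  rw [coker_d_cokerMk, tr_self_apply, ← map_add]
  simp

lemma tr_cokerShift_tr (Y : ESpSe R) {i j : ℤ × ℤ} (h : j = i)
    (y : (Y.page 0).X ((transEmb 0).f i)) :
    tr (Y.page 0) ((transEmb 0).f j) ((transEmb 0).f i)
      (Y.cokerShift.f j (tr ((Shift R).obj Y).coker i j
        (((Shift R).obj Y).cokerMk i (y, 0)))) = y := by
  subst h
  rw [tr_self_apply, cokerShift_cokerMk]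
  exact tr_self_apply _ y

/-- The components of the counit of the adjunction between `LDec` and `Shift`. -/
def ldecCounitPage (Y : ESpSe R) : ∀ r, ((LDec R).obj ((Shift R).obj Y)).page r ⟶ Y.page r
  | 0 => HomologicalComplex.restrictionMap Y.cokerShift invTransEmbZero ≫
      resTr (Y.page 0) (transEmb 0) (invTransEmb 0) (transEmb_invTransEmb 0)
  | r + 1 => resTr (Y.page (r + 1)) (transEmb (r + 1)) (invTransEmb (r + 1))
      (transEmb_invTransEmb (r + 1))

/-- The counit of the adjunction between `LDec` and `Shift`. -/
def ldecShiftCounit (Y : ESpSe R) : (LDec R).obj ((Shift R).obj Y) ⟶ Y :=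
  Hom.ofCompat Y.ldecCounitPage (by
    rintro (_ | r) i x x' h
    -- Here x is κ v plus a boundary. The entries x₀ and x₁ of v coincide in `Shift Y`, so
    -- `cokerShift` sends κ v to x₁, which represents φ x', and the boundary to a boundary.
    · obtain ⟨v, -, -, hv, w, hw⟩ := compat_ldec_zero_iff.1 h
      have hv' := compat_shift_succ_iff.1 hv
      have hv₀ : v.1.1 = v.1.2.1 := compat_shift_zero_iff.1 v.2.1
      have h₁ : Y.cokerShift.f (invTransEmbZero.f i) (((κ ((Shift R).obj Y)).f _ v)) = v.1.2.1 :=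
        (cokerShift_cokerMk Y (invTransEmbZero.f i) v.1.1).trans hv₀
      have h₂ := congrArg (Y.cokerShift.f (invTransEmbZero.f i)) hw
      rw [map_add, h₁, ← comm_apply] at h₂
      have h₃ := (compat_iff.1 hv').add_d (Y.cokerShift.f _ w)
      have h₄ : IsClass (Y.page 0) _ (Y.cokerShift.f (invTransEmbZero.f i) x) _ := h₂ ▸ h₃
      exact Compat.tr h₄ i
    · exact (compat_shift_succ_iff.1 (compat_ldec_succ_iff.1 h)).tr i)

/-- The adjunction between `LDec` and `Shift`. -/
def ldecShiftAdj (R : Type u) [CommRing R] : LDec R ⊣ Shift R where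
  unit :=
    { app := ldecShiftUnit
      naturality := fun X Y f => by
        ext (_ | _ | r) : 1
        · refine hom_ext_apply fun i x => ?_
          exact (congrArg (tr Y.coker i _) (cokerMap_cokerMk_zero f i x)).symm.trans
            (tr_naturality (cokerMap f) _ _ _)
        · refine hom_ext_apply fun i x => ?_
          exact (congrArg (tr Y.coker i _) (congrArg (fun g => g.f i x)
            (pageOneToCoker_naturality f))).trans
            (tr_naturality (cokerMap f) _ _ (X.pageOneToCoker.f i x))
        · exact hom_ext_apply fun i x => tr_naturality (f.page (r + 2)) _ _ x }
  counit :=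
    { app := ldecShiftCounit
      naturality := fun X Y f => by
        ext (_ | r) : 1
        · refine hom_ext_apply fun i x => ?_
          exact (congrArg (tr (Y.page 0) _ i) (congrArg (fun g => g.f (invTransEmbZero.f i) x)
            (cokerShift_naturality f))).trans (tr_naturality (f.page 0) _ _ _)
        · exact hom_ext_apply fun i x => tr_naturality (f.page (r + 1)) _ _ x }
  left_triangle_components X := by
    ext (_ | r) : 1
    · refine hom_ext_apply fun i x => ?_
      obtain ⟨⟨a, b⟩, rfl⟩ := cokerMk_surjective (X := X) (invTransEmbZero.f i) x
      let j := invTransEmbZero.f i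
      have hj (k : ℤ × ℤ) : k = invTransEmbZero.f ((transEmb 0).f k) :=
        (invTransEmb_transEmb 0 k).symm
      -- On the class of (a, b), the unit followed by the counit gives [(a, 0)] + d[(b, 0)] up to
      -- transport; this is the class of (a, b) by `cokerMk_add_d`.
      have h₁ := congrArg (tr X.coker j (invTransEmbZero.f ((transEmb 0).f j)) (X.cokerMk j (a, 0)) + ·)
        (d_tr (K := X.coker) (hj (src j)) (hj j) (X.cokerMk (src j) (b, 0)))
      have h₂ := h₁.trans (map_add (tr X.coker j (invTransEmbZero.f ((transEmb 0).f j))).hom _ _).symm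
      have h₃ := h₂.trans (congrArg _ (cokerMk_add_d j a b))
      exact (congrArg (tr (X.coker.restriction invTransEmbZero) ((transEmb 0).f j) i) h₃).trans
        (tr_restriction_tr (K := X.coker) (e := invTransEmbZero) (transEmb_invTransEmb 0 i)
          (X.cokerMk j (a, b)))
    · exact hom_ext_apply fun i x => 
        tr_restriction_tr (e := invTransEmb (r + 1)) (transEmb_invTransEmb (r + 1) i) x
  right_triangle_components Y := by
    ext (_ | _ | r) : 1
    · refine hom_ext_apply fun i v => ?_
      exact tr_cokerShift_tr Y (invTransEmb_transEmb 0 i) v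
    · refine hom_ext_apply fun i v => ?_
      have h : ((Shift R).obj Y).pageOneToCoker.f i v = ((Shift R).obj Y).cokerMk i (v, 0) :=
        pageOneToCoker_apply (compat_shift_zero_iff.2 rfl)
      exact (congrArg (fun z => tr (Y.page 0) _ _ (Y.cokerShift.f _
        (tr ((Shift R).obj Y).coker i _ z))) h).trans
          (tr_cokerShift_tr Y (invTransEmb_transEmb 0 i) v)
    · exact hom_ext_apply fun i x => tr_tr_restriction (K := Y.page (r + 1))
        (e := transEmb (r + 1)) (invTransEmb_transEmb (r + 1) i) x

end Coker

end ESpSe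

/-! ### Completeness and cocompleteness. -/

namespace ESpSe

variable {R : Type u} [CommRing R]

/-! ### Colimits -/

section Colimits

open Limits

/-- The functor which sends an extended spectral sequence to its page `r`. -/
def pageFunctor (R : Type u) [CommRing R] (r : ℕ) : ESpSe R ⥤ BiComplex R r where
  obj X := X.page r
  map f := f.page r

variable {J : Type u} [SmallCategory J] (F : J ⥤ ESpSe R)

/-- The colimit of the terms of given bidegree on the page `r` of a diagram. -/
def isColimitEvalPage (r : ℕ) (i : ℤ × ℤ) :
    IsColimit ((HomologicalComplex.eval (ModuleCat.{u} R) (pageShape r) i).mapCocone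
      (colimit.cocone (F ⋙ pageFunctor R r))) :=
  isColimitOfPreserves _ (colimit.isColimit _)

/-- The inclusion of a page in the pagewise colimit. -/
def colimitιPage (j : J) (r : ℕ) : (F.obj j).page r ⟶ colimit (F ⋙ pageFunctor R r) :=
  colimit.ι (F ⋙ pageFunctor R r) j

lemma map_comp_colimitιPage {j k : J} (f : j ⟶ k) (r : ℕ) :
    Hom.page (F.map f) r ≫ colimitιPage F k r = colimitιPage F j r :=
  colimit.w (F ⋙ pageFunctor R r) f

/-- The pagewise colimit of a diagram. -/
def colimitObj : ESpSe R where
  page r := colimit (F ⋙ pageFunctor R r)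
  -- Homology need not commute with the colimit. The canonical maps H(F_j) ⟶ H(colim F) suffice,
  -- because characteristic maps end in homology.
  φ r i := (isColimitEvalPage F (r + 1) i).desc
    { pt := (colimit (F ⋙ pageFunctor R r)).homology i
      ι :=
        { app := fun j => (F.obj j).φ r i ≫ HomologicalComplex.homologyMap (colimitιPage F j r) i
          naturality := fun j k f => by
            refine Eq.trans ?_ (Category.comp_id _).symm
            change (Hom.page (F.map f) (r + 1)).f i ≫ (F.obj k).φ r i ≫ _ = _
            rw [← Category.assoc, (F.map f).comm, Category.assoc,
              ← HomologicalComplex.homologyMap_comp, map_comp_colimitιPage]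
            rfl } }

lemma colimitObj_fac (r : ℕ) (i : ℤ × ℤ) (j : J) :
    (colimitιPage F j (r + 1)).f i ≫ (colimitObj F).φ r i = (F.obj j).φ r i ≫
      HomologicalComplex.homologyMap (colimitιPage F j r) i :=
  (isColimitEvalPage F (r + 1) i).fac _ j

variable {F} in
/-- The universal property of the pagewise colimit, on a page. -/
def colimitDescPage (s : Cocone F) (r : ℕ) :
    colimit (F ⋙ pageFunctor R r) ⟶ s.pt.page r :=
  colimit.desc (F ⋙ pageFunctor R r) ((pageFunctor R r).mapCocone s)

variable {F} in
lemma colimitιPage_desc (s : Cocone F) (r : ℕ) (j : J) :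
    colimitιPage F j r ≫ colimitDescPage s r = Hom.page (s.ι.app j) r :=
  colimit.ι_desc _ _

/-- The cocone with point the pagewise colimit. -/
def colimitCocone : Cocone F where
  pt := colimitObj F
  ι :=
    { app := fun j =>
        { page := fun r => colimitιPage F j r
          comm := fun r i => colimitObj_fac F r i j }
      naturality := fun j k f => by
        ext r : 1
        exact (colimit.w (F ⋙ pageFunctor R r) f).trans (Category.comp_id _).symm }

/-- The pagewise colimit is a colimit. -/
def colimitCoconeIsColimit : IsColimit (colimitCocone F) where
  desc s :=
    { page := fun r => colimitDescPage s r
      comm := fun r i => by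
        refine (isColimitEvalPage F (r + 1) i).hom_ext fun j => ?_
        change (colimitιPage F j (r + 1)).f i ≫ (colimitDescPage s (r + 1)).f i ≫ _ =
          (colimitιPage F j (r + 1)).f i ≫ (colimitObj F).φ r i ≫ _
        have h₁ : (colimitιPage F j (r + 1)).f i ≫ (colimitDescPage s (r + 1)).f i =
            (Hom.page (s.ι.app j) (r + 1)).f i := by
          rw [← HomologicalComplex.comp_f, colimitιPage_desc]
        have h₂ : HomologicalComplex.homologyMap (colimitιPage F j r) i ≫
            HomologicalComplex.homologyMap (colimitDescPage s r) i =
              HomologicalComplex.homologyMap (Hom.page (s.ι.app j) r) i := by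
          rw [← HomologicalComplex.homologyMap_comp, colimitιPage_desc]
        refine (Category.assoc _ _ _).symm.trans ((congrArg (· ≫ s.pt.φ r i) h₁).trans ?_)
        refine ((s.ι.app j).comm r i).trans ?_
        refine (congrArg ((F.obj j).φ r i ≫ ·) h₂.symm).trans ?_
        refine (Category.assoc _ _ _).symm.trans ?_
        exact (congrArg (· ≫ _) (colimitObj_fac F r i j).symm).trans (Category.assoc _ _ _) }
  fac s j := by
    ext r : 1
    exact colimit.ι_desc _ _
  uniq s m hm := by
    ext r : 1
    refine colimit.hom_ext fun j => ?_
    exact (congrArg (fun g => Hom.page g r) (hm j)).trans (colimitιPage_desc s r j).symm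

instance : HasColimits (ESpSe R) where
  has_colimits_of_shape _ _ := ⟨fun F => ⟨_, colimitCoconeIsColimit F⟩⟩

/-- Consequently epimorphisms and pushouts can be examined page by page. -/
instance (r : ℕ) : PreservesColimits (pageFunctor R r) where
  preservesColimitsOfShape := ⟨fun {F} =>
    preservesColimit_of_preserves_colimit_cocone (colimitCoconeIsColimit F)
      ((colimit.isColimit (F ⋙ pageFunctor R r)).ofIsoColimit (Cocone.ext (Iso.refl _)
        (fun _ => Category.comp_id _)))⟩

end Colimits

/-! ### Limits -/

section Limits

open Limits

instance epi_page {X Y : ESpSe R} (f : X ⟶ Y) [Epi f] (r : ℕ) : Epi (f.page r) :=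
  inferInstanceAs (Epi ((pageFunctor R r).map f))

/-- The factorization exists on each page of the epimorphism p. It respects the characteristic maps
because this may be tested after precomposing with the epimorphism on page r + 1. -/
lemma comp_desc_eq {X Y Z : ESpSe R} (p : X ⟶ Y) [Epi p] (q : X ⟶ Z)
    (h : ∀ r, kernel.ι (p.page r) ≫ q.page r = 0) : ∃ g : Y ⟶ Z, p ≫ g = q := by
  have hg (r : ℕ) : p.page r ≫ Abelian.epiDesc (p.page r) (q.page r) (h r) = q.page r :=
    Abelian.comp_epiDesc _ _ _
  refine ⟨⟨fun r => Abelian.epiDesc (p.page r) (q.page r) (h r), fun r i => ?_⟩, ?_⟩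
  · have : Epi ((p.page (r + 1)).f i) := inferInstance
    rw [← cancel_epi ((p.page (r + 1)).f i), ← Category.assoc, ← HomologicalComplex.comp_f, hg,
      ← Category.assoc, p.comm, Category.assoc, ← HomologicalComplex.homologyMap_comp, hg, q.comm]
  · ext r : 1
    exact hg r

/-- A quotient of X is determined by the family of its kernels on the pages of X, and such families
form a small set. -/
instance : WellPowered.{u} (ESpSe R)ᵒᵖ where
  subobject_small X := by
    let k (S : Subobject X) (r : ℕ) : Subobject (X.unop.page r) :=
      kernelSubobject (S.arrow.unop.page r)
    have hk (S T : Subobject X) (h : k S = k T) : S ≤ T := by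
      obtain ⟨g, hg⟩ := comp_desc_eq T.arrow.unop S.arrow.unop (fun r => by
        have h' : k T r = k S r := congrFun h.symm r
        have h₁ : (k T r).arrow ≫ S.arrow.unop.page r = 0 := by
          rw [h']
          exact kernelSubobject_arrow_comp _
        rw [← cancel_epi (kernelSubobjectIso (T.arrow.unop.page r)).hom, ← Category.assoc,
          kernelSubobject_arrow, comp_zero]
        exact h₁)
      exact Subobject.le_of_comm g.op (Quiver.Hom.unop_inj hg)
    exact small_of_injective (f := k) fun S T h => le_antisymm (hk S T h) (hk T S h.symm)

open ZeroObject in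
/-- The extended spectral sequence whose only nonzero page is the given page `0`. -/
def ofPageZero (K : BiComplex R 0) : ESpSe R where
  page r :=
    match r with
    | 0 => K
    | _ + 1 => 0
  φ _ _ := 0

lemma isZero_ofPageZero_page (K : BiComplex R 0) (r : ℕ) (i : ℤ × ℤ) :
    IsZero (((ofPageZero K).page (r + 1)).X i) :=
  (HomologicalComplex.eval (ModuleCat.{u} R) (pageShape (r + 1)) i).map_isZero (isZero_zero _)

/-- The morphisms from `ofPageZero K`. -/
def ofPageZeroDesc {K : BiComplex R 0} {Y : ESpSe R} (f : K ⟶ Y.page 0) : ofPageZero K ⟶ Y where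
  page r :=
    match r with
    | 0 => f
    | _ + 1 => 0
  comm r i := (isZero_ofPageZero_page K r i).eq_of_src _ _

/-- The free complex on a generator of a given bidegree. -/
abbrev disc (R : Type u) [CommRing R] (i : ℤ × ℤ) : BiComplex R 0 :=
  HomologicalComplex.double (𝟙 (ModuleCat.of R R)) (rel_nxt 0 i)

lemma nxt_ne (r : ℕ) (i : ℤ × ℤ) : i ≠ nxt r i := fun h =>
  (pageShape r).not_rel_of_eq h (rel_nxt r i)

/-- The morphism from the free complex given by an element. -/
def discDesc {K : BiComplex R 0} {i : ℤ × ℤ} (x : K.X i) : disc R i ⟶ K :=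
  (HomologicalComplex.evalCompCoyonedaCorepresentableByDoubleId (rel_nxt 0 i) (nxt_ne 0 i)
    (ModuleCat.of R R)).homEquiv.symm (ModuleCat.ofHom (LinearMap.toSpanSingleton R (K.X i) x))

/-- The generator of the free complex. -/
def discGen (R : Type u) [CommRing R] (i : ℤ × ℤ) : (disc R i).X i :=
  (HomologicalComplex.doubleXIso₀ (𝟙 (ModuleCat.of R R)) (rel_nxt 0 i)).inv (1 : R)

lemma discDesc_gen {K : BiComplex R 0} {i : ℤ × ℤ} (x : K.X i) :
    (discDesc x).f i (discGen R i) = x := by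
  have h := (HomologicalComplex.evalCompCoyonedaCorepresentableByDoubleId (rel_nxt 0 i)
    (nxt_ne 0 i) (ModuleCat.of R R)).homEquiv.apply_symm_apply
      (ModuleCat.ofHom (LinearMap.toSpanSingleton R (K.X i) x))
  have h' := congrArg (fun g : ModuleCat.of R R ⟶ K.X i => g (1 : R)) h
  exact h'.trans (one_smul R x)

/-- The iterated shift. -/
def shiftIter (X : ESpSe R) : ℕ → ESpSe R
  | 0 => X
  | s + 1 => (Shift R).obj (X.shiftIter s)

/-- Page s of `Dec` determines page s + 1: by reindexing for s > 0, and through the surjection ρ for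
s = 0. -/
lemma page_succ_eq_of_dec {X Y : ESpSe R} {f g : X ⟶ Y} {s : ℕ}
    (h : Hom.page ((Dec R).map f) s = Hom.page ((Dec R).map g) s) :
    f.page (s + 1) = g.page (s + 1) := by
  refine hom_ext_apply ((invTransEmb_surjective s).forall.2 fun j x => ?_)
  match s with
  | 0 =>
    obtain ⟨v, rfl⟩ := ρ_surjective X _ x
    have h₁ : (nerveMap f).f (invTransEmbZero.f j) v = (nerveMap g).f (invTransEmbZero.f j) v :=
      congrArg (fun k : (X.nerve.restriction invTransEmbZero) ⟶
        (Y.nerve.restriction invTransEmbZero) => k.f j v) h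
    exact congrArg ((ρ Y).f _) h₁
  | s + 1 =>
    exact congrArg (fun k : ((X.page (s + 2)).restriction (invTransEmb (s + 1))) ⟶
        ((Y.page (s + 2)).restriction (invTransEmb (s + 1))) => k.f j x) h

/-- Morphisms from a disc placed on page 0 pick out the elements of page 0. By adjunction, s-fold
shifts of discs pick out the page 0 of the s-fold `Dec`, which determines page s. -/
lemma page_eq_of_shiftIter_disc {X Y : ESpSe R} {f g : X ⟶ Y} {s : ℕ}
    (h : ∀ i (k : (ofPageZero (disc R i)).shiftIter s ⟶ X), k ≫ f = k ≫ g) :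
    f.page s = g.page s := by
  induction s generalizing X Y with
  | zero =>
    refine hom_ext_apply fun i x => ?_
    have := congrArg (fun k => (Hom.page k 0).f i (discGen R i)) (h i (ofPageZeroDesc (discDesc x)))
    exact (congrArg ((f.page 0).f i) (discDesc_gen x)).symm.trans
      (this.trans (congrArg ((g.page 0).f i) (discDesc_gen x)))
  | succ s ih =>
    refine page_succ_eq_of_dec (ih fun i k => ?_)
    apply ((shiftDecAdj R).homEquiv _ _).symm.injective
    rw [Adjunction.homEquiv_naturality_right_symm, Adjunction.homEquiv_naturality_right_symm]
    exact h i _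

lemma isSeparating_shiftIter_disc :
    (ObjectProperty.ofObj fun t : ℕ × ℤ × ℤ =>
      (ofPageZero (disc R t.2)).shiftIter t.1).IsSeparating := by
  intro X Y f g h
  ext s : 1
  exact page_eq_of_shiftIter_disc fun i k => h _ (ObjectProperty.ofObj_apply _ (s, i)) k

/-- A characteristic map into the homology of a pagewise limit would have to lift from the limit of
the homologies, so limits are not pagewise. They exist by the special adjoint functor theorem:
cocompleteness, small sets of quotients and a small separating set. -/
instance : HasLimits (ESpSe R) :=
  hasLimits_of_hasColimits_of_isSeparating (isSeparating_shiftIter_disc (R := R))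

end Limits

end ESpSe

/-! ### The small object argument for 0-bigraded complexes. -/

namespace ESpSe

variable {R : Type u} [CommRing R]

/-! ### Surjective quasi-isomorphisms of complexes -/

section SurjQi

/-- The class of morphisms of complexes which are degreewise surjective quasi-isomorphisms. -/
def surjQi (R : Type u) [CommRing R] (r : ℕ) : MorphismProperty (BiComplex R r) := fun _ _ f =>
  (∀ i, Function.Surjective (f.f i)) ∧ QuasiIso f

variable {r : ℕ} {K L : BiComplex R r}

lemma eq_nxt {i j : ℤ × ℤ} (h : (pageShape r).Rel i j) : j = nxt r i :=
  pageShape_rel.1 h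

lemma eq_prv {i j : ℤ × ℤ} (h : (pageShape r).Rel i j) : i = prv r j :=
  (pageShape r).prev_eq h (rel_prv r j)

lemma exists_of_quasiIso_inj' (f : K ⟶ L) [QuasiIso f] {i j k : ℤ × ℤ}
    (hij : (pageShape r).Rel i j) (hjk : (pageShape r).Rel j k) (x : K.X j) (hx : K.d j k x = 0)
    (w : L.X i) (hw : L.d i j w = f.f j x) : ∃ w', K.d i j w' = x := by
  obtain rfl := eq_prv hij
  obtain rfl := eq_nxt hjk
  exact exists_of_quasiIso_inj f j x hx w hw

lemma exists_of_quasiIso_surj' (f : K ⟶ L) [QuasiIso f] {i j : ℤ × ℤ}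
    (hij : (pageShape r).Rel i j) (y : L.X i) (hy : L.d i j y = 0) :
    ∃ x : K.X i, K.d i j x = 0 ∧ ∃ w, y = f.f i x + L.d (prv r i) i w := by
  obtain rfl := eq_nxt hij
  exact exists_of_quasiIso_surj f i y hy

/-- Forwards, a primitive c of a is corrected by a cycle and a boundary until it maps to b.
Backwards, a = 0 shows that cycles lift to cycles; then a general y lifts by first lifting the cycle
dy. -/
lemma surjQi_iff (f : K ⟶ L) : surjQi R r f ↔
    ∀ i j k, (pageShape r).Rel i j → (pageShape r).Rel j k → ∀ (a : K.X j) (b : L.X i),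
      K.d j k a = 0 → L.d i j b = f.f j a → ∃ c, K.d i j c = a ∧ f.f i c = b := by
  constructor
  · rintro ⟨hs, hq⟩ i j k hij hjk a b ha hb
    obtain ⟨c, rfl⟩ := exists_of_quasiIso_inj' f hij hjk a ha b hb
    have hc : L.d i j (b - f.f _ c) = 0 := by rw [map_sub, hb, comm_apply, sub_self]
    obtain ⟨z, hz, w, hw⟩ := exists_of_quasiIso_surj' f hij _ hc
    obtain ⟨w, rfl⟩ := hs _ w
    refine ⟨c + z + K.d _ _ w, ?_, ?_⟩
    · rw [map_add, map_add, hz, d_d_apply, add_zero, add_zero]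
    · rw [map_add, map_add, ← comm_apply, add_assoc, ← hw]
      abel
  · intro h
    have hc (i) (y : L.X i) (hy : L.d i (nxt r i) y = 0) :
        ∃ x, K.d i (nxt r i) x = 0 ∧ f.f i x = y :=
      h i _ _ (rel_nxt r i) (rel_nxt r _) 0 y (map_zero _) (by rw [hy, map_zero])
    refine ⟨fun i y => ?_, ?_⟩
    · obtain ⟨a, ha, ha'⟩ := hc _ (L.d i (nxt r i) y) (d_d_apply _ _ _ _ _)
      obtain ⟨c, -, hc'⟩ := h i _ _ (rel_nxt r i) (rel_nxt r _) a y ha ha'.symm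
      exact ⟨c, hc'⟩
    · refine quasiIso_of_elements f _ _ (rel_prv r) (rel_nxt r) ?_ ?_
      · intro i x hx w hw
        obtain ⟨c, hc, -⟩ := h _ _ _ (rel_prv r i) (rel_nxt r i) x w hx hw
        exact ⟨c, hc⟩
      · intro i y hy
        obtain ⟨x, hx, rfl⟩ := hc i y hy
        exact ⟨x, hx, 0, by simp⟩

end SurjQi

/-! ### Spheres and discs -/

section Sphere

/-- The complex which is free of rank one in a given bidegree, and zero elsewhere. -/
abbrev sphere (R : Type u) [CommRing R] (j : ℤ × ℤ) : BiComplex R 0 :=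
  (HomologicalComplex.single (ModuleCat.{u} R) (pageShape 0) j).obj (ModuleCat.of R R)

/-- The generator of the sphere. -/
def sphereGen (R : Type u) [CommRing R] (j : ℤ × ℤ) : (sphere R j).X j :=
  (HomologicalComplex.singleObjXSelf (pageShape 0) j (ModuleCat.of R R)).inv (1 : R)

/-- The morphism from the sphere given by a cycle. -/
def sphereDesc {K : BiComplex R 0} {j : ℤ × ℤ} (x : K.X j) (hx : K.d j (nxt 0 j) x = 0) :
    sphere R j ⟶ K :=
  HomologicalComplex.mkHomFromSingle (ModuleCat.ofHom (LinearMap.toSpanSingleton R (K.X j) x))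
    (by
      intro k hk
      obtain rfl := eq_nxt hk
      refine ModuleCat.hom_ext (LinearMap.ext_ring ?_)
      change K.d j _ ((1 : R) • x) = 0
      rw [one_smul, hx])

lemma sphereDesc_gen {K : BiComplex R 0} {j : ℤ × ℤ} (x : K.X j)
    (hx : K.d j (nxt 0 j) x = 0) : (sphereDesc x hx).f j (sphereGen R j) = x := by
  rw [sphereDesc, HomologicalComplex.mkHomFromSingle_f, sphereGen, ConcreteCategory.comp_apply,
    ← ConcreteCategory.comp_apply (HomologicalComplex.singleObjXSelf _ _ _).inv, Iso.inv_hom_id]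
  exact one_smul R x

lemma sphere_hom_ext {K : BiComplex R 0} {j : ℤ × ℤ} {f g : sphere R j ⟶ K}
    (h : f.f j (sphereGen R j) = g.f j (sphereGen R j)) : f = g := by
  refine HomologicalComplex.from_single_hom_ext ?_
  rw [← cancel_epi (HomologicalComplex.singleObjXSelf (pageShape 0) j (ModuleCat.of R R)).inv]
  exact ModuleCat.hom_ext (LinearMap.ext_ring h)

lemma d_sphereGen (j k : ℤ × ℤ) : (sphere R j).d j k (sphereGen R j) = 0 := by
  rw [HomologicalComplex.single_obj_d]
  rfl

lemma disc_hom_ext {K : BiComplex R 0} {i : ℤ × ℤ} {f g : disc R i ⟶ K}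
    (h : f.f i (discGen R i) = g.f i (discGen R i)) : f = g := by
  apply (HomologicalComplex.evalCompCoyonedaCorepresentableByDoubleId (rel_nxt 0 i) (nxt_ne 0 i)
    (ModuleCat.of R R)).homEquiv.injective
  exact ModuleCat.hom_ext (LinearMap.ext_ring h)

/-- The inclusion of the boundary sphere in the disc. -/
def sphereToDisc (R : Type u) [CommRing R] (i : ℤ × ℤ) : sphere R (nxt 0 i) ⟶ disc R i :=
  sphereDesc ((disc R i).d i (nxt 0 i) (discGen R i)) (d_d_apply _ _ _ _ _)

lemma sphereToDisc_gen (i : ℤ × ℤ) : (sphereToDisc R i).f (nxt 0 i) (sphereGen R (nxt 0 i)) =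
    (disc R i).d i (nxt 0 i) (discGen R i) := sphereDesc_gen _ _

/-- The sphere is concentrated in bidegree `nxt 0 i`, where the map is the identity of R up to
canonical isomorphisms. -/
instance mono_sphereToDisc (i : ℤ × ℤ) : Mono (sphereToDisc R i) := by
  have (k : ℤ × ℤ) : Mono ((sphereToDisc R i).f k) := by
    by_cases hk : k = nxt 0 i
    · subst hk
      have : (sphereToDisc R i).f (nxt 0 i) =
          (HomologicalComplex.singleObjXSelf (pageShape 0) (nxt 0 i) (ModuleCat.of R R)).hom ≫
          (HomologicalComplex.doubleXIso₁ (𝟙 (ModuleCat.of R R)) (rel_nxt 0 i) (nxt_ne 0 i)).inv := by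
        rw [← Iso.inv_comp_eq]
        refine ModuleCat.hom_ext (LinearMap.ext_ring ?_)
        refine (sphereToDisc_gen i).trans ?_
        rw [HomologicalComplex.double_d _ _ (nxt_ne 0 i), discGen, ← ConcreteCategory.comp_apply,
          Iso.inv_hom_id_assoc, Category.id_comp]
      rw [this]
      infer_instance
    · exact (HomologicalComplex.isZero_single_obj_X (pageShape 0) (nxt 0 i) _ k hk).mono _
  exact HomologicalComplex.mono_of_mono_f _ this

/-- The inclusions of the boundary spheres in the discs. -/
def generatingCofibrations (R : Type u) [CommRing R] : MorphismProperty (BiComplex R 0) :=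
  MorphismProperty.ofHoms (sphereToDisc R)

/-- A square from the inclusion of a sphere into a disc is a pair (a, b) with a a cycle and db = f
a, and a lift is an element c as in `surjQi_iff`. -/
lemma generatingCofibrations_rlp : (generatingCofibrations R).rlp = surjQi R 0 := by
  ext K L f
  rw [surjQi_iff]
  constructor
  · intro hf i j k hij hjk a b ha hb
    obtain rfl := eq_nxt hij
    obtain rfl := eq_nxt hjk
    have := hf _ (MorphismProperty.ofHoms.mk (f := sphereToDisc R) i)
    have sq : CommSq (sphereDesc a ha) (sphereToDisc R i) f (discDesc b) := ⟨by
      refine sphere_hom_ext ?_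
      rw [HomologicalComplex.comp_f, HomologicalComplex.comp_f, ConcreteCategory.comp_apply,
        ConcreteCategory.comp_apply, sphereDesc_gen, sphereToDisc_gen, ← comm_apply,
        discDesc_gen, hb]⟩
    refine ⟨sq.lift.f i (discGen R i), ?_, ?_⟩
    · rw [comm_apply, ← sphereToDisc_gen, ← ConcreteCategory.comp_apply,
        ← HomologicalComplex.comp_f, sq.fac_left, sphereDesc_gen]
    · rw [← ConcreteCategory.comp_apply, ← HomologicalComplex.comp_f, sq.fac_right, discDesc_gen]
  · rintro hf _ _ _ ⟨i⟩
    refine ⟨fun {u v} sq => ?_⟩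
    obtain ⟨c, hc, hc'⟩ := hf i _ _ (rel_nxt 0 i) (rel_nxt 0 _)
      (u.f _ (sphereGen R _)) (v.f i (discGen R i))
      (by rw [comm_apply, d_sphereGen, map_zero])
      (by
        rw [comm_apply, ← sphereToDisc_gen, ← ConcreteCategory.comp_apply,
          ← ConcreteCategory.comp_apply, ← HomologicalComplex.comp_f, ← HomologicalComplex.comp_f,
          sq.w])
    refine ⟨⟨⟨discDesc c, sphere_hom_ext ?_, disc_hom_ext ?_⟩⟩⟩
    · rw [HomologicalComplex.comp_f, ConcreteCategory.comp_apply, sphereToDisc_gen, ← comm_apply,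
        discDesc_gen, hc]
    · rw [HomologicalComplex.comp_f, ConcreteCategory.comp_apply, discDesc_gen, hc']

end Sphere

/-! ### The small object argument -/

section SmallObject

open MorphismProperty Limits

/-- For a regular cardinal exceeding the number of subobjects of the domains, mapping out of a
domain commutes with the colimits of chains of monomorphisms indexed by that cardinal. Relative cell
complexes are such chains. -/
lemma hasSmallObjectArgument_of_mono {C : Type*} [Category.{u} C] [Abelian C]
    [IsGrothendieckAbelian.{u} C] {T : Type*} [Small.{u} T] {A B : T → C} (f : ∀ t, A t ⟶ B t)
    [∀ t, Mono (f t)] : HasSmallObjectArgument.{u} (ofHoms f) := by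
  obtain ⟨κ, hκ', hκ⟩ := HasCardinalLT.exists_regular_cardinal.{u} (Σ t, Shrink.{u} (Subobject (A t)))
  have : Fact κ.IsRegular := ⟨hκ'⟩
  have : Nonempty κ.ord.ToType := by simpa using hκ'.ne_zero
  have := WellFoundedLT.toOrderBot κ.ord.ToType
  exact ⟨κ, inferInstance, inferInstance,
    { preservesColimit {X₁ X₂ X Y} i hi g hg := by
        let hg' : (monomorphisms C).TransfiniteCompositionOfShape κ.ord.ToType g :=
          { toTransfiniteCompositionOfShape := hg.toTransfiniteCompositionOfShape
            map_mem j hj := by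
              have := (hg.attachCells j hj).pushouts_coproducts
              simp only [ofHoms_homFamily] at this
              refine (?_ : _ ≤ monomorphisms C) _ this
              simp only [pushouts_le_iff, coproducts_le_iff]
              rintro _ _ _ ⟨t⟩
              exact inferInstanceAs (Mono (f t)) }
        have (j j' : κ.ord.ToType) (φ : j ⟶ j') : Mono (hg'.F.map φ) := hg'.mem_map φ
        apply IsGrothendieckAbelian.preservesColimit_coyoneda_obj_of_mono (Y := hg'.F) (κ := κ)
        obtain ⟨t⟩ := hi
        exact hκ.of_injective (fun S => ⟨t, equivShrink _ S⟩) (fun S S' h => by simpa using h) }⟩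

/-- The left-hand class consists of retracts of relative cell complexes, and monomorphisms are
closed under all the operations involved. -/
lemma llp_rlp_le_monomorphisms {C : Type*} [Category.{u} C] [Abelian C]
    [IsGrothendieckAbelian.{u} C] {I : MorphismProperty C} [HasSmallObjectArgument.{u} I]
    (hI : I ≤ monomorphisms C) : I.rlp.llp ≤ monomorphisms C := by
  rw [llp_rlp_of_hasSmallObjectArgument]
  trans (transfiniteCompositions.{u} (coproducts.{u} (monomorphisms C)).pushouts).retracts
  · apply retracts_monotone
    apply transfiniteCompositions_monotone
    apply pushouts_monotone
    apply coproducts_monotone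
    exact hI
  · simp

instance : HasSmallObjectArgument.{u} (generatingCofibrations R) :=
  hasSmallObjectArgument_of_mono (sphereToDisc R)

lemma generatingCofibrations_le_monomorphisms :
    generatingCofibrations R ≤ monomorphisms (BiComplex R 0) := by
  rintro _ _ _ ⟨i⟩
  exact mono_sphereToDisc i

lemma exists_factorization_complex {K L : BiComplex R 0} (f : K ⟶ L) :
    ∃ (P : BiComplex R 0) (i : K ⟶ P) (p : P ⟶ L), i ≫ p = f ∧ (surjQi R 0).llp i ∧ Mono i ∧
      surjQi R 0 p := by
  let h := factorizationData (generatingCofibrations R).rlp.llp (generatingCofibrations R).rlp f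
  refine ⟨h.Z, h.i, h.p, h.fac, ?_, ?_, ?_⟩
  · rw [← generatingCofibrations_rlp]
    exact h.hi
  · have hle : (generatingCofibrations R).rlp.llp ≤ monomorphisms (BiComplex R 0) :=
      llp_rlp_le_monomorphisms generatingCofibrations_le_monomorphisms
    exact hle _ h.hi
  · rw [← generatingCofibrations_rlp]
    exact h.hp

end SmallObject

end ESpSe

/-! ### Both factorizations at level 0. -/

namespace ESpSe

variable {R : Type u} [CommRing R]

/-! ### Free discs -/

section FreeDisc

open Limits

/-- The bigraded free module on the elements of a complex. -/
def freeGraded (L : BiComplex R 0) : BiComplex R 0 where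
  X i := ModuleCat.of R (L.X i →₀ R)
  d _ _ := 0

/-- The sum of the discs indexed by the elements of a complex. -/
def freeDisc (L : BiComplex R 0) : BiComplex R 0 where
  X i := ModuleCat.of R ((freeGraded L).X i × (freeGraded L).X (prv 0 i))
  d i j := ModuleCat.ofHom
    (LinearMap.inr R _ _ ∘ₗ (tr (freeGraded L) i (prv 0 j)).hom ∘ₗ LinearMap.fst R _ _)
  shape i j hij := by
    have h : i ≠ prv 0 j := fun h => hij (h ▸ rel_prv 0 j)
    refine ModuleCat.hom_ext (LinearMap.ext fun v => ?_)
    change ((0 : (freeGraded L).X j), tr (freeGraded L) i (prv 0 j) v.1) = 0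
    simp [tr_of_ne h]
  d_comp_d' i j k _ _ := by
    refine ModuleCat.hom_ext (LinearMap.ext fun v => ?_)
    change ((0 : (freeGraded L).X k), tr (freeGraded L) j (prv 0 k) 0) = 0
    simp

lemma freeDisc_d {L : BiComplex R 0} (i j : ℤ × ℤ) (a : (freeGraded L).X i)
    (b : (freeGraded L).X (prv 0 i)) :
    (freeDisc L).d i j ((a, b) : (freeGraded L).X i × (freeGraded L).X (prv 0 i)) =
      ((0, tr (freeGraded L) i (prv 0 j) a) : (freeGraded L).X j × (freeGraded L).X (prv 0 j)) :=
  rfl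

/-- A cycle has the form (0, b), which is the boundary of (b, 0). -/
lemma freeDisc_acyclic {L : BiComplex R 0} (i : ℤ × ℤ) (x : (freeDisc L).X i)
    (hx : (freeDisc L).d i (nxt 0 i) x = 0) : ∃ w, (freeDisc L).d (prv 0 i) i w = x := by
  obtain ⟨a, b⟩ := x
  have hi : i = prv 0 (nxt 0 i) := eq_prv (rel_nxt 0 i)
  have ha : tr (freeGraded L) i (prv 0 (nxt 0 i)) a = 0 :=
    congrArg Prod.snd ((freeDisc_d i _ a b).symm.trans hx)
  have ha' : a = 0 := (tr_bijective hi).1 (ha.trans (map_zero _).symm)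
  subst ha'
  exact ⟨((b, 0) : (freeGraded L).X (prv 0 i) × (freeGraded L).X (prv 0 (prv 0 i))),
    (freeDisc_d _ _ b 0).trans (Prod.ext rfl (tr_self_apply _ b))⟩

/-- The generators of the sum of the discs. -/
def freeDiscGen {L : BiComplex R 0} {i : ℤ × ℤ} (x : L.X i) : (freeDisc L).X i :=
  ((Finsupp.single x 1, 0) : (L.X i →₀ R) × (L.X (prv 0 i) →₀ R))

variable {K L : BiComplex R 0}

/-- The second summand consists of the boundaries of the first, and the first is free on the
generators. -/
lemma freeDisc_hom_ext {f g : freeDisc L ⟶ K}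
    (h : ∀ i (x : L.X i), f.f i (freeDiscGen x) = g.f i (freeDiscGen x)) : f = g := by
  have h₁ (i) (a : L.X i →₀ R) : f.f i ((a, 0) : (L.X i →₀ R) × (L.X (prv 0 i) →₀ R)) =
      g.f i ((a, 0) : (L.X i →₀ R) × (L.X (prv 0 i) →₀ R)) := by
    have : (f.f i).hom ∘ₗ LinearMap.inl R (L.X i →₀ R) (L.X (prv 0 i) →₀ R) =
        (g.f i).hom ∘ₗ LinearMap.inl R (L.X i →₀ R) (L.X (prv 0 i) →₀ R) := by
      refine Finsupp.lhom_ext' fun x => LinearMap.ext_ring ?_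
      exact h i x
    exact LinearMap.congr_fun this a
  have h₂ (i) (b : L.X (prv 0 i) →₀ R) :
      f.f i ((0, b) : (L.X i →₀ R) × (L.X (prv 0 i) →₀ R)) =
      g.f i ((0, b) : (L.X i →₀ R) × (L.X (prv 0 i) →₀ R)) := by
    have hb : (freeDisc L).d (prv 0 i) i
        ((b, 0) : (L.X (prv 0 i) →₀ R) × (L.X (prv 0 (prv 0 i)) →₀ R)) =
        ((0, b) : (L.X i →₀ R) × (L.X (prv 0 i) →₀ R)) :=
      Prod.ext rfl (tr_self_apply (K := freeGraded L) _ b)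
    refine (congrArg (f.f i) hb).symm.trans ((comm_apply f _ _ _).symm.trans
      (Eq.trans ?_ ((comm_apply g _ _ _).trans (congrArg (g.f i) hb))))
    exact congrArg (K.d (prv 0 i) i) (h₁ _ b)
  refine hom_ext_apply fun i x => ?_
  obtain ⟨a, b⟩ := x
  have hab : ((a, b) : (L.X i →₀ R) × (L.X (prv 0 i) →₀ R)) = (a, 0) + (0, b) :=
    Prod.ext (add_zero a).symm (zero_add b).symm
  refine (congrArg (f.f i) hab).trans (Eq.trans ?_ (congrArg (g.f i) hab).symm)
  exact ((f.f i).hom.map_add _ _).trans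
    ((congrArg₂ (· + ·) (h₁ i a) (h₂ i b)).trans ((g.f i).hom.map_add _ _).symm)

/-- The morphism from the sum of the discs given by the images of the generators. -/
def freeDiscDesc (φ : ∀ i, L.X i → K.X i) : freeDisc L ⟶ K where
  f i := ModuleCat.ofHom (LinearMap.coprod (Finsupp.lift (K.X i) R (L.X i) (φ i))
    ((K.d (prv 0 i) i).hom ∘ₗ Finsupp.lift (K.X (prv 0 i)) R (L.X (prv 0 i)) (φ (prv 0 i))))
  comm' i j hij := by
    obtain rfl := eq_prv hij
    refine ModuleCat.hom_ext (LinearMap.ext fun v => ?_)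
    obtain ⟨a, b⟩ := v
    change K.d (prv 0 j) j (Finsupp.lift (K.X _) R (L.X _) (φ _) a +
      K.d _ _ (Finsupp.lift (K.X _) R (L.X _) (φ _) b)) =
      Finsupp.lift (K.X j) R (L.X j) (φ j) 0 + K.d (prv 0 j) j
        (Finsupp.lift (K.X _) R (L.X _) (φ _) (tr (freeGraded L) (prv 0 j) (prv 0 j) a))
    rw [tr_self_apply, map_add, d_d_apply, map_zero, add_zero, zero_add]

lemma freeDiscDesc_gen (φ : ∀ i, L.X i → K.X i) {i : ℤ × ℤ} (x : L.X i) :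
    (freeDiscDesc φ).f i (freeDiscGen x) = φ i x := by
  change Finsupp.lift (K.X i) R (L.X i) (φ i) (Finsupp.single x 1) +
      K.d (prv 0 i) i (Finsupp.lift (K.X (prv 0 i)) R (L.X (prv 0 i)) (φ (prv 0 i)) 0) = φ i x
  simp

lemma exists_freeDisc_lift {M : BiComplex R 0} (p : K ⟶ M)
    (hp : ∀ i, Function.Surjective (p.f i)) (v : freeDisc L ⟶ M) : ∃ l, l ≫ p = v := by
  choose φ hφ using fun i (x : L.X i) => hp i (v.f i (freeDiscGen x))
  refine ⟨freeDiscDesc φ, freeDisc_hom_ext fun i x => ?_⟩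
  rw [HomologicalComplex.comp_f, ConcreteCategory.comp_apply, freeDiscDesc_gen, hφ]

/-- Only the summand `freeDisc L` needs to be lifted, and it is projective with respect to
bidegreewise surjections. -/
lemma hasLiftingProperty_inl_freeDisc {M N : BiComplex R 0} (p : M ⟶ N)
    (hp : ∀ i, Function.Surjective (p.f i)) :
    HasLiftingProperty (biprod.inl : K ⟶ K ⊞ freeDisc L) p where
  sq_hasLift {u v} sq := by
    obtain ⟨l, hl⟩ := exists_freeDisc_lift p hp (biprod.inr ≫ v)
    refine ⟨⟨⟨biprod.desc u l, by simp, ?_⟩⟩⟩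
    apply biprod.hom_ext' <;> simp [hl, sq.w]

/-- The complementary summand is acyclic. -/
instance quasiIso_inl_freeDisc : QuasiIso (biprod.inl : K ⟶ K ⊞ freeDisc L) := by
  have htot (i) (y : (K ⊞ freeDisc L).X i) :
      y = (biprod.inl : K ⟶ K ⊞ freeDisc L).f i ((biprod.fst : K ⊞ freeDisc L ⟶ K).f i y) +
        (biprod.inr : freeDisc L ⟶ K ⊞ freeDisc L).f i
          ((biprod.snd : K ⊞ freeDisc L ⟶ freeDisc L).f i y) :=
    (congrArg (fun g : K ⊞ freeDisc L ⟶ K ⊞ freeDisc L => g.f i y) biprod.total).symm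
  have hfst (i) (x : K.X i) : (biprod.fst : K ⊞ freeDisc L ⟶ K).f i
      ((biprod.inl : K ⟶ K ⊞ freeDisc L).f i x) = x :=
    congrArg (fun g : K ⟶ K => g.f i x) (biprod.inl_fst (X := K) (Y := freeDisc L))
  refine quasiIso_of_elements _ (prv 0) (nxt 0) (rel_prv 0) (rel_nxt 0) ?_ ?_
  · intro i x _ w hw
    exact ⟨(biprod.fst : K ⊞ freeDisc L ⟶ K).f _ w, by rw [comm_apply, hw, hfst]⟩
  · intro i y hy
    obtain ⟨w, hw⟩ := freeDisc_acyclic i ((biprod.snd : K ⊞ freeDisc L ⟶ freeDisc L).f i y)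
      (by rw [comm_apply, hy, map_zero])
    exact ⟨(biprod.fst : K ⊞ freeDisc L ⟶ K).f i y, by rw [comm_apply, hy, map_zero],
      (biprod.inr : freeDisc L ⟶ K ⊞ freeDisc L).f _ w, by rw [comm_apply, hw, ← htot]⟩

end FreeDisc

/-! ### Changing the page zero -/

section PageZero

variable {X Y : ESpSe R}

/-- The extended spectral sequence obtained from `X` by replacing the page `0` by the target of a
morphism. -/
def pushPageZero (X : ESpSe R) {K : BiComplex R 0} (g : X.page 0 ⟶ K) : ESpSe R where
  page r :=
    match r with
    | 0 => K
    | r + 1 => X.page (r + 1)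
  φ r i :=
    match r with
    | 0 => X.φ 0 i ≫ HomologicalComplex.homologyMap g i
    | r + 1 => X.φ (r + 1) i

/-- The morphism from `X` to `X.pushPageZero g`. -/
def toPushPageZero (X : ESpSe R) {K : BiComplex R 0} (g : X.page 0 ⟶ K) :
    X ⟶ X.pushPageZero g where
  page r :=
    match r with
    | 0 => g
    | r + 1 => 𝟙 (X.page (r + 1))
  comm r i :=
    match r with
    | 0 => Category.id_comp _
    | r + 1 => (Category.id_comp (X.φ (r + 1) i)).trans
        ((Category.comp_id (X.φ (r + 1) i)).symm.trans
          (congrArg (X.φ (r + 1) i ≫ ·) (HomologicalComplex.homologyMap_id _ _).symm))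

/-- The morphisms from `X.pushPageZero g`. -/
def pushPageZeroDesc {K : BiComplex R 0} {g : X.page 0 ⟶ K} (f : X ⟶ Y) (h : K ⟶ Y.page 0)
    (w : g ≫ h = f.page 0) : X.pushPageZero g ⟶ Y where
  page r :=
    match r with
    | 0 => h
    | r + 1 => f.page (r + 1)
  comm r i :=
    match r with
    | 0 => by
      change (f.page 1).f i ≫ Y.φ 0 i = (X.φ 0 i ≫ HomologicalComplex.homologyMap g i) ≫
        HomologicalComplex.homologyMap h i
      rw [Category.assoc, ← HomologicalComplex.homologyMap_comp, w, f.comm]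
    | r + 1 => f.comm (r + 1) i

/-- The object `X.pushPageZero g` is X with only page 0 changed, so on higher pages the lift is u
itself. -/
lemma hasLiftingProperty_toPushPageZero {K : BiComplex R 0} (g : X.page 0 ⟶ K) {A B : ESpSe R}
    (p : A ⟶ B) [HasLiftingProperty g (p.page 0)] :
    HasLiftingProperty (X.toPushPageZero g) p where
  sq_hasLift {u v} sq := by
    have sq₀ : CommSq (u.page 0) g (p.page 0) (Hom.page v 0) :=
      ⟨congrArg (fun k => Hom.page k 0) sq.w⟩
    have : sq₀.HasLift := HasLiftingProperty.sq_hasLift (i := g) (p := p.page 0) sq₀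
    refine ⟨⟨⟨pushPageZeroDesc u sq₀.lift sq₀.fac_left, ?_, ?_⟩⟩⟩
    · ext (_ | r) : 1
      · exact sq₀.fac_left
      · exact Category.id_comp _
    · ext (_ | r) : 1
      · exact sq₀.fac_right
      · exact (congrArg (fun k => Hom.page k (r + 1)) sq.w).trans (Category.id_comp _)

/-- The extended spectral sequence obtained from `Y` by replacing the page `0` by the source of a
quasi-isomorphism. -/
def pullPageZero (Y : ESpSe R) {K : BiComplex R 0} (p : K ⟶ Y.page 0) [QuasiIso p] : ESpSe R where
  page r :=
    match r with
    | 0 => K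
    | r + 1 => Y.page (r + 1)
  φ r i :=
    match r with
    | 0 => Y.φ 0 i ≫ inv (HomologicalComplex.homologyMap p i)
    | r + 1 => Y.φ (r + 1) i

/-- The morphism from `Y.pullPageZero p` to `Y`. -/
def fromPullPageZero (Y : ESpSe R) {K : BiComplex R 0} (p : K ⟶ Y.page 0) [QuasiIso p] :
    Y.pullPageZero p ⟶ Y where
  page r :=
    match r with
    | 0 => p
    | r + 1 => 𝟙 (Y.page (r + 1))
  comm r i :=
    match r with
    | 0 => by
      change 𝟙 _ ≫ Y.φ 0 i = (Y.φ 0 i ≫ inv (HomologicalComplex.homologyMap p i)) ≫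
        HomologicalComplex.homologyMap p i
      simp
    | r + 1 => (Category.id_comp (Y.φ (r + 1) i)).trans
        ((Category.comp_id (Y.φ (r + 1) i)).symm.trans
          (congrArg (Y.φ (r + 1) i ≫ ·) (HomologicalComplex.homologyMap_id _ _).symm))

/-- The morphisms to `Y.pullPageZero p`. -/
def pullPageZeroLift {K : BiComplex R 0} {p : K ⟶ Y.page 0} [QuasiIso p] (f : X ⟶ Y)
    (h : X.page 0 ⟶ K) (w : h ≫ p = f.page 0) : X ⟶ Y.pullPageZero p where
  page r :=
    match r with
    | 0 => h
    | r + 1 => f.page (r + 1)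
  comm r i :=
    match r with
    | 0 => by
      change (f.page 1).f i ≫ Y.φ 0 i ≫ inv (HomologicalComplex.homologyMap p i) =
        X.φ 0 i ≫ HomologicalComplex.homologyMap h i
      rw [← cancel_mono (HomologicalComplex.homologyMap p i)]
      simp only [Category.assoc, IsIso.inv_hom_id, Category.comp_id]
      rw [← HomologicalComplex.homologyMap_comp, w, f.comm]
    | r + 1 => f.comm (r + 1) i

/-- Lifts are chosen page by page, uniquely above page 0. They commute with the characteristic maps
because H(p) is an isomorphism on every page and can be cancelled. -/
lemma hasLiftingProperty_of_weq_zero (i : X ⟶ Y) {A B : ESpSe R} (p : A ⟶ B) (hp : weq R 0 p)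
    [HasLiftingProperty (i.page 0) (p.page 0)] : HasLiftingProperty i p where
  sq_hasLift {u v} sq := by
    have hp' (s : ℕ) : IsIso (p.page (s + 1)) := hp.2 _ s.succ_pos
    have hq (s : ℕ) : QuasiIso (p.page s) :=
      match s with
      | 0 => hp.1
      | s + 1 => inferInstance
    have sq' (s : ℕ) : CommSq (u.page s) (i.page s) (p.page s) (v.page s) :=
      ⟨congrArg (fun k => Hom.page k s) sq.w⟩
    have hl (s : ℕ) : (sq' s).HasLift :=
      match s with
      | 0 => inferInstance
      | s + 1 => inferInstance
    refine ⟨⟨⟨⟨fun s => (sq' s).lift, fun s j => ?_⟩, ?_, ?_⟩⟩⟩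
    · rw [← cancel_mono (HomologicalComplex.homologyMap (p.page s) j), Category.assoc,
        Category.assoc, ← HomologicalComplex.homologyMap_comp, CommSq.fac_right, ← p.comm,
        ← Category.assoc, ← HomologicalComplex.comp_f, CommSq.fac_right, v.comm]
    · ext s : 1
      exact (sq' s).fac_left
    · ext s : 1
      exact (sq' s).fac_right

end PageZero

/-! ### Factorizations for the page zero -/

section Factorization

variable {X Y : ESpSe R}

open Limits

/-- Adding to X_0 a disc for each element of Y_0 makes page 0 surjective without changing its
homology or the higher pages. -/
lemma exists_factorization_freeDisc (f : X ⟶ Y) :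
    ∃ (Z : ESpSe R) (i : X ⟶ Z) (p : Z ⟶ Y), i ≫ p = f ∧ (fib R 0).llp i ∧ weq R 0 i ∧
      (∀ j, Function.Injective ((i.page 0).f j)) ∧ fib R 0 p := by
  let g : X.page 0 ⟶ X.page 0 ⊞ freeDisc (Y.page 0) := biprod.inl
  let h : X.page 0 ⊞ freeDisc (Y.page 0) ⟶ Y.page 0 :=
    biprod.desc (f.page 0) (freeDiscDesc fun _ x => x)
  have w : g ≫ h = f.page 0 := biprod.inl_desc _ _
  refine ⟨X.pushPageZero g, X.toPushPageZero g, pushPageZeroDesc f h w, ?_, ?_, ⟨?_, ?_⟩, ?_, ?_⟩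
  · ext (_ | r) : 1
    · exact w
    · exact Category.id_comp _
  · intro A B p hp
    have : HasLiftingProperty g (p.page 0) := hasLiftingProperty_inl_freeDisc _ (hp 0 le_rfl)
    exact hasLiftingProperty_toPushPageZero g p
  · exact quasiIso_inl_freeDisc
  · rintro (_ | s) hs
    · exact (lt_irrefl _ hs).elim
    · exact inferInstanceAs (IsIso (𝟙 (X.page (s + 1))))
  · intro j
    have : Mono (g.f j) := inferInstance
    exact (ModuleCat.mono_iff_injective _).1 this
  · intro s hs
    obtain rfl := Nat.le_zero.1 hs
    intro j y
    refine ⟨(biprod.inr : _ ⟶ X.page 0 ⊞ freeDisc (Y.page 0)).f j (freeDiscGen y), ?_⟩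
    have := congrArg (fun k : freeDisc (Y.page 0) ⟶ Y.page 0 => k.f j (freeDiscGen y))
      (biprod.inr_desc (f.page 0) (freeDiscDesc fun j (x : (Y.page 0).X j) => x))
    exact this.trans (freeDiscDesc_gen _ y)

/-- Page 0 is factored as a complex through P. Since P ⟶ Y_0 is a quasi-isomorphism, `φ 0` of Y
lifts to H(P), and P can replace the page 0 of Y. -/
lemma exists_factorization_zero (f : X ⟶ Y) :
    ∃ (Z : ESpSe R) (i : X ⟶ Z) (p : Z ⟶ Y), i ≫ p = f ∧ (fib R 0 ⊓ weq R 0).llp i ∧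
      (∀ j, Function.Injective ((i.page 0).f j)) ∧ (fib R 0 ⊓ weq R 0) p := by
  obtain ⟨P, g, h, w, hg, hg', hh⟩ := exists_factorization_complex (f.page 0)
  have := hh.2
  refine ⟨Y.pullPageZero h, pullPageZeroLift f g w, Y.fromPullPageZero h, ?_, ?_, ?_, ?_, ?_, ?_⟩
  · ext (_ | r) : 1
    · exact w
    · exact Category.comp_id _
  · intro A B p hp
    have : HasLiftingProperty (Hom.page (pullPageZeroLift f g w) 0) (p.page 0) :=
      hg (p.page 0) ⟨hp.1 0 le_rfl, hp.2.1⟩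
    exact hasLiftingProperty_of_weq_zero _ p hp.2
  · intro j
    have : Mono (g.f j) := inferInstance
    exact (ModuleCat.mono_iff_injective _).1 this
  · intro s hs
    obtain rfl := Nat.le_zero.1 hs
    exact hh.1
  · exact hh.2
  · rintro (_ | s) hs
    · exact (lt_irrefl _ hs).elim
    · exact inferInstanceAs (IsIso (𝟙 (Y.page (s + 1))))

end Factorization

end ESpSe

/-! ### Transfer of factorizations from level r to level r + 1. -/

namespace ESpSe

variable {R : Type u} [CommRing R]

/-! ### Weak equivalences and fibrations -/

section Classes

variable {X Y Z : ESpSe R}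

instance (r : ℕ) : (weq R r).HasTwoOutOfThreeProperty where
  comp_mem f g hf hg := by
    have := hf.1
    have := hg.1
    refine ⟨inferInstanceAs (QuasiIso (f.page r ≫ g.page r)), fun s hs => ?_⟩
    have := hf.2 s hs
    have := hg.2 s hs
    exact inferInstanceAs (IsIso (f.page s ≫ g.page s))
  of_postcomp f g hg hfg := by
    have := hg.1
    refine ⟨(quasiIso_iff_comp_right (f.page r) (g.page r)).1 hfg.1, fun s hs => ?_⟩
    have := hg.2 s hs
    have : IsIso (f.page s ≫ g.page s) := hfg.2 s hs
    exact IsIso.of_isIso_comp_right (f.page s) (g.page s)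
  of_precomp f g hf hfg := by
    have := hf.1
    refine ⟨(quasiIso_iff_comp_left (f.page r) (g.page r)).1 hfg.1, fun s hs => ?_⟩
    have := hf.2 s hs
    have : IsIso (f.page s ≫ g.page s) := hfg.2 s hs
    exact IsIso.of_isIso_comp_left (f.page s) (g.page s)

instance (r : ℕ) : (weq R r).IsStableUnderRetracts where
  of_retract {_ _ _ _ f g} h hg := by
    refine ⟨?_, fun s hs => ?_⟩
    · exact MorphismProperty.of_retract
        (P := HomologicalComplex.quasiIso (ModuleCat.{u} R) (pageShape r))
        (h.map (pageFunctor R r)) hg.1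
    · exact MorphismProperty.of_retract (P := MorphismProperty.isomorphisms _)
        (h.map (pageFunctor R s)) (hg.2 s hs)

instance (r : ℕ) : (fib R r).IsStableUnderRetracts where
  of_retract {_ _ _ _ f g} h hg := by
    intro s hs i
    have : Epi ((f.page s).f i) := MorphismProperty.of_retract
      (P := MorphismProperty.epimorphisms _)
      (h.map (pageFunctor R s ⋙ HomologicalComplex.eval (ModuleCat.{u} R) (pageShape s) i))
      ((ModuleCat.epi_iff_surjective _).2 (hg s hs i))
    exact (ModuleCat.epi_iff_surjective _).1 this

lemma fib_antitone : Antitone (fib R) := fun _ _ hrs _ _ _ hf s hs => hf s (hs.trans hrs)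

/-- Page s + 1 of `Shift f` is a bijective reindexing of page s of f, and level r + 1 puts no
condition on page 0. -/
lemma weq_shift_iff {r : ℕ} (f : X ⟶ Y) : weq R (r + 1) ((Shift R).map f) ↔ weq R r f := by
  refine and_congr (quasiIso_restrictionMap_iff (transEmb r) (f.page r) (transEmb_surjective r))
    ⟨fun h s hs => ?_, fun h s hs => ?_⟩
  · exact (isIso_restrictionMap_iff (transEmb s) (f.page s) (transEmb_surjective s)).1
      (h (s + 1) (by omega))
  · obtain _ | s := s
    · omega
    · exact (isIso_restrictionMap_iff (transEmb s) (f.page s) (transEmb_surjective s)).2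
        (h s (by omega))

instance quasiIso_ρ (X : ESpSe R) : QuasiIso (ρ X) where
  quasiIsoAt i := by
    rw [quasiIsoAt_iff_isIso_homologyMap]
    infer_instance

lemma quasiIso_nerveMap_iff (f : X ⟶ Y) : QuasiIso (nerveMap f) ↔ QuasiIso (f.page 1) := by
  rw [← quasiIso_iff_comp_right (nerveMap f) (ρ Y), ρ_naturality, quasiIso_iff_comp_left]

/-- Beyond reindexing, the only case is r = 0: the page 0 of `Dec f` is the nerve map, which ρ
compares with page 1 of f. -/
lemma weq_dec_iff {r : ℕ} (f : X ⟶ Y) : weq R r ((Dec R).map f) ↔ weq R (r + 1) f := by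
  refine and_congr ?_ ⟨fun h s hs => ?_, fun h s hs => ?_⟩
  · obtain _ | r := r
    · exact (quasiIso_restrictionMap_iff (invTransEmb 0) (nerveMap f)
        (invTransEmb_surjective 0)).trans (quasiIso_nerveMap_iff f)
    · exact quasiIso_restrictionMap_iff (invTransEmb (r + 1)) (f.page (r + 2))
        (invTransEmb_surjective (r + 1))
  · obtain _ | _ | s := s
    · omega
    · omega
    · exact (isIso_restrictionMap_iff (invTransEmb (s + 1)) (f.page (s + 2))
        (invTransEmb_surjective (s + 1))).1 (h (s + 1) (by omega))
  · obtain _ | s := s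
    · omega
    · exact (isIso_restrictionMap_iff (invTransEmb (s + 1)) (f.page (s + 2))
        (invTransEmb_surjective (s + 1))).2 (h (s + 2) (by omega))

lemma fib_shift {r : ℕ} (f : X ⟶ Y) (hf : fib R r f) : fib R (r + 1) ((Shift R).map f)
  | 0, _, i => hf 0 (Nat.zero_le r) (i.2, 2 * i.2 - i.1)
  | s + 1, hs, i => hf s (by omega) ((transEmb s).f i)

/-- Any representative of φ x' maps to y up to a boundary dw, and lifting w corrects it. -/
lemma exists_compat_of_surjective (f : X ⟶ Y)
    (h : ∀ i, Function.Surjective ((f.page 0).f i)) {i : ℤ × ℤ} {y : (Y.page 0).X i}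
    {x' : (X.page 1).X i} (hy : Compat Y 0 i y ((f.page 1).f i x')) :
    ∃ x, Compat X 0 i x x' ∧ (f.page 0).f i x = y := by
  obtain ⟨x, hx⟩ := Compat.exists_left (X := X) (r := 0) x'
  obtain ⟨w, hw⟩ := (compat_iff.1 hy).exists_sub_eq_d (rel_prv 0 i) (compat_iff.1 (hx.map f))
  obtain ⟨w, rfl⟩ := h _ w
  refine ⟨x + (X.page 0).d _ _ w, (compat_iff.1 hx).add_d w, ?_⟩
  rw [map_add, ← comm_apply, hw]
  abel

lemma nerveMap_surjective (f : X ⟶ Y) (h₀ : ∀ i, Function.Surjective ((f.page 0).f i))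
    (h₁ : ∀ i, Function.Surjective ((f.page 1).f i)) (i : ℤ × ℤ) :
    Function.Surjective ((nerveMap f).f i) := by
  rintro ⟨⟨x, x', y, y'⟩, hx, hy, hd⟩
  obtain ⟨a', rfl⟩ : ∃ a', (f.page 1).f i a' = x' := h₁ i x'
  obtain ⟨a, ha, rfl⟩ : ∃ a, Compat X 0 i a a' ∧ (f.page 0).f i a = x :=
    exists_compat_of_surjective f h₀ hx
  have hd' : (f.page 1).f (tgt i) ((X.page 1).d i (tgt i) a') = y' :=
    (comm_apply (f.page 1) i (tgt i) a').symm.trans hd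
  subst hd'
  obtain ⟨b, hb, rfl⟩ : ∃ b, Compat X 0 (tgt i) b ((X.page 1).d i (tgt i) a') ∧
    (f.page 0).f (tgt i) b = y := exists_compat_of_surjective f h₀ hy
  exact ⟨⟨(a, a', b, _), ha, hb, rfl⟩, rfl⟩

lemma fib_dec {r : ℕ} (f : X ⟶ Y) (hf : fib R (r + 1) f) : fib R r ((Dec R).map f)
  | 0, _, i => nerveMap_surjective f (hf 0 (by omega)) (hf 1 (by omega)) (invTransEmbZero.f i)
  | s + 1, hs, i => hf (s + 2) (by omega) ((invTransEmb (s + 1)).f i)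

lemma llp_shift {r : ℕ} (i : X ⟶ Y) (hi : (fib R r).llp i) :
    (fib R (r + 1)).llp ((Shift R).map i) := fun A B p hp => by
  rw [(shiftDecAdj R).hasLiftingProperty_iff]
  exact hi _ (fib_dec p hp)

lemma llp_inf_shift {r : ℕ} (i : X ⟶ Y) (hi : (fib R r ⊓ weq R r).llp i) :
    (fib R (r + 1) ⊓ weq R (r + 1)).llp ((Shift R).map i) := fun A B p hp => by
  rw [(shiftDecAdj R).hasLiftingProperty_iff]
  exact hi _ ⟨fib_dec p hp.1, (weq_dec_iff p).2 hp.2⟩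

lemma llp_ldec {r : ℕ} (i : X ⟶ Y) (hi : (fib R (r + 1)).llp i) :
    (fib R r).llp ((LDec R).map i) := fun A B p hp => by
  rw [(ldecShiftAdj R).hasLiftingProperty_iff]
  exact hi _ (fib_shift p hp)

lemma llp_inf_ldec {r : ℕ} (i : X ⟶ Y) (hi : (fib R (r + 1) ⊓ weq R (r + 1)).llp i) :
    (fib R r ⊓ weq R r).llp ((LDec R).map i) := fun A B p hp => by
  rw [(ldecShiftAdj R).hasLiftingProperty_iff]
  exact hi _ ⟨fib_shift p hp.1, (weq_shift_iff p).2 hp.2⟩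

end Classes

/-! ### The counit of the adjunction between `Shift` and `Dec` -/

section Counit

instance isIso_tr {c : ComplexShape (ℤ × ℤ)} (K : HomologicalComplex (ModuleCat.{u} R) c)
    {i j : ℤ × ℤ} [h : Fact (i = j)] : IsIso (tr K i j) := by
  obtain rfl := h.out
  rw [tr_self]
  infer_instance

lemma isIso_resTr {c c' : ComplexShape (ℤ × ℤ)} (K : HomologicalComplex (ModuleCat.{u} R) c)
    (e : c'.Embedding c) [e.IsRelIff] (e' : c.Embedding c') [e'.IsRelIff]
    (h : ∀ i, e.f (e'.f i) = i) : IsIso (resTr K e e' h) := by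
  have (i : ℤ × ℤ) : IsIso ((resTr K e e' h).f i) := by
    have : Fact (e.f (e'.f i) = i) := ⟨h i⟩
    exact inferInstanceAs (IsIso (tr K (e.f (e'.f i)) i))
  exact HomologicalComplex.Hom.isIso_of_components _

variable (X : ESpSe R)

lemma isIso_counit_page (s : ℕ) : IsIso ((shiftDecCounit X).page (s + 2)) :=
  isIso_resTr (X.page (s + 2)) (invTransEmb (s + 1)) (transEmb (s + 1))
    (invTransEmb_transEmb (s + 1))

lemma surjQi_counit_page_one : surjQi R 1 ((shiftDecCounit X).page 1) := by
  have := isIso_resTr X.nerve (invTransEmb 0) (transEmb 0) (invTransEmb_transEmb 0)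
  refine ⟨fun i => ?_, inferInstanceAs (QuasiIso (resTr X.nerve (invTransEmb 0) (transEmb 0)
    (invTransEmb_transEmb 0) ≫ ρ X))⟩
  have h : Function.Surjective
      ((resTr X.nerve (invTransEmb 0) (transEmb 0) (invTransEmb_transEmb 0)).f i) :=
    (ModuleCat.epi_iff_surjective _).1 inferInstance
  exact (ρ_surjective X i).comp h

/-- Page 1 of the counit is ρ up to reindexing, and the later pages are isomorphisms. -/
lemma surjQi_counit_page (s : ℕ) : surjQi R (s + 1) ((shiftDecCounit X).page (s + 1)) := by
  obtain _ | s := s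
  · exact surjQi_counit_page_one X
  · have := isIso_counit_page X s
    exact ⟨fun i => (ModuleCat.epi_iff_surjective _).1 inferInstance, inferInstance⟩

end Counit

/-! ### Pushouts of surjective quasi-isomorphisms -/

section Pushout

open Limits

/-- Exactness of A ⟶ B ⊞ C ⟶ D at the middle, applied to (b, 0) = (i a, -e a). -/
lemma exists_of_isPushout {A B C D : ModuleCat.{u} R} {i : A ⟶ B} {e : A ⟶ C} {k : B ⟶ D}
    {j : C ⟶ D} (h : IsPushout i e k j) (b : B) (hb : k b = 0) : ∃ a, i a = b ∧ e a = 0 := by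
  have hex := h.exact_shortComplex
  rw [ShortComplex.moduleCat_exact_iff] at hex
  obtain ⟨a, ha⟩ := hex ((biprod.inl : B ⟶ B ⊞ C) b)
    ((congrArg (fun g : B ⟶ D => g b) (biprod.inl_desc k j)).trans hb)
  refine ⟨a, ?_, neg_eq_zero.1 ?_⟩
  · refine (congrArg (fun g : A ⟶ B => g a) (biprod.lift_fst i (-e))).symm.trans ?_
    exact (congrArg (biprod.fst : B ⊞ C ⟶ B) ha).trans
      (congrArg (fun g : B ⟶ B => g b) biprod.inl_fst)
  · refine (congrArg (fun g : A ⟶ C => g a) (biprod.lift_snd i (-e))).symm.trans ?_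
    exact (congrArg (biprod.snd : B ⊞ C ⟶ C) ha).trans
      (congrArg (fun g : B ⟶ C => g b) biprod.inl_snd)

/-- Given db' = k a, lift b' to b. Then a - db lies in Ker k, hence equals i c with e c = 0, and c
is a cycle because i is injective. As e is a surjective quasi-isomorphism, c = dx with e x = 0, and
b + i x solves the problem of `surjQi_iff`. -/
lemma surjQi_of_isPushout {r : ℕ} {A B C D : BiComplex R r} {i : A ⟶ B} {e : A ⟶ C} {k : B ⟶ D}
    {j : C ⟶ D} (h : IsPushout i e k j) (hi : ∀ a, Function.Injective (i.f a))
    (he : surjQi R r e) : surjQi R r k := by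
  have hj (a) (b : B.X a) (hb : k.f a b = 0) : ∃ x, i.f a x = b ∧ e.f a x = 0 :=
    exists_of_isPushout (h.map (HomologicalComplex.eval (ModuleCat.{u} R) (pageShape r) a)) b hb
  have hk (a) : Function.Surjective (k.f a) := by
    have : Epi e := HomologicalComplex.epi_of_epi_f _
      fun a => (ModuleCat.epi_iff_surjective _).2 (he.1 a)
    have : Epi k := MorphismProperty.of_isPushout (P := MorphismProperty.epimorphisms _) h this
    exact (ModuleCat.epi_iff_surjective _).1 inferInstance
  rw [surjQi_iff] at he ⊢
  intro l m n hlm hmn a b ha hb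
  obtain ⟨b, rfl⟩ := hk _ b
  obtain ⟨c, hc, hc'⟩ := hj m (a - B.d l m b) (by rw [map_sub, ← hb, comm_apply, sub_self])
  obtain ⟨x, rfl, hx⟩ := he l m n hlm hmn c 0
    (hi _ (by rw [map_zero, ← comm_apply, hc, map_sub, ha, d_d_apply, sub_zero]))
    (by rw [hc', map_zero])
  refine ⟨b + i.f l x, ?_, ?_⟩
  · rw [map_add, comm_apply, hc]
    abel
  · have : k.f l (i.f l x) = j.f l (e.f l x) :=
      congrArg (fun g : A ⟶ D => g.f l x) h.w
    rw [map_add, this, hx, map_zero, add_zero]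

end Pushout

/-! ### Factorizations -/

section Factorization

open Limits

variable {X Y Z : ESpSe R}

/-- Pushing `Shift i` out along the counit at X gives j, a cobase change of `Shift i`, while k
compares the pushout with `Shift Z`. Two-out-of-three then carries weak equivalences across, as k
and both counits are quasi-isomorphisms on page r + 1 and isomorphisms above. Page 0 of f' is not
controlled. -/
lemma exists_factorization_of_dec {r : ℕ} (f : X ⟶ Y) (i : (Dec R).obj X ⟶ Z)
    (p : Z ⟶ (Dec R).obj Y) (w : i ≫ p = (Dec R).map f)
    (hi : r = 0 → ∀ a, Function.Injective ((i.page 0).f a)) (hp : fib R r p) :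
    ∃ (X' : ESpSe R) (j : X ⟶ X') (f' : X' ⟶ Y), j ≫ f' = f ∧
      (∀ W : MorphismProperty (ESpSe R), W.llp ((Shift R).map i) → W.llp j) ∧
      (weq R r p → weq R (r + 1) f') ∧ (weq R r i → weq R (r + 1) j) ∧
      (∀ s ≤ r, ∀ a, Function.Surjective ((f'.page (s + 1)).f a)) := by
  have w' : (Shift R).map i ≫ (Shift R).map p ≫ shiftDecCounit Y = shiftDecCounit X ≫ f := by
    rw [← Category.assoc, ← Functor.map_comp, w]
    exact (shiftDecAdj R).counit.naturality f
  let k := pushout.inl ((Shift R).map i) (shiftDecCounit X)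
  let j := pushout.inr ((Shift R).map i) (shiftDecCounit X)
  let f' := pushout.desc ((Shift R).map p ≫ shiftDecCounit Y) f w'
  have hpo : IsPushout ((Shift R).map i) (shiftDecCounit X) k j := IsPushout.of_hasPushout _ _
  have hpage (s : ℕ) : IsPushout (((Shift R).map i).page s) ((shiftDecCounit X).page s) (k.page s)
      (j.page s) := hpo.map (pageFunctor R s)
  have hkiso (s : ℕ) : IsIso (k.page (s + 2)) :=
    MorphismProperty.of_isPushout (P := MorphismProperty.isomorphisms _) (hpage (s + 2))
      (isIso_counit_page X s)
  have hkqi : QuasiIso (k.page (r + 1)) := by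
    obtain _ | r := r
    -- Page 1 of `Shift i` is page 0 of i, so this is where injectivity on page 0 is needed.
    · exact (surjQi_of_isPushout (hpage 1) (fun a => hi rfl _) (surjQi_counit_page X 0)).2
    · have := hkiso r
      infer_instance
  have hj (s : ℕ) : (shiftDecCounit X).page s ≫ j.page s =
      Hom.page ((Shift R).map i) s ≫ k.page s := (hpage s).w.symm
  have hf' (s : ℕ) : k.page s ≫ f'.page s =
      Hom.page ((Shift R).map p) s ≫ (shiftDecCounit Y).page s :=
    congrArg (fun g => Hom.page g s) (pushout.inl_desc _ _ w')
  refine ⟨_, j, f', pushout.inr_desc _ _ _, fun W hW => MorphismProperty.of_isPushout hpo.flip hW,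
    fun h => ?_, fun h => ?_, fun s hs a => ?_⟩
  · have hs := (weq_shift_iff p).2 h
    constructor
    · have := hs.1
      have := (surjQi_counit_page Y r).2
      rw [← quasiIso_iff_comp_left (k.page (r + 1)), hf']
      infer_instance
    · rintro (_ | _ | s) hs'
      · omega
      · omega
      · have := hkiso s
        have := isIso_counit_page Y s
        have := hs.2 _ hs'
        have : IsIso (k.page (s + 2) ≫ f'.page (s + 2)) := by
          rw [hf']
          infer_instance
        exact IsIso.of_isIso_comp_left (k.page (s + 2)) _
  · have hs := (weq_shift_iff i).2 h
    constructor
    · have := hs.1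
      have := (surjQi_counit_page X r).2
      rw [← quasiIso_iff_comp_left ((shiftDecCounit X).page (r + 1)), hj]
      infer_instance
    · rintro (_ | _ | s) hs'
      · omega
      · omega
      · have := hkiso s
        have := isIso_counit_page X s
        have := hs.2 _ hs'
        have : IsIso ((shiftDecCounit X).page (s + 2) ≫ j.page (s + 2)) := by
          rw [hj]
          infer_instance
        exact IsIso.of_isIso_comp_left ((shiftDecCounit X).page (s + 2)) _
  · have h₁ : Function.Surjective ((((Shift R).map p).page (s + 1)).f a) :=
      fib_shift p hp (s + 1) (by omega) a
    have h₂ := ((surjQi_counit_page Y s).1 a).comp h₁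
    have h₃ : ⇑((f'.page (s + 1)).f a) ∘ ⇑((k.page (s + 1)).f a) =
        ⇑(((shiftDecCounit Y).page (s + 1)).f a) ∘ ⇑((((Shift R).map p).page (s + 1)).f a) :=
      congrArg (fun g : ((Shift R).obj Z).page (s + 1) ⟶ Y.page (s + 1) => ⇑(g.f a))
        (hf' (s + 1))
    rw [← h₃] at h₂
    exact h₂.of_comp

lemma exists_factorization_fib (r : ℕ) : ∀ {X Y : ESpSe R} (f : X ⟶ Y),
    ∃ (Z : ESpSe R) (i : X ⟶ Z) (p : Z ⟶ Y), i ≫ p = f ∧ (fib R r).llp i ∧ weq R r i ∧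
      (r = 0 → ∀ j, Function.Injective ((i.page 0).f j)) ∧ fib R r p := by
  induction r with
  | zero =>
    intro X Y f
    obtain ⟨Z, i, p, h, h₁, h₂, h₃, h₄⟩ := exists_factorization_freeDisc f
    exact ⟨Z, i, p, h, h₁, h₂, fun _ => h₃, h₄⟩
  | succ r hr =>
    intro X Y f
    obtain ⟨Z, i, p, w, hi, hi', hi'', hp⟩ := hr ((Dec R).map f)
    obtain ⟨X', j, f', rfl, hj, -, hj', hf'⟩ := exists_factorization_of_dec f i p w hi'' hp
    -- Free discs repair the surjectivity of page 0. Since a is an isomorphism on the pages above 0,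
    -- nothing achieved there is lost.
    obtain ⟨Z', a, b, rfl, ha, ha', -, hb⟩ := exists_factorization_freeDisc f'
    have := ha'.2
    refine ⟨Z', j ≫ a, b, Category.assoc _ _ _, ?_, ?_, fun h => (by omega), ?_⟩
    · exact MorphismProperty.comp_mem _ _ _ (hj _ (llp_shift i hi))
        (MorphismProperty.antitone_llp (fib_antitone (Nat.zero_le _)) _ ha)
    · refine MorphismProperty.comp_mem _ _ _ (hj' hi') ⟨?_, fun s hs => ha'.2 s (by omega)⟩
      have := ha'.2 (r + 1) (by omega)
      infer_instance
    · rintro (_ | s) hs c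
      · exact hb 0 le_rfl c
      · have h := hf' s (by omega) c
        exact Function.Surjective.of_comp (g := ⇑((a.page (s + 1)).f c)) h

lemma exists_factorization_inf (r : ℕ) : ∀ {X Y : ESpSe R} (f : X ⟶ Y),
    ∃ (Z : ESpSe R) (i : X ⟶ Z) (p : Z ⟶ Y), i ≫ p = f ∧ (fib R r ⊓ weq R r).llp i ∧
      (r = 0 → ∀ j, Function.Injective ((i.page 0).f j)) ∧ (fib R r ⊓ weq R r) p := by
  induction r with
  | zero =>
    intro X Y f
    obtain ⟨Z, i, p, h, h₁, h₂, h₃⟩ := exists_factorization_zero f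
    exact ⟨Z, i, p, h, h₁, fun _ => h₂, h₃⟩
  | succ r hr =>
    intro X Y f
    obtain ⟨Z, i, p, w, hi, hi'', hp⟩ := hr ((Dec R).map f)
    obtain ⟨X', j, f', rfl, hj, hp', -, hf'⟩ := exists_factorization_of_dec f i p w hi'' hp.1
    obtain ⟨Z', a, b, rfl, ha, ha', -, hb⟩ := exists_factorization_freeDisc f'
    refine ⟨Z', j ≫ a, b, Category.assoc _ _ _, ?_, fun h => (by omega), ?_, ?_⟩
    · exact MorphismProperty.comp_mem _ _ _ (hj _ (llp_inf_shift i hi))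
        (MorphismProperty.antitone_llp (inf_le_left.trans (fib_antitone (Nat.zero_le _))) _ ha)
    · rintro (_ | s) hs c
      · exact hb 0 le_rfl c
      · have h := hf' s (by omega) c
        exact Function.Surjective.of_comp (g := ⇑((a.page (s + 1)).f c)) h
    -- Both a and a ≫ b are weak equivalences at level r + 1, hence so is b.
    · have := ha'.2 (r + 1) (by omega)
      have ha'' : weq R (r + 1) a := ⟨inferInstance, fun s hs => ha'.2 s (by omega)⟩
      exact MorphismProperty.of_precomp (weq R (r + 1)) a b ha'' (hp' hp.2)

end Factorization

end ESpSe

/-! ### Model structures, cofibrant objects and Quillen equivalences. -/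

namespace ESpSe

variable {R : Type u} [CommRing R]

/-! ### The model structures -/

section Model

open MorphismProperty Limits

/-- Retract argument: i is factored as a trivial map a in the left class followed by a fibration b.
If i is a cofibration and a weak equivalence, b is a trivial fibration; in either direction i lifts
against b and is a retract of a. -/
lemma cof_inf_weq (r : ℕ) : cof R r ⊓ weq R r = (fib R r).llp := by
  apply le_antisymm
  · rintro X Y i ⟨hi, hw⟩
    obtain ⟨Z, a, b, rfl, ha, haw, -, hb⟩ := exists_factorization_fib r i
    have : HasLiftingProperty (a ≫ b) b := hi b ⟨hb, of_precomp (weq R r) a b haw hw⟩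
    exact of_retract (RetractArrow.ofLeftLiftingProperty rfl) ha
  · intro X Y i hi
    refine ⟨antitone_llp inf_le_left _ hi, ?_⟩
    obtain ⟨Z, a, b, rfl, ha, haw, -, hb⟩ := exists_factorization_fib r i
    have : HasLiftingProperty (a ≫ b) b := hi b hb
    exact of_retract (RetractArrow.ofLeftLiftingProperty rfl) haw

lemma isWeakFactorizationSystem_cof (r : ℕ) :
    IsWeakFactorizationSystem (cof R r) (fib R r ⊓ weq R r) := by
  have : HasFactorization (cof R r) (fib R r ⊓ weq R r) := ⟨fun f => by
    obtain ⟨Z, i, p, h, hi, -, hp⟩ := exists_factorization_inf r f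
    exact ⟨⟨Z, i, p, h, hi, hp⟩⟩⟩
  have : (cof R r).IsStableUnderRetracts := llp_isStableUnderRetracts _
  exact IsWeakFactorizationSystem.mk' _ _ fun i p hi hp => hi p hp

lemma isWeakFactorizationSystem_fib (r : ℕ) :
    IsWeakFactorizationSystem (cof R r ⊓ weq R r) (fib R r) := by
  rw [cof_inf_weq]
  have : HasFactorization (fib R r).llp (fib R r) := ⟨fun f => by
    obtain ⟨Z, i, p, h, hi, -, -, hp⟩ := exists_factorization_fib r f
    exact ⟨⟨Z, i, p, h, hi, hp⟩⟩⟩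
  exact IsWeakFactorizationSystem.mk' _ _ fun i p hi hp => hi p hp

variable (R) in
/-- The model category `eSpSe'_r`. -/
abbrev modelPrime (r : ℕ) : ModelCategory (ESpSe R) :=
  letI : CategoryWithFibrations (ESpSe R) := ⟨fib R r⟩
  letI : CategoryWithCofibrations (ESpSe R) := ⟨cof R r⟩
  letI : CategoryWithWeakEquivalences (ESpSe R) := ⟨weq R r⟩
  have : (weakEquivalences (ESpSe R)).HasTwoOutOfThreeProperty :=
    inferInstanceAs (weq R r).HasTwoOutOfThreeProperty
  have : IsWeakFactorizationSystem (cofibrations (ESpSe R)) (trivialFibrations (ESpSe R)) :=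
    isWeakFactorizationSystem_cof r
  have : IsWeakFactorizationSystem (trivialCofibrations (ESpSe R)) (fibrations (ESpSe R)) :=
    isWeakFactorizationSystem_fib r
  ModelCategory.mk' _

lemma isModelPrime_modelPrime (r : ℕ) : IsModelPrime (modelPrime R r) r where
  fibrations_eq := rfl
  weakEquivalences_eq := rfl
  cofibrations_eq := rfl

end Model

/-! ### The first characteristic map of a cofibrant object -/

section Cofibrant

open Limits

/-- The bigraded module of page `1`, with zero differential. -/
def gradedPageOne (X : ESpSe R) : BiComplex R 0 where
  X i := (X.page 1).X i
  d _ _ := 0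

/-- The map sending an element of page `1` to its class. -/
def gradedPageOneφ (X : ESpSe R) (i : ℤ × ℤ) :
    (X.page 1).X i ⟶ (gradedPageOne X).homology i :=
  (gradedPageOne X).liftCycles (𝟙 ((gradedPageOne X).X i)) _ rfl comp_zero ≫
    (gradedPageOne X).homologyπ i

lemma isClass_gradedPageOneφ (X : ESpSe R) (i : ℤ × ℤ) (x : (X.page 1).X i) :
    IsClass (gradedPageOne X) i x (gradedPageOneφ X i x) :=
  ⟨(gradedPageOne X).liftCycles (𝟙 ((gradedPageOne X).X i)) _ rfl comp_zero x,
    congrArg (fun g : (gradedPageOne X).X i ⟶ (gradedPageOne X).X i => g x)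
      ((gradedPageOne X).liftCycles_i _ _ _ _), rfl⟩

lemma gradedPageOneφ_injective (X : ESpSe R) (i : ℤ × ℤ) :
    Function.Injective (gradedPageOneφ X i) := by
  intro x y h
  have hx := isClass_gradedPageOneφ X i x
  rw [h] at hx
  obtain ⟨w, hw⟩ := hx.exists_sub_eq_d (rel_prv 0 i) (isClass_gradedPageOneφ X i y)
  have hw' : x - y = 0 := hw.symm
  exact sub_eq_zero.1 hw'

/-- The extended spectral sequence obtained from `X` by adding the page `1` to the page `0`, so that
the first characteristic map becomes injective. -/
def addPageOne (X : ESpSe R) : ESpSe R where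
  page r :=
    match r with
    | 0 => X.page 0 ⊞ gradedPageOne X
    | r + 1 => X.page (r + 1)
  φ r i :=
    match r with
    | 0 => X.φ 0 i ≫ HomologicalComplex.homologyMap biprod.inl i +
        gradedPageOneφ X i ≫ HomologicalComplex.homologyMap biprod.inr i
    | r + 1 => X.φ (r + 1) i

/-- Projecting to the added summand recovers the class map of a complex with zero differential,
which is injective. -/
lemma addPageOne_φ_injective (X : ESpSe R) (i : ℤ × ℤ) :
    Function.Injective (X.addPageOne.φ 0 i) := by
  have h : (X.φ 0 i ≫ HomologicalComplex.homologyMap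
        (biprod.inl : X.page 0 ⟶ X.page 0 ⊞ gradedPageOne X) i +
      gradedPageOneφ X i ≫ HomologicalComplex.homologyMap
        (biprod.inr : gradedPageOne X ⟶ X.page 0 ⊞ gradedPageOne X) i) ≫
      HomologicalComplex.homologyMap (biprod.snd : X.page 0 ⊞ gradedPageOne X ⟶ _) i =
        gradedPageOneφ X i := by
    simp only [Preadditive.add_comp, Category.assoc, ← HomologicalComplex.homologyMap_comp,
      biprod.inl_snd, biprod.inr_snd, HomologicalComplex.homologyMap_zero,
      HomologicalComplex.homologyMap_id, comp_zero, zero_add, Category.comp_id]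
  have := gradedPageOneφ_injective X i
  rw [← h] at this
  exact Function.Injective.of_comp
    (f := ⇑(HomologicalComplex.homologyMap (biprod.snd : X.page 0 ⊞ gradedPageOne X ⟶ _) i)) this

/-- The projection from `X.addPageOne` to `X`. -/
def fromAddPageOne (X : ESpSe R) : X.addPageOne ⟶ X where
  page r :=
    match r with
    | 0 => biprod.fst
    | r + 1 => 𝟙 (X.page (r + 1))
  comm r i :=
    match r with
    | 0 => by
      have h : (X.φ 0 i ≫ HomologicalComplex.homologyMap
          (biprod.inl : X.page 0 ⟶ X.page 0 ⊞ gradedPageOne X) i +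
        gradedPageOneφ X i ≫ HomologicalComplex.homologyMap
          (biprod.inr : gradedPageOne X ⟶ X.page 0 ⊞ gradedPageOne X) i) ≫
        HomologicalComplex.homologyMap (biprod.fst : X.page 0 ⊞ gradedPageOne X ⟶ _) i =
          X.φ 0 i := by
        simp only [Preadditive.add_comp, Category.assoc, ← HomologicalComplex.homologyMap_comp,
          biprod.inl_fst, biprod.inr_fst, HomologicalComplex.homologyMap_zero,
          HomologicalComplex.homologyMap_id, comp_zero, add_zero, Category.comp_id]
      exact (Category.id_comp (X.φ 0 i)).trans h.symm
    | r + 1 => (Category.id_comp (X.φ (r + 1) i)).trans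
        ((Category.comp_id (X.φ (r + 1) i)).symm.trans
          (congrArg (X.φ (r + 1) i ≫ ·) (HomologicalComplex.homologyMap_id _ _).symm))

lemma fib_fromAddPageOne (X : ESpSe R) (r : ℕ) : fib R r X.fromAddPageOne := by
  rintro (_ | s) _ i
  · have : Epi ((biprod.fst : X.page 0 ⊞ gradedPageOne X ⟶ _).f i) := inferInstance
    exact (ModuleCat.epi_iff_surjective _).1 this
  · exact Function.surjective_id

lemma weq_fromAddPageOne (X : ESpSe R) (r : ℕ) : weq R (r + 1) X.fromAddPageOne := by
  refine ⟨inferInstanceAs (QuasiIso (𝟙 (X.page (r + 1)))), ?_⟩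
  rintro (_ | s) hs
  · omega
  · exact inferInstanceAs (IsIso (𝟙 (X.page (s + 1))))

/-- Cofibrancy gives a section of the trivial fibration `fromAddPageOne`. The section is injective
on page 1 and intertwines `φ 0` of X with an injective map, so `φ 0` of X is injective. -/
lemma φ_injective_of_cof {X : ESpSe R} {r : ℕ} (hX : cof R (r + 1) (initial.to X)) (i : ℤ × ℤ) :
    Function.Injective (X.φ 0 i) := by
  have : HasLiftingProperty (initial.to X) X.fromAddPageOne :=
    hX _ ⟨fib_fromAddPageOne X _, weq_fromAddPageOne X r⟩
  have sq : CommSq (initial.to X.addPageOne) (initial.to X) X.fromAddPageOne (𝟙 X) := ⟨by simp⟩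
  have h₁ : Function.Injective (((sq.lift.page 1).f i)) := by
    have : ((sq.lift.page 1).f i) ≫ (X.fromAddPageOne.page 1).f i = 𝟙 _ :=
      congrArg (fun g : X ⟶ X => (g.page 1).f i) sq.fac_right
    exact Function.LeftInverse.injective (g := ⇑((X.fromAddPageOne.page 1).f i))
      fun x => congrArg (fun g : (X.page 1).X i ⟶ (X.page 1).X i => g x) this
  have h₂ := (addPageOne_φ_injective X i).comp h₁
  have h₃ : ⇑(X.addPageOne.φ 0 i) ∘ ⇑((sq.lift.page 1).f i) =
      ⇑(HomologicalComplex.homologyMap (sq.lift.page 0) i) ∘ ⇑(X.φ 0 i) :=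
    congrArg (fun g : (X.page 1).X i ⟶ (X.addPageOne.page 0).homology i => ⇑g) (sq.lift.comm 0 i)
  rw [h₃] at h₂
  exact h₂.of_comp

end Cofibrant

/-! ### The units of the adjunctions -/

section Unit

lemma isIso_resTrInv {c c' : ComplexShape (ℤ × ℤ)} (K : HomologicalComplex (ModuleCat.{u} R) c)
    (e : c'.Embedding c) [e.IsRelIff] (e' : c.Embedding c') [e'.IsRelIff]
    (h : ∀ i, e.f (e'.f i) = i) : IsIso (resTrInv K e e' h) := by
  have (i : ℤ × ℤ) : IsIso ((resTrInv K e e' h).f i) := by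
    have : Fact (i = e.f (e'.f i)) := ⟨(h i).symm⟩
    exact inferInstanceAs (IsIso (tr K i (e.f (e'.f i))))
  exact HomologicalComplex.Hom.isIso_of_components _

lemma isIso_shiftDecUnit_page (X : ESpSe R) (s : ℕ) : IsIso ((shiftDecUnit X).page s) := by
  obtain _ | s := s
  · have := isIso_resTrInv (X.page 0) (transEmb 0) (invTransEmb 0) (transEmb_invTransEmb 0)
    have (i : ℤ × ℤ) : IsIso (X.shiftNerve.f i) :=
      (ConcreteCategory.isIso_iff_bijective _).2 (shiftNerve_bijective X i)
    have : IsIso X.shiftNerve := HomologicalComplex.Hom.isIso_of_components _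
    have := (isIso_restrictionMap_iff (invTransEmb 0) X.shiftNerve (invTransEmb_surjective 0)).2 this
    exact inferInstanceAs (IsIso (resTrInv (X.page 0) (transEmb 0) (invTransEmb 0)
      (transEmb_invTransEmb 0) ≫ HomologicalComplex.restrictionMap X.shiftNerve (invTransEmb 0)))
  · exact isIso_resTrInv (X.page (s + 1)) (transEmb (s + 1)) (invTransEmb (s + 1))
      (transEmb_invTransEmb (s + 1))

lemma weq_shiftDecUnit (X : ESpSe R) (r : ℕ) : weq R r (shiftDecUnit X) := by
  have := isIso_shiftDecUnit_page X
  exact ⟨inferInstance, fun s _ => this s⟩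

lemma weq_ldecShiftUnit (X : ESpSe R) (r : ℕ) (hX : ∀ i, Function.Injective (X.φ 0 i)) :
    weq R (r + 1) (ldecShiftUnit X) := by
  have h (s : ℕ) : IsIso ((ldecShiftUnit X).page (s + 2)) :=
    isIso_resTrInv (X.page (s + 2)) (invTransEmb (s + 1)) (transEmb (s + 1))
      (invTransEmb_transEmb (s + 1))
  constructor
  · obtain _ | r := r
    · have := quasiIso_pageOneToCoker hX
      have := isIso_resTrInv X.coker (invTransEmb 0) (transEmb 0) (invTransEmb_transEmb 0)
      exact inferInstanceAs (QuasiIso (X.pageOneToCoker ≫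
        resTrInv X.coker (invTransEmb 0) (transEmb 0) (invTransEmb_transEmb 0)))
    · have := h r
      infer_instance
  · rintro (_ | _ | s) hs
    · omega
    · omega
    · exact h s

lemma weq_of_isIso {X Y : ESpSe R} (f : X ⟶ Y) [IsIso f] (r : ℕ) : weq R r f := by
  have (s : ℕ) : IsIso (f.page s) := inferInstanceAs (IsIso ((pageFunctor R s).map f))
  exact ⟨inferInstance, fun s _ => this s⟩

/-- Left adjoints are unique up to isomorphism, so the units of two adjunctions between the same
functors differ by an isomorphism. This permits an arbitrary adjunction in the final statement. -/
lemma weq_unit_of_weq_unit {F G : ESpSe R ⥤ ESpSe R} (adj adj' : F ⊣ G) {r : ℕ} {X : ESpSe R}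
    (h : weq R r (adj.unit.app X)) : weq R r (adj'.unit.app X) := by
  rw [← Adjunction.unit_leftAdjointUniq_hom_app adj adj' X]
  exact MorphismProperty.comp_mem _ _ _ h (weq_of_isIso _ r)

/-- The adjunct is the unit followed by G f, so two-out-of-three applies. -/
lemma weq_homEquiv_iff {F G : ESpSe R ⥤ ESpSe R} (adj : F ⊣ G) {r : ℕ} {X Y : ESpSe R}
    (h : weq R r (adj.unit.app X)) (f : F.obj X ⟶ Y) :
    weq R r (adj.homEquiv X Y f) ↔ weq R r (G.map f) := by
  rw [Adjunction.homEquiv_unit]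
  exact MorphismProperty.precomp_iff (weq R r) _ _ h

end Unit

/-! ### The Quillen equivalences -/

section Quillen

variable {M M' : ModelCategory (ESpSe R)} {r r' : ℕ}

lemma isQuillenAdjunction (hM : IsModelPrime M r) (hM' : IsModelPrime M' r')
    {F G : ESpSe R ⥤ ESpSe R} (adj : F ⊣ G)
    (h : ∀ {X Y : ESpSe R} (i : X ⟶ Y), (fib R r ⊓ weq R r).llp i →
      (fib R r' ⊓ weq R r').llp (F.map i))
    (h' : ∀ {X Y : ESpSe R} (i : X ⟶ Y), (fib R r).llp i → (fib R r').llp (F.map i)) :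
    IsQuillenAdjunction M M' adj where
  map_cofibration f hf := by
    rw [hM.cofibrations_eq] at hf
    rw [hM'.cofibrations_eq]
    exact h f hf
  map_trivialCofibration f hf := by
    rw [trivialCofibrations, hM.cofibrations_eq, hM.weakEquivalences_eq, cof_inf_weq] at hf
    rw [trivialCofibrations, hM'.cofibrations_eq, hM'.weakEquivalences_eq, cof_inf_weq]
    exact h' f hf

lemma isQuillenEquivalence_shift_dec (hM : IsModelPrime M r) (hM' : IsModelPrime M' (r + 1))
    (adj : Shift R ⊣ Dec R) : IsQuillenEquivalence M M' adj where
  toIsQuillenAdjunction := isQuillenAdjunction hM hM' adj llp_inf_shift llp_shift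
  weakEquivalence_iff X Y f _ _ := by
    rw [hM.weakEquivalences_eq, hM'.weakEquivalences_eq, weq_homEquiv_iff adj
      (weq_unit_of_weq_unit (shiftDecAdj R) adj (weq_shiftDecUnit X r)), weq_dec_iff]

lemma isQuillenEquivalence_ldec_shift (hM : IsModelPrime M (r + 1)) (hM' : IsModelPrime M' r)
    (adj : LDec R ⊣ Shift R) : IsQuillenEquivalence M M' adj where
  toIsQuillenAdjunction := isQuillenAdjunction hM hM' adj llp_inf_ldec llp_ldec
  weakEquivalence_iff X Y f hX _ := by
    have hX' : cof R (r + 1) (Limits.initial.to X) := by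
      rw [← hM.cofibrations_eq]
      exact hX.mem
    rw [hM.weakEquivalences_eq, hM'.weakEquivalences_eq, weq_homEquiv_iff adj
      (weq_unit_of_weq_unit (ldecShiftAdj R) adj
        (weq_ldecShiftUnit X r (φ_injective_of_cof hX'))), weq_shift_iff]

end Quillen

end ESpSe

end

/-- The categories `eSpSe'_r` are model categories, and `Shift ⊣ Dec` and `LDec ⊣ Shift` are
Quillen equivalences between them. -/
theorem propositionP (R : Type u) [CommRing R] :
    Limits.HasLimits (ESpSe R) ∧ Limits.HasColimits (ESpSe R) ∧
    ∃ M : ℕ → ModelCategory (ESpSe R), (∀ r : ℕ, ESpSe.IsModelPrime (M r) r) ∧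
      Nonempty (ESpSe.Shift R ⊣ ESpSe.Dec R) ∧ Nonempty (ESpSe.LDec R ⊣ ESpSe.Shift R) ∧
      ∀ r : ℕ,
        (∀ adj : ESpSe.Shift R ⊣ ESpSe.Dec R, IsQuillenEquivalence (M r) (M (r + 1)) adj) ∧
        (∀ adj : ESpSe.LDec R ⊣ ESpSe.Shift R, IsQuillenEquivalence (M (r + 1)) (M r) adj) :=
  ⟨inferInstance, inferInstance, ESpSe.modelPrime R, ESpSe.isModelPrime_modelPrime,
    ⟨ESpSe.shiftDecAdj R⟩, ⟨ESpSe.ldecShiftAdj R⟩, fun r =>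
    ⟨ESpSe.isQuillenEquivalence_shift_dec (ESpSe.isModelPrime_modelPrime r)
      (ESpSe.isModelPrime_modelPrime (r + 1)),
    ESpSe.isQuillenEquivalence_ldec_shift (ESpSe.isModelPrime_modelPrime (r + 1))
      (ESpSe.isModelPrime_modelPrime r)⟩⟩
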